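/- **Proposition (Jacobi identity).** Let $R$ be a commutative ring and $F(z,w)\in R[\![z,w]\!]$ a commutative one-dimensional formal group law, with inverse series $\iota(z)=-z+O(z^2)$, $F(z,\iota z)=0$. For $n\in\mathbb Z$ let $i_{z,w}F(z,w)^n$ and $i_{z,w}F(z,\iota w)^n$ be the $n$-th powers of $F(z,w)$ and $F(z,\iota w)$ in $R(\!(z)\!)(\!(w)\!)$, where both series are invertible, and let $i_{w,z}F(z,\iota w)^n$ be the $n$-th power of $F(z,\iota w)$ in $R(\!(w)\!)(\!(z)\!)$. The $F$-delta distribution is $$z^{-1}\delta_F\Bigl(\frac wz\Bigr)=i_{z,w}F(z,\iota w)^{-1}-i_{w,z}F(z,\iota w)^{-1}=\sum_{p,q\in\mathbb Z}d_{p,q}\,w^pz^q ,$$ and, for variables $x,y,u$, its expansions are the substitutions $$i_{x,y}\,u^{-1}\delta_F\Bigl(\frac{F(x,\iota y)}{u}\Bigr)=\sum_{p,q}d_{p,q}\,\bigl(i_{x,y}F(x,\iota y)^p\bigr)u^q,\qquad i_{y,x}\,u^{-1}\delta_F\Bigl(\frac{F(x,\iota y)}{u}\Bigr)=\sum_{p,q}d_{p,q}\,\bigl(i_{y,x}F(x,\iota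 y)^p\bigr)u^q .$$ A vertex $F$-algebra is an $R$-module $V$ with a vector $\mathbb 1\in V$, an $R$-linear map $\mathcal S(z)=\sum_{n\ge0}\mathcal S^{(n)}z^n\colon V\to V[\![z]\!]$ and an $R$-bilinear map $(a,b)\mapsto Y(a,z)b\in V(\!(z)\!)$ such that for all $a,b,c\in V$: 1. $Y(a,z)\mathbb 1\in V[\![z]\!]$, $Y(a,z)\mathbb 1|_{z=0}=a$, and $Y(\mathbb 1,z)=\mathrm{id}_V$; 2. $Y(\mathcal S(w)a,z)b=i_{z,w}Y(a,F(z,w))b$, $\mathcal S(z)\mathbb 1=\mathbb 1$, $\mathcal S(z)\circ\mathcal S(w)=\mathcal S(F(z,w))$, and $\mathcal S(0)=\mathrm{id}_V$; 3. there is $N\ge0$ with $F(z,w)^N\,Y(Y(a,z)b,w)c=F(z,w)^N\,i_{z,w}Y(a,F(z,w))Y(b,w)c$; 4. $Y(a,z)b=\mathcal S(z)\circ Y(b,\iota z)a$. Here $i_{z,w}Y(a,F(z,w))$ means that each power $v^n$ in $Y(a,v)$ is replaced by $i_{z,w}F(z,w)^n$, and in (4) each power $v^n$ in $Y(b,v)a$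 is replaced by $\iota(z)^n\in R(\!(z)\!)$. Then for every vertex $F$-algebra $V$ and all $a,b,c\in V$, all substitutions and products of bilateral Laurent series below converge (every coefficient is a sum with only finitely many nonzero terms), and in $V[\![z_0^{\pm1},z_1^{\pm1},z_2^{\pm1}]\!]$ $$i_{z_1,z_0}z_2^{-1}\delta_F\Bigl(\frac{F(z_1,\iota z_0)}{z_2}\Bigr)Y(Y(a,z_0)b,z_2)c = i_{z_1,z_2}z_0^{-1}\delta_F\Bigl(\frac{F(z_1,\iota z_2)}{z_0}\Bigr)Y(a,z_1)Y(b,z_2)c - i_{z_2,z_1}z_0^{-1}\delta_F\Bigl(\frac{F(z_1,\iota z_2)}{z_0}\Bigr)Y(b,z_2)Y(a,z_1)c .$$ -/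

import Mathlib

noncomputable section

open MvPowerSeries Finsupp

/-! ### Formal group laws: the inverse series and the expansions of `F(z, w)` and `F(z, ι w)` -/

namespace FormalGroup

variable {R : Type*} [CommRing R] (F : FormalGroup R)

theorem coeff_subst_X (f : MvPowerSeries (Fin 2) R) (a : PowerSeries R)
    (ha : PowerSeries.constantCoeff a = 0) (n : ℕ) :
    PowerSeries.coeff n (f.subst ![PowerSeries.X, a]) =
      ∑ᶠ d : Fin 2 →₀ ℕ, f.coeff d • PowerSeries.coeff n (PowerSeries.X ^ d 0 * a ^ d 1) := by
  have h : HasSubst ![(PowerSeries.X : PowerSeries R), a] :=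
    hasSubst_of_constantCoeff_zero fun s => by
      fin_cases s
      · exact PowerSeries.constantCoeff_X
      · exact ha
  rw [PowerSeries.coeff, MvPowerSeries.coeff_subst h]
  refine finsum_congr fun d => ?_
  rw [Finsupp.prod_fintype _ _ (by simp)]
  simp [PowerSeries.coeff]

theorem coeff_subst_X_zero (f : MvPowerSeries (Fin 2) R) (n : ℕ) :
    PowerSeries.coeff n (f.subst ![PowerSeries.X, (0 : PowerSeries R)]) =
      f.coeff (single 0 n) := by
  rw [coeff_subst_X f 0 (map_zero _), finsum_eq_single _ (single 0 n)]
  · simp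
  · intro d hd
    by_cases h1 : d 1 = 0
    · have h0 : d 0 ≠ n := by
        rintro rfl
        exact hd (by ext i; fin_cases i <;> simp [h1])
      simp [h1, PowerSeries.coeff_X_pow, Ne.symm h0]
    · simp [h1]

theorem coeff_single_one (n : ℕ) :
    F.toPowerSeries.coeff (single 1 n) = if n = 1 then 1 else 0 := by
  have h := congrArg (PowerSeries.coeff n) F.zeroX_eq_X
  rw [PowerSeries.coeff_X] at h
  have hX : HasSubst ![(0 : PowerSeries R), PowerSeries.X] := HasSubst.zero_X
  rw [← h, zeroX, PowerSeries.coeff, MvPowerSeries.coeff_subst hX,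
    finsum_eq_single _ (single 1 n)]
  · rw [Finsupp.prod_fintype _ _ (by simp)]
    have := PowerSeries.coeff_X_pow_self (R := R) n
    simpa [PowerSeries.coeff] using (congrArg (F.toPowerSeries.coeff (single 1 n) * ·) this).symm
  · intro d hd
    rw [Finsupp.prod_fintype _ _ (by simp)]
    by_cases h0 : d 0 = 0
    · have h1 : n ≠ d 1 := by
        rintro rfl
        exact hd (by ext i; fin_cases i <;> simp [h0])
      have := PowerSeries.coeff_X_pow (R := R) n (d 1)
      rw [if_neg h1] at this
      simpa [PowerSeries.coeff, h0] using congrArg (F.toPowerSeries.coeff d * ·) this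
    · simp [h0]

/-- If `a` and `b` agree up to degree `k`, then so do `F(z, a)` and `F(z, b)`. -/
theorem dvd_subst_sub (f : MvPowerSeries (Fin 2) R) {a b : PowerSeries R}
    (ha : PowerSeries.constantCoeff a = 0) (hb : PowerSeries.constantCoeff b = 0) {k : ℕ}
    (h : PowerSeries.X ^ k ∣ a - b) :
    PowerSeries.X ^ k ∣
      f.subst ![PowerSeries.X, a] - f.subst ![PowerSeries.X, b] := by
  rw [PowerSeries.X_pow_dvd_iff]
  intro m hm
  rw [map_sub, coeff_subst_X f a ha, coeff_subst_X f b hb, sub_eq_zero]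
  refine finsum_congr fun d => ?_
  have h1 : PowerSeries.X ^ k ∣ PowerSeries.X ^ d 0 * a ^ d 1 - PowerSeries.X ^ d 0 * b ^ d 1 := by
    rw [← mul_sub]
    exact Dvd.dvd.mul_left (h.trans (sub_dvd_pow_sub_pow _ _ _)) _
  have h2 := PowerSeries.X_pow_dvd_iff.1 h1 m hm
  rw [map_sub, sub_eq_zero] at h2
  rw [h2]

theorem coeff_subst_X_finite (f : MvPowerSeries (Fin 2) R) (a : PowerSeries R)
    (ha : PowerSeries.constantCoeff a = 0) (n : ℕ) :
    (Function.support fun d : Fin 2 →₀ ℕ =>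
      f.coeff d • PowerSeries.coeff n (PowerSeries.X ^ d 0 * a ^ d 1)).Finite := by
  have h : HasSubst ![(PowerSeries.X : PowerSeries R), a] :=
    hasSubst_of_constantCoeff_zero fun s => by
      fin_cases s
      · exact PowerSeries.constantCoeff_X
      · exact ha
  refine (MvPowerSeries.coeff_subst_finite h f (single () n)).subset ?_
  intro d hd
  simp only [Function.mem_support] at hd ⊢
  rw [Finsupp.prod_fintype _ _ (by simp)]
  simpa [PowerSeries.coeff] using hd

/-- One Newton step: it improves an approximate solution `a` of `F(z, a) = 0` by one degree. -/
theorem dvd_newton_step {a : PowerSeries R} (ha : PowerSeries.constantCoeff a = 0) {k : ℕ}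
    (h : PowerSeries.X ^ (k + 1) ∣ F.toPowerSeries.subst ![PowerSeries.X, a]) :
    PowerSeries.X ^ (k + 2) ∣ F.toPowerSeries.subst
      ![PowerSeries.X, a - F.toPowerSeries.subst ![PowerSeries.X, a]] := by
  set E := F.toPowerSeries.subst ![PowerSeries.X, a] with hE
  have hE0 : PowerSeries.constantCoeff E = 0 := by
    rw [← PowerSeries.coeff_zero_eq_constantCoeff_apply]
    exact PowerSeries.X_pow_dvd_iff.1 h 0 (by omega)
  have hb : PowerSeries.constantCoeff (a - E) = 0 := by rw [map_sub, ha, hE0, sub_zero]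
  rw [PowerSeries.X_pow_dvd_iff]
  intro m hm
  have key : PowerSeries.coeff m E -
      PowerSeries.coeff m (F.toPowerSeries.subst ![PowerSeries.X, a - E]) =
      PowerSeries.coeff m E := by
    refine (congrArg₂ (· - ·) (coeff_subst_X _ a ha m) (coeff_subst_X _ (a - E) hb m)).trans ?_
    rw [← finsum_sub_distrib
      (coeff_subst_X_finite _ a ha m) (coeff_subst_X_finite _ _ hb m),
      finsum_eq_single _ (single 1 1)]
    · rw [F.lin_coeff_Y, one_smul, one_smul, ← map_sub]
      simp
    · intro d hd
      rw [← smul_sub, ← map_sub]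
      by_cases h0 : d 0 = 0
      · have hd' : d = single 1 (d 1) := by ext i; fin_cases i <;> simp [h0]
        have h1 : d 1 ≠ 1 := fun h1 => hd (by rw [hd', h1])
        rw [hd', coeff_single_one, if_neg h1, zero_smul]
      · have h2 : PowerSeries.X ^ (k + 2) ∣
            PowerSeries.X ^ d 0 * a ^ d 1 - PowerSeries.X ^ d 0 * (a - E) ^ d 1 := by
          rw [← mul_sub, show k + 2 = 1 + (k + 1) by ring, pow_add, pow_one]
          refine mul_dvd_mul (dvd_pow_self _ h0) (h.trans ?_)
          have := sub_dvd_pow_sub_pow a (a - E) (d 1)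
          rwa [sub_sub_cancel] at this
        rw [PowerSeries.X_pow_dvd_iff.1 h2 m hm, smul_zero]
  simpa using key

/-- The inverse series `ι(z) = -z + O(z²)` with `F(z, ι z) = 0` exists. -/
theorem exists_iota : ∃ a : PowerSeries R, PowerSeries.constantCoeff a = 0 ∧
    PowerSeries.coeff 1 a = -1 ∧ F.toPowerSeries.subst ![PowerSeries.X, a] = 0 := by
  let A : ℕ → PowerSeries R := fun k => Nat.rec (0 : PowerSeries R)
    (fun _ a => a - F.toPowerSeries.subst ![PowerSeries.X, a]) k
  have hA : ∀ k, A (k + 1) = A k - F.toPowerSeries.subst ![PowerSeries.X, A k] := fun _ => rfl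
  have hA0 : F.toPowerSeries.subst ![PowerSeries.X, A 0] = PowerSeries.X := F.Xzero_eq_X
  have h1 : ∀ k, PowerSeries.constantCoeff (A k) = 0 ∧
      PowerSeries.X ^ (k + 1) ∣ F.toPowerSeries.subst ![PowerSeries.X, A k] := by
    intro k
    induction k with
    | zero => exact ⟨map_zero _, by rw [hA0]; simp⟩
    | succ k ih =>
      refine ⟨?_, F.dvd_newton_step ih.1 ih.2⟩
      rw [hA, map_sub, ih.1, ← PowerSeries.coeff_zero_eq_constantCoeff_apply (φ :=
        F.toPowerSeries.subst ![PowerSeries.X, A k]), PowerSeries.X_pow_dvd_iff.1 ih.2 0 (by omega),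
        sub_zero]
  have h2 : ∀ k l n, n ≤ k → PowerSeries.coeff n (A (k + l)) = PowerSeries.coeff n (A k) := by
    intro k l n hn
    induction l with
    | zero => rfl
    | succ l ih =>
      rw [← add_assoc, hA, map_sub, PowerSeries.X_pow_dvd_iff.1 (h1 (k + l)).2 n (by omega), ih,
        sub_zero]
  have h3 : ∀ k n, n ≤ k → PowerSeries.coeff n (A k) = PowerSeries.coeff n (A n) := by
    intro k n hn
    obtain ⟨l, rfl⟩ := Nat.exists_eq_add_of_le hn
    exact h2 n l n le_rfl
  have hc : PowerSeries.constantCoeff (PowerSeries.mk fun n => PowerSeries.coeff n (A n)) = 0 := by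
    rw [← PowerSeries.coeff_zero_eq_constantCoeff_apply, PowerSeries.coeff_mk]
    exact (PowerSeries.coeff_zero_eq_constantCoeff_apply _).trans (h1 0).1
  refine ⟨PowerSeries.mk fun n => PowerSeries.coeff n (A n), hc, ?_, ?_⟩
  · rw [PowerSeries.coeff_mk, show A 1 = _ from hA 0, hA0]
    simp [A]
  · ext n
    have h4 : PowerSeries.X ^ (n + 1) ∣
        (PowerSeries.mk fun n => PowerSeries.coeff n (A n)) - A n := by
      rw [PowerSeries.X_pow_dvd_iff]
      intro m hm
      rw [map_sub, PowerSeries.coeff_mk, h3 n m (by omega), sub_self]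
    have h5 := PowerSeries.X_pow_dvd_iff.1
      (dvd_subst_sub F.toPowerSeries hc (h1 n).1 h4) n (by omega)
    rw [map_sub, PowerSeries.X_pow_dvd_iff.1 (h1 n).2 n (by omega), sub_zero] at h5
    rw [h5, map_zero]

/-- The inverse series `ι(z) ∈ R⟦z⟧` of a formal group law: `ι(z) = -z + O(z²)` and
`F(z, ι z) = 0`. -/
def iota : PowerSeries R := F.exists_iota.choose

theorem constantCoeff_iota : PowerSeries.constantCoeff F.iota = 0 := F.exists_iota.choose_spec.1

theorem coeff_one_iota : PowerSeries.coeff 1 F.iota = -1 := F.exists_iota.choose_spec.2.1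

theorem subst_iota : F.toPowerSeries.subst ![PowerSeries.X, F.iota] = 0 :=
  F.exists_iota.choose_spec.2.2

/-- The inverse series is determined by `F(z, ι z) = 0` (and `ι(0) = 0`). -/
theorem eq_iota [F.IsComm] {a : PowerSeries R} (ha : PowerSeries.constantCoeff a = 0)
    (h : F.toPowerSeries.subst ![PowerSeries.X, a] = 0) : a = F.iota := by
  let x : F.Point Unit := ⟨PowerSeries.X, PowerSeries.HasSubst.X'⟩
  let y : F.Point Unit := ⟨a, PowerSeries.HasSubst.of_constantCoeff_zero' ha⟩
  let z : F.Point Unit := ⟨F.iota, PowerSeries.HasSubst.of_constantCoeff_zero' F.constantCoeff_iota⟩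
  have h1 : x + y = 0 := Subtype.ext h
  have h2 : x + z = 0 := Subtype.ext F.subst_iota
  have h3 : y = z := by
    rw [← _root_.add_zero y, ← h2, ← add_assoc, add_comm y x, h1, _root_.zero_add]
  exact congrArg Subtype.val h3

/-- `F(z, ι w) ∈ R⟦z, w⟧`, with `z = X 0` and `w = X 1`. -/
def diff : MvPowerSeries (Fin 2) R :=
  F.toPowerSeries.subst ![X 0, F.iota.subst (X 1 : MvPowerSeries (Fin 2) R)]

/-- `F(z, ι w) ∈ R⟦w, z⟧`, with `w = X 0` and `z = X 1`. -/
def diffSwap : MvPowerSeries (Fin 2) R :=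
  F.toPowerSeries.subst ![X 1, F.iota.subst (X 0 : MvPowerSeries (Fin 2) R)]

/-- The natural inclusion `R⟦x, y⟧ ⊆ R((x))((y))`, where `x = X 0` and `y = X 1`. The coefficient of
`x ^ m * y ^ n` of `f : R((x))((y))` is `(f.coeff n).coeff m`. -/
def iterated (f : MvPowerSeries (Fin 2) R) : LaurentSeries (LaurentSeries R) :=
  HahnSeries.ofPowerSeries ℤ (LaurentSeries R) <| PowerSeries.mk fun n =>
    HahnSeries.ofPowerSeries ℤ R <| PowerSeries.mk fun m => f.coeff (single 0 m + single 1 n)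

theorem isUnit_iterated {f : MvPowerSeries (Fin 2) R}
    (h : IsUnit (HahnSeries.ofPowerSeries ℤ R (f.subst ![PowerSeries.X, (0 : PowerSeries R)]))) :
    IsUnit (iterated f) := by
  refine IsUnit.map (HahnSeries.ofPowerSeries ℤ (LaurentSeries R)) ?_
  rw [PowerSeries.isUnit_iff_constantCoeff, ← PowerSeries.coeff_zero_eq_constantCoeff_apply,
    PowerSeries.coeff_mk]
  convert h using 2
  ext m
  rw [PowerSeries.coeff_mk]
  exact (by simp : f.coeff (single 0 m + single 1 0) = f.coeff (single 0 m)).trans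
    (coeff_subst_X_zero f m).symm

theorem isUnit_ofPowerSeries_X :
    IsUnit (HahnSeries.ofPowerSeries ℤ R (PowerSeries.X : PowerSeries R)) := by
  rw [HahnSeries.ofPowerSeries_X]
  refine IsUnit.of_mul_eq_one (HahnSeries.single (-1) 1) ?_
  rw [HahnSeries.single_mul_single]
  simp

/-- `ι(z)` is invertible in `R((z))`. -/
theorem isUnit_iota : IsUnit (HahnSeries.ofPowerSeries ℤ R F.iota) := by
  obtain ⟨u, hu⟩ : PowerSeries.X ∣ F.iota := PowerSeries.X_dvd_iff.2 F.constantCoeff_iota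
  have hu1 : IsUnit u := by
    rw [PowerSeries.isUnit_iff_constantCoeff]
    have h := F.coeff_one_iota
    rw [hu, PowerSeries.coeff_one_mul] at h
    simp at h
    rw [h]
    exact isUnit_one.neg
  rw [hu, map_mul]
  exact isUnit_ofPowerSeries_X.mul (hu1.map _)

theorem isUnit_iterated_sum : IsUnit (iterated F.toPowerSeries) :=
  isUnit_iterated (by
    have h : F.toPowerSeries.subst ![PowerSeries.X, (0 : PowerSeries R)] = PowerSeries.X :=
      F.Xzero_eq_X
    rw [h]
    exact isUnit_ofPowerSeries_X)

theorem hasSubst_pair {a b : MvPowerSeries (Fin 2) R} (ha : constantCoeff a = 0)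
    (hb : constantCoeff b = 0) : HasSubst ![a, b] :=
  hasSubst_of_constantCoeff_zero fun s => by
    fin_cases s
    · exact ha
    · exact hb

theorem constantCoeff_iota_subst (i : Fin 2) :
    constantCoeff (F.iota.subst (X i : MvPowerSeries (Fin 2) R)) = 0 :=
  PowerSeries.constantCoeff_subst_eq_zero (constantCoeff_X i) _ F.constantCoeff_iota

theorem subst_iota_subst (i : Fin 2) (a : Fin 2 → PowerSeries R) (ha : HasSubst a) :
    (F.iota.subst (X i : MvPowerSeries (Fin 2) R)).subst a = F.iota.subst (a i) := by
  rw [PowerSeries.subst, MvPowerSeries.subst_comp_subst_apply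
    (PowerSeries.HasSubst.X i).const ha, MvPowerSeries.subst_X ha]
  rfl

theorem isUnit_iterated_diff : IsUnit (iterated F.diff) :=
  isUnit_iterated (by
    have hX : HasSubst ![(PowerSeries.X : PowerSeries R), 0] := HasSubst.X_zero
    have h : F.diff.subst ![PowerSeries.X, (0 : PowerSeries R)] = PowerSeries.X := by
      rw [diff, MvPowerSeries.subst_comp_subst_apply
        (hasSubst_pair (constantCoeff_X 0) (F.constantCoeff_iota_subst 1)) hX]
      refine Eq.trans ?_ F.Xzero_eq_X
      rw [Xzero]
      congr 1
      funext s
      fin_cases s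
      · exact MvPowerSeries.subst_X hX 0
      · exact (F.subst_iota_subst 1 _ hX).trans
          (PowerSeries.subst_zero_of_constantCoeff_zero F.constantCoeff_iota)
    rw [h]
    exact isUnit_ofPowerSeries_X)

theorem isUnit_iterated_diffSwap : IsUnit (iterated F.diffSwap) :=
  isUnit_iterated (by
    have hX : HasSubst ![(PowerSeries.X : PowerSeries R), 0] := HasSubst.X_zero
    have h : F.diffSwap.subst ![PowerSeries.X, (0 : PowerSeries R)] = F.iota := by
      rw [diffSwap, MvPowerSeries.subst_comp_subst_apply
        (hasSubst_pair (constantCoeff_X 1) (F.constantCoeff_iota_subst 0)) hX]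
      refine Eq.trans ?_
        (F.zero_add (PowerSeries.HasSubst.of_constantCoeff_zero' F.constantCoeff_iota))
      congr 1
      funext s
      fin_cases s
      · exact MvPowerSeries.subst_X hX 1
      · exact (F.subst_iota_subst 0 _ hX).trans (PowerSeries.X_subst F.iota)
    rw [h]
    exact F.isUnit_iota)

/-- `ι(z)` as a unit of `R((z))`. -/
def iotaUnit : (LaurentSeries R)ˣ := F.isUnit_iota.unit

/-- `i_{z,w} F(z, w)` as a unit of `R((z))((w))`, so that `i_{z,w} F(z, w) ^ n` is its `n`-th power
for every integer `n`. -/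
def sumUnit : (LaurentSeries (LaurentSeries R))ˣ := F.isUnit_iterated_sum.unit

/-- `i_{z,w} F(z, ι w)` as a unit of `R((z))((w))`. -/
def diffUnit : (LaurentSeries (LaurentSeries R))ˣ := F.isUnit_iterated_diff.unit

/-- `i_{w,z} F(z, ι w)` as a unit of `R((w))((z))`. -/
def diffSwapUnit : (LaurentSeries (LaurentSeries R))ˣ := F.isUnit_iterated_diffSwap.unit

/-- The `F`-delta distribution
`z⁻¹ δ_F(w / z) = i_{z,w} F(z, ι w)⁻¹ - i_{w,z} F(z, ι w)⁻¹`: its coefficient of `w ^ p * z ^ q`. -/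
def delta (p q : ℤ) : R :=
  ((F.diffUnit⁻¹).val.coeff p).coeff q - ((F.diffSwapUnit⁻¹).val.coeff q).coeff p

end FormalGroup
/-! ### Bilateral series -/

/-- Bilateral Laurent series `M⟦z_i^±1 : i ∈ σ⟧`: the coefficient of `∏ z_i ^ e i` is the value at
`e`. -/
abbrev Bilateral (σ M : Type*) := (σ → ℤ) → M

namespace Bilateral

variable {σ R M : Type*} [CommRing R] [AddCommGroup M] [Module R M]

/-- The product of `f` and `g` converges: each coefficient is a sum of finitely many nonzero
terms. -/
def MulConverges (f : Bilateral σ R) (g : Bilateral σ M) : Prop :=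
  ∀ e : σ → ℤ, {d : σ → ℤ | f d • g (e - d) ≠ 0}.Finite

/-- The (partially defined) product of bilateral series. -/
def mul (f : Bilateral σ R) (g : Bilateral σ M) : Bilateral σ M :=
  fun e => ∑ᶠ d : σ → ℤ, f d • g (e - d)

open Classical in
/-- The series `∑ g m z_i ^ m`. -/
def ofVar (i : σ) (g : ℤ → M) : Bilateral σ M :=
  fun e => if ∀ k, k ≠ i → e k = 0 then g (e i) else 0

open Classical in
/-- The series `∑ g m n z_i ^ m z_j ^ n`, for `i ≠ j`. -/
def ofVars (i j : σ) (g : ℤ → ℤ → M) : Bilateral σ M :=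
  fun e => if ∀ k, k ≠ i → k ≠ j → e k = 0 then g (e i) (e j) else 0

/-- The inclusion of `M((z_i))((z_j))` into the bilateral series. -/
def ofIterated (i j : σ) (f : LaurentSeries (LaurentSeries M)) : Bilateral σ M :=
  ofVars i j fun m n => (f.coeff n).coeff m

/-- The substitution `x ↦ W(z_i, z_j)` in `∑ f m x ^ m` converges, where `W` is a unit of
`R((z_i))((z_j))` and the `f m` are bilateral series. -/
def SubstConverges (i j : σ) (W : (LaurentSeries (LaurentSeries R))ˣ) (f : ℤ → Bilateral σ M) :
    Prop :=
  (∀ m, MulConverges (ofIterated i j (W ^ m).val) (f m)) ∧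
    ∀ e : σ → ℤ, {m : ℤ | mul (ofIterated i j (W ^ m).val) (f m) e ≠ 0}.Finite

/-- The substitution `x ↦ W(z_i, z_j)` in `∑ f m x ^ m`, i.e. `∑ W ^ m f m`, where `W` is a unit of
`R((z_i))((z_j))`. -/
def subst (i j : σ) (W : (LaurentSeries (LaurentSeries R))ˣ) (f : ℤ → Bilateral σ M) :
    Bilateral σ M :=
  fun e => ∑ᶠ m : ℤ, mul (ofIterated i j (W ^ m).val) (f m) e

end Bilateral

namespace FormalGroup

variable {σ R : Type*} [CommRing R] (F : FormalGroup R)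

/-- `z_k⁻¹ δ_F(w / z_k)` as a series in powers of `w`, with coefficients series in `z_k`. -/
def deltaIn (k : σ) : ℤ → Bilateral σ R :=
  fun p => Bilateral.ofVar k (F.delta p)

/-- `z_k⁻¹ δ_F(W / z_k)`, where `W` is a unit of `R((z_i))((z_j))` substituted for `w`. -/
def deltaSubst (i j k : σ) (W : (LaurentSeries (LaurentSeries R))ˣ) : Bilateral σ R :=
  Bilateral.subst i j W (F.deltaIn k)

/-- `i_{z_i,z_j} z_k⁻¹ δ_F(F(z_i, ι z_j) / z_k)`. -/
def deltaExp (i j k : σ) : Bilateral σ R := F.deltaSubst i j k F.diffUnit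

/-- `i_{z_j,z_i} z_k⁻¹ δ_F(F(z_i, ι z_j) / z_k)`. -/
def deltaExpSwap (i j k : σ) : Bilateral σ R := F.deltaSubst j i k F.diffSwapUnit

end FormalGroup

/-! ### Vertex `F`-algebras -/

namespace VertexOperator

variable {R V : Type*} [CommRing R] [AddCommGroup V] [Module R V]

/-- The coefficients of `z ^ p * w ^ q` in `A(z) B(w) c`. -/
def comp (A B : VertexOperator R V) (c : V) : ℤ → ℤ → V :=
  fun p q => HVertexOperator.coeff A p (HVertexOperator.coeff B q c)

/-- The coefficients of `z ^ p * w ^ q` in `Y(Y(a, z) b, w) c`. -/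
def nested (Y : V →ₗ[R] VertexOperator R V) (a b c : V) : ℤ → ℤ → V :=
  fun p q => HVertexOperator.coeff (Y (HVertexOperator.coeff (Y a) p b)) q c

/-- `i_{z,w} A(F(z, w)) b`, in the variables `z = z_0` and `w = z_1`. -/
def atSum (F : FormalGroup R) (A : VertexOperator R V) (b : V) : Bilateral (Fin 2) V :=
  Bilateral.subst 0 1 F.sumUnit fun m =>
    Bilateral.ofVars 0 1 fun p q => if p = 0 ∧ q = 0 then HVertexOperator.coeff A m b else 0

/-- `i_{z,w} A(F(z, w)) B(w) c`, in the variables `z = z_0` and `w = z_1`: the substitution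
`v ↦ F(z, w)` in `A(v) B(w) c ∈ V((v))((w))`. -/
def atSumComp (F : FormalGroup R) (A B : VertexOperator R V) (c : V) : Bilateral (Fin 2) V :=
  Bilateral.subst 0 1 F.sumUnit fun m => Bilateral.ofVar 1 fun q => comp A B c m q

/-- The coefficients of `z ^ p` in `A(ι z) b ∈ V((z))`. -/
def atIota (F : FormalGroup R) (A : VertexOperator R V) (b : V) : ℤ → V :=
  fun p => ∑ᶠ m : ℤ,
    (F.iotaUnit ^ m).val.coeff p • HVertexOperator.coeff A m b

end VertexOperator

open VertexOperator in
/-- A vertex `F`-algebra structure on the `R`-module `V`, for a commutative one-dimensional formal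
group law `F` over `R`. The coefficient of `z ^ n` in `Y(a, z) b` is
`HVertexOperator.coeff (Y a) n b`. -/
structure VertexFAlgebra {R : Type*} [CommRing R] (F : FormalGroup R) [F.IsComm]
    (V : Type*) [AddCommGroup V] [Module R V] where
  /-- the vacuum vector -/
  vacuum : V
  /-- the coefficients `S^(n)` of the `F`-shift operator `S(z) : V → V⟦z⟧` -/
  shift : ℕ → V →ₗ[R] V
  /-- the state-to-field correspondence `Y(a, z) b ∈ V((z))` -/
  Y : V →ₗ[R] VertexOperator R V
  /-- `Y(a, z) 1` is holomorphic -/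
  creation_holomorphic : ∀ (a : V) (n : ℤ), n < 0 → HVertexOperator.coeff (Y a) n vacuum = 0
  /-- `Y(a, z) 1 |_{z = 0} = a` -/
  creation : ∀ a : V, HVertexOperator.coeff (Y a) 0 vacuum = a
  /-- `Y(1, z) = id` -/
  vacuum_field : ∀ (b : V) (n : ℤ),
    HVertexOperator.coeff (Y vacuum) n b = if n = 0 then b else 0
  /-- `Y(S(w) a, z) b = i_{z,w} Y(a, F(z, w)) b` -/
  translation : ∀ a b : V,
    Bilateral.ofVars 0 1
      (fun p q => if 0 ≤ q then HVertexOperator.coeff (Y (shift q.toNat a)) p b else 0) =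
      atSum F (Y a) b
  /-- `S(z) 1 = 1` -/
  shift_vacuum : ∀ n : ℕ, shift n vacuum = if n = 0 then vacuum else 0
  /-- `S(z) ∘ S(w) = S(F(z, w))` -/
  shift_shift : ∀ (p q : ℕ) (a : V), shift p (shift q a) =
    ∑ᶠ n : ℕ, (F.toPowerSeries ^ n).coeff (single 0 p + single 1 q) • shift n a
  /-- `S(0) = id` -/
  shift_zero : ∀ a : V, shift 0 a = a
  /-- weak `F`-associativity:
  `F(z, w) ^ N Y(Y(a, z) b, w) c = F(z, w) ^ N i_{z,w} Y(a, F(z, w)) Y(b, w) c` -/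
  associativity : ∀ a b c : V, ∃ N : ℕ,
    Bilateral.mul (Bilateral.ofIterated 0 1 (F.sumUnit ^ N).val)
      (Bilateral.ofVars 0 1 (nested Y a b c)) =
    Bilateral.mul (Bilateral.ofIterated 0 1 (F.sumUnit ^ N).val) (atSumComp F (Y a) (Y b) c)
  /-- skew symmetry: `Y(a, z) b = S(z) Y(b, ι z) a` -/
  skew : ∀ (a b : V) (p : ℤ), HVertexOperator.coeff (Y a) p b =
    ∑ᶠ n : ℕ, shift n (atIota F (Y b) a (p - n))

end

/-!
In the group of points of `F`, put `T = z_0 + z_2 - z_1`, that is `T = F(F(z_0, z_2), ι z_1)`. The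
power series `T` has three inverses `inv₀`, `inv₁`, `inv₂`, where `inv_k` is expanded in
nonnegative powers of the variables other than `z_k`, and an inverse is determined by the cone
that contains its support (`ConeBounded.inverse_unique`). Each of the substitutions in the three
delta series produces two of these inverses, so that the delta series are `inv₂ - inv₁`, `inv₀ -
inv₁` and `inv₀ - inv₂` (`deltaExp_one_zero_two`, `deltaExp_one_two_zero`,
`deltaExpSwap_one_two_zero`). In particular the first is the difference of the other two, and all
three are annihilated by `T`.

Since `T` divides `F(z_0, z_2) - z_1`, `F(z_2, z_0) - z_1` and `F(ι z_0, z_1) - z_2`, the formal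
sums `F(z_0, z_2)`, `F(z_2, z_0)` and `F(ι z_0, z_1)` may be replaced by `z_1`, `z_1` and `z_2` in a
product with a delta series. The language for such replacements is that of kernels: families of
series that transform like the monomials `u ^ a * v ^ b` (`IsKernel`), for instance
`z_0 ^ a * z_2 ^ b * E` with `E` a delta series (`lineKernel`). With these,
* weak associativity turns the first two products of the Jacobi identity, up to a shift, into
  products with the single series `K = F ^ N Y(Y(a, z_0) b, z_2) c`, whose exponents are bounded
  below (`mul_substLaurent_pow_mul`, `mul_substLaurent_substFst`);
* weak associativity for `b`, `a`, `c` turns the third product into one with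
  `K' = F ^ N' Y(Y(b, x) a, z_1) c` at `x = ι(z_0)`; and by skew symmetry and translation the first
  product can also be written with this series (`mul_nested_skew`).

So a difference `P` of shifts of `K` and `K'` is annihilated by the first delta series
`inv₂ - inv₁`. The exponents of `inv₁ P = inv₂ P` are bounded below in every variable, `P` is `T`
times this series, and therefore `inv₀ P` is the same series again. Thus `P` is annihilated by the
third delta series as well (`deltaExpSwap_mul_eq_zero`). The Jacobi identity then reduces to the
relation between the three delta series.
-/

noncomputable section

open MvPowerSeries Finsupp

/-! ### Convolution of bilateral series -/

section Finsum

variable {α β R M : Type*} [CommRing R] [AddCommGroup M] [Module R M]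

theorem finsum_comm_of_finite {f : α → β → M} (h : {p : α × β | f p.1 p.2 ≠ 0}.Finite) :
    ∑ᶠ a, ∑ᶠ b, f a b = ∑ᶠ b, ∑ᶠ a, f a b := by
  rw [← finsum_curry (fun p : α × β => f p.1 p.2) h, ← finsum_comp_equiv (Equiv.prodComm β α)]
  exact finsum_curry (fun p : β × α => f p.2 p.1) (h.preimage (Equiv.prodComm β α).injective.injOn)

/-- Associativity of the product of matrices `a * K * g`, where `a` is a row and `g` is a column,
when only finitely many of the products of entries can be nonzero. -/
theorem finsum_smul_finsum_smul {a : α → R} {K : α → β → R} {g : β → M}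
    (h : {p : α × β | a p.1 ≠ 0 ∧ K p.1 p.2 ≠ 0 ∧ g p.2 ≠ 0}.Finite) :
    ∑ᶠ x, a x • ∑ᶠ y, K x y • g y = ∑ᶠ y, (∑ᶠ x, a x * K x y) • g y := by
  have h1 : ∀ x, a x • ∑ᶠ y, K x y • g y = ∑ᶠ y, (a x * K x y) • g y := by
    intro x
    by_cases hx : a x = 0
    · simp [hx]
    · rw [smul_finsum']
      · simp only [mul_smul]
      · refine (h.image Prod.snd).subset fun y hy => ⟨(x, y), ⟨hx, ?_, ?_⟩, rfl⟩
        · intro h0; exact hy (by simp [h0])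
        · intro h0; exact hy (by simp [h0])
  have h2 : ∀ y, (∑ᶠ x, a x * K x y) • g y = ∑ᶠ x, (a x * K x y) • g y := by
    intro y
    by_cases hy : g y = 0
    · simp [hy]
    · refine finsum_smul' ((h.image Prod.fst).subset fun x hx => ⟨(x, y), ⟨?_, ?_, hy⟩, rfl⟩) _
      · intro h0; exact hx (by simp [h0])
      · intro h0; exact hx (by simp [h0])
  rw [finsum_congr h1, finsum_congr h2]
  refine finsum_comm_of_finite (h.subset fun p hp => ⟨?_, ?_, ?_⟩)
  · intro h0; exact hp (by simp [h0])
  · intro h0; exact hp (by simp [h0])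
  · intro h0; exact hp (by simp [h0])

theorem finsum_comp_of_support_subset_range {f : β → M} {φ : α → β} (hφ : Function.Injective φ)
    (h : ∀ b, f b ≠ 0 → b ∈ Set.range φ) : ∑ᶠ b, f b = ∑ᶠ a, f (φ a) := by
  rw [← finsum_mem_range hφ, ← finsum_mem_inter_support,
    Set.inter_eq_right.2 (show Function.support f ⊆ Set.range φ from h), finsum_mem_support]

end Finsum

namespace Bilateral

section Mul

variable {σ R M : Type*} [CommRing R] [AddCommGroup M] [Module R M]

theorem mul_eq_finsum (f : Bilateral σ R) (g : Bilateral σ M) (e : σ → ℤ) :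
    mul f g e = ∑ᶠ d : σ → ℤ, f (e - d) • g d := by
  rw [mul, ← finsum_comp_equiv (Equiv.subLeft e)]
  simp

theorem mul_comm' (f g : Bilateral σ R) : mul f g = mul g f := by
  funext e
  rw [mul_eq_finsum, mul]
  simp only [smul_eq_mul, mul_comm]

/-- Multiplication is associative where, for each exponent, only finitely many triples of terms
contribute. -/
theorem mul_assoc' {f g : Bilateral σ R} {h : Bilateral σ M}
    (hfin : ∀ e, {p : (σ → ℤ) × (σ → ℤ) | f p.1 ≠ 0 ∧ g p.2 ≠ 0 ∧ h (e - p.1 - p.2) ≠ 0}.Finite) :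
    mul (mul f g) h = mul f (mul g h) := by
  funext e
  have h1 : ∀ d, mul g h (e - d) = ∑ᶠ n, g (n - d) • h (e - n) := by
    intro d
    rw [mul, ← finsum_comp_equiv (Equiv.subRight d)]
    refine finsum_congr fun n => ?_
    simp
  rw [mul, mul]
  simp only [h1]
  rw [finsum_smul_finsum_smul (K := fun d n => g (n - d)) (g := fun n => h (e - n))]
  · rfl
  · refine ((hfin e).image fun p => (p.1, p.2 + p.1)).subset fun p hp => ?_
    refine ⟨(p.1, p.2 - p.1), ⟨hp.1, hp.2.1, ?_⟩, by simp⟩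
    have := hp.2.2
    simpa using this

open Classical in
/-- The monomial with exponents `d`. -/
def monomial (R : Type*) [CommRing R] (d : σ → ℤ) : Bilateral σ R := fun e => if e = d then 1 else 0

theorem monomial_mul (d : σ → ℤ) (f : Bilateral σ M) (e : σ → ℤ) :
    mul (monomial R d) f e = f (e - d) := by
  rw [mul, finsum_eq_single _ d]
  · simp [monomial]
  · intro d' hd'
    simp [monomial, hd']

theorem one_mul' (f : Bilateral σ M) : mul (monomial R 0) f = f := by
  funext e
  rw [monomial_mul, sub_zero]

theorem mul_sub' {f : Bilateral σ R} {g h : Bilateral σ M} (hg : MulConverges f g)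
    (hh : MulConverges f h) : mul f (g - h) = mul f g - mul f h := by
  funext e
  simp only [mul, Pi.sub_apply, smul_sub]
  exact finsum_sub_distrib (hg e) (hh e)

theorem sub_mul' {f g : Bilateral σ R} {h : Bilateral σ M} (hf : MulConverges f h)
    (hg : MulConverges g h) : mul (f - g) h = mul f h - mul g h := by
  funext e
  simp only [mul, Pi.sub_apply, sub_smul]
  exact finsum_sub_distrib (hf e) (hg e)

theorem mul_shift (f : Bilateral σ R) (g : Bilateral σ M) (d e : σ → ℤ) :
    mul f (fun x => g (x - d)) e = mul f g (e - d) := by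
  simp only [mul]
  refine finsum_congr fun x => ?_
  rw [sub_right_comm]

theorem MulConverges.of_finite {f : Bilateral σ R} {g : Bilateral σ M}
    (h : ∀ e, {d | f d ≠ 0 ∧ g (e - d) ≠ 0}.Finite) : MulConverges f g := fun e =>
  (h e).subset fun d hd => ⟨fun h0 => hd (by simp [h0]), fun h0 => hd (by simp [h0])⟩

theorem exists_of_mul_ne_zero {f : Bilateral σ R} {g : Bilateral σ M} {e : σ → ℤ}
    (h : mul f g e ≠ 0) : ∃ d, f d ≠ 0 ∧ g (e - d) ≠ 0 := by
  by_contra! hc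
  refine h (finsum_eq_zero_of_forall_eq_zero fun d => ?_)
  by_cases hd : f d = 0
  · simp [hd]
  · simp [hc d hd]

end Mul

/-! ### Formal power series acting on bilateral series of bounded degree -/

section PowerSeries

variable {σ R M : Type*} [Fintype σ] [CommRing R] [AddCommGroup M] [Module R M]

/-- The total degrees of the monomials of `f` are bounded below. -/
def DegreeBounded (f : Bilateral σ M) : Prop := ∃ c : ℤ, ∀ e, f e ≠ 0 → c ≤ ∑ i, e i

/-- The exponents `e` with nonnegative entries and total degree at most `c`. -/
theorem finite_nonneg_sum_le (c : ℤ) :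
    {d : σ → ℤ | (∀ i, 0 ≤ d i) ∧ ∑ i, d i ≤ c}.Finite := by
  refine (Set.Finite.pi' fun _ : σ => Set.finite_Icc (0 : ℤ) c).subset fun d hd i =>
    ⟨hd.1 i, ?_⟩
  exact (Finset.single_le_sum (fun j _ => hd.1 j) (Finset.mem_univ i)).trans hd.2

open Classical in
/-- The inclusion of formal power series into the bilateral series. -/
def ofPowerSeries (f : MvPowerSeries σ R) : Bilateral σ R :=
  fun e => if ∀ i, 0 ≤ e i then f.coeff (Finsupp.equivFunOnFinite.symm fun i => (e i).toNat) else 0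

theorem ofPowerSeries_natCast (f : MvPowerSeries σ R) (n : σ →₀ ℕ) :
    ofPowerSeries f (fun i => (n i : ℤ)) = f.coeff n := by
  rw [ofPowerSeries, if_pos fun i => Int.natCast_nonneg _]
  congr 2
  ext i
  simp

theorem nonneg_of_ofPowerSeries_ne_zero {f : MvPowerSeries σ R} {e : σ → ℤ}
    (h : ofPowerSeries f e ≠ 0) (i : σ) : 0 ≤ e i := by
  by_contra hc
  exact h (if_neg fun h' => hc (h' i))

theorem exists_natCast {e : σ → ℤ} (h : ∀ i, 0 ≤ e i) :
    ∃ n : σ →₀ ℕ, e = fun i => (n i : ℤ) :=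
  ⟨Finsupp.equivFunOnFinite.symm fun i => (e i).toNat, by
    funext i
    simp [h i]⟩

theorem natCast_injective {τ : Type*} :
    Function.Injective fun (n : τ →₀ ℕ) (i : τ) => (n i : ℤ) :=
  fun _ _ h => Finsupp.ext fun i => Int.ofNat_inj.1 (congrFun h i)

theorem ofPowerSeries_one : ofPowerSeries (1 : MvPowerSeries σ R) = monomial R 0 := by
  classical
  funext e
  by_cases he : ∀ i, 0 ≤ e i
  · obtain ⟨n, rfl⟩ := exists_natCast he
    rw [ofPowerSeries_natCast, MvPowerSeries.coeff_one, monomial]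
    congr 1
    exact propext ⟨fun h => by subst h; funext i; simp, fun h => natCast_injective (h.trans (by
      funext i; simp))⟩
  · rw [ofPowerSeries, if_neg he, monomial, if_neg]
    rintro rfl
    exact he fun i => le_rfl

theorem ofPowerSeries_sub (f g : MvPowerSeries σ R) :
    ofPowerSeries (f - g) = ofPowerSeries f - ofPowerSeries g := by
  funext e
  simp only [ofPowerSeries, Pi.sub_apply]
  split_ifs <;> simp

theorem mul_ofPowerSeries_eq (f : MvPowerSeries σ R) (g : Bilateral σ M) (e : σ → ℤ) :
    mul (ofPowerSeries f) g e = ∑ᶠ n : σ →₀ ℕ, f.coeff n • g (e - fun i => (n i : ℤ)) := by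
  rw [mul, finsum_comp_of_support_subset_range natCast_injective]
  · simp only [ofPowerSeries_natCast]
  · intro d hd
    obtain ⟨n, hn⟩ := exists_natCast fun i => nonneg_of_ofPowerSeries_ne_zero (f := f) (e := d)
      (fun h0 => hd (by simp [h0])) i
    exact ⟨n, hn.symm⟩

theorem ofPowerSeries_mul (f g : MvPowerSeries σ R) :
    ofPowerSeries (f * g) = mul (ofPowerSeries f) (ofPowerSeries g) := by
  classical
  funext e
  rw [mul_ofPowerSeries_eq]
  by_cases he : ∀ i, 0 ≤ e i
  · obtain ⟨n, rfl⟩ := exists_natCast he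
    rw [ofPowerSeries_natCast, MvPowerSeries.coeff_mul,
      finsum_eq_sum_of_support_subset (s := (Finset.HasAntidiagonal.antidiagonal n).image Prod.fst)]
    · rw [Finset.sum_image]
      · refine Finset.sum_congr rfl fun p hp => ?_
        rw [Finset.HasAntidiagonal.mem_antidiagonal] at hp
        subst hp
        rw [smul_eq_mul, ← ofPowerSeries_natCast g p.2]
        congr 2
        funext i
        simp
      · intro p hp q hq h
        simp only [Finset.mem_coe,
          Finset.HasAntidiagonal.mem_antidiagonal] at hp hq
        refine Prod.ext h ?_
        rw [← hp, h] at hq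
        exact (add_left_cancel hq).symm
    · intro m hm
      have h1 : ∀ i, 0 ≤ (n i : ℤ) - m i := nonneg_of_ofPowerSeries_ne_zero
        (f := g) (e := (fun i => (n i : ℤ)) - fun i => (m i : ℤ)) fun h0 => hm (by simp [h0])
      have h2 : m ≤ n := fun i => by have := h1 i; omega
      simp only [Finset.coe_image, Set.mem_image, Finset.mem_coe,
        Finset.HasAntidiagonal.mem_antidiagonal]
      exact ⟨(m, n - m), add_tsub_cancel_of_le h2, rfl⟩
  · rw [ofPowerSeries, if_neg he]
    refine (finsum_eq_zero_of_forall_eq_zero fun n => ?_).symm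
    have : ofPowerSeries g (e - fun i => (n i : ℤ)) = 0 := by
      by_contra h0
      refine he fun i => ?_
      have := nonneg_of_ofPowerSeries_ne_zero h0 i
      simp at this
      omega
    rw [this, smul_zero]

theorem DegreeBounded.finite {g : Bilateral σ M} (hg : DegreeBounded g) (e : σ → ℤ) :
    {d : σ → ℤ | (∀ i, 0 ≤ d i) ∧ g (e - d) ≠ 0}.Finite := by
  obtain ⟨c, hc⟩ := hg
  refine (finite_nonneg_sum_le (∑ i, e i - c)).subset fun d hd => ⟨hd.1, ?_⟩
  have := hc _ hd.2
  simp only [Pi.sub_apply, Finset.sum_sub_distrib] at this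
  omega

theorem DegreeBounded.mulConverges {g : Bilateral σ M} (hg : DegreeBounded g)
    (f : MvPowerSeries σ R) : MulConverges (ofPowerSeries f) g :=
  .of_finite fun e => (hg.finite e).subset fun _ hd =>
    ⟨nonneg_of_ofPowerSeries_ne_zero hd.1, hd.2⟩

theorem ofPowerSeries_mul_mul {g : Bilateral σ M} (hg : DegreeBounded g)
    (f f' : MvPowerSeries σ R) :
    mul (ofPowerSeries (f * f')) g = mul (ofPowerSeries f) (mul (ofPowerSeries f') g) := by
  rw [ofPowerSeries_mul, mul_assoc']
  intro e
  obtain ⟨c, hc⟩ := hg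
  have hS := finite_nonneg_sum_le (σ := σ) (∑ i, e i - c)
  refine (hS.prod hS).subset fun p hp => ?_
  have h1 := nonneg_of_ofPowerSeries_ne_zero hp.1
  have h2 := nonneg_of_ofPowerSeries_ne_zero hp.2.1
  have h3 := hc _ hp.2.2
  simp only [Pi.sub_apply, Finset.sum_sub_distrib] at h3
  have h4 := Finset.sum_nonneg fun i (_ : i ∈ Finset.univ) => h1 i
  have h5 := Finset.sum_nonneg fun i (_ : i ∈ Finset.univ) => h2 i
  exact ⟨⟨h1, by omega⟩, h2, by omega⟩

theorem ofPowerSeries_X [DecidableEq σ] (i : σ) :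
    ofPowerSeries (X i : MvPowerSeries σ R) = monomial R (Pi.single i 1) := by
  classical
  funext e
  by_cases he : ∀ i, 0 ≤ e i
  · obtain ⟨n, rfl⟩ := exists_natCast he
    rw [ofPowerSeries_natCast, MvPowerSeries.coeff_X, monomial]
    congr 1
    refine propext ⟨?_, fun h => natCast_injective (h.trans ?_)⟩
    · rintro rfl
      funext j
      rw [Finsupp.single_apply, Pi.single_apply]
      simp [eq_comm]
    · funext j
      simp [Finsupp.single_apply, Pi.single_apply, eq_comm]
  · rw [ofPowerSeries, if_neg he, monomial, if_neg]
    rintro rfl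
    exact he fun j => by rw [Pi.single_apply]; split_ifs <;> simp

theorem X_mul [DecidableEq σ] (i : σ) (g : Bilateral σ M) (e : σ → ℤ) :
    mul (ofPowerSeries (X i : MvPowerSeries σ R)) g e = g (e - Pi.single i 1) := by
  rw [ofPowerSeries_X, monomial_mul]

end PowerSeries

end Bilateral

/-! ### Substitution kernels -/

namespace Bilateral

variable {σ R M : Type*} [Fintype σ] [CommRing R] [AddCommGroup M] [Module R M]

/-- A kernel `κ` over a pair of power series `(u, v)`: a family of bilateral series of bounded
degree that transforms like the family of monomials `u ^ a * v ^ b`. -/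
structure IsKernel (u v : MvPowerSeries σ R) (κ : (Fin 2 → ℤ) → Bilateral σ R) : Prop where
  degreeBounded : ∀ z, DegreeBounded (κ z)
  fst_mul : ∀ z, mul (ofPowerSeries u) (κ z) = κ (z + Pi.single 0 1)
  snd_mul : ∀ z, mul (ofPowerSeries v) (κ z) = κ (z + Pi.single 1 1)

namespace IsKernel

variable {u v : MvPowerSeries σ R} {κ : (Fin 2 → ℤ) → Bilateral σ R}

theorem translate (h : IsKernel u v κ) (y : Fin 2 → ℤ) : IsKernel u v fun z => κ (z + y) where
  degreeBounded z := h.degreeBounded _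
  fst_mul z := by rw [h.fst_mul, add_right_comm]
  snd_mul z := by rw [h.snd_mul, add_right_comm]

theorem pow_mul (h : IsKernel u v κ) (n : Fin 2 →₀ ℕ) (z : Fin 2 → ℤ) :
    mul (ofPowerSeries (u ^ n 0 * v ^ n 1)) (κ z) = κ (z + fun i => (n i : ℤ)) := by
  have h0 : ∀ (a : ℕ) z, mul (ofPowerSeries (u ^ a)) (κ z) = κ (z + Pi.single 0 (a : ℤ)) := by
    intro a z
    induction a with
    | zero => rw [pow_zero, ofPowerSeries_one, one_mul']; simp
    | succ a ih =>
      rw [pow_succ', ofPowerSeries_mul_mul (h.degreeBounded z), ih, h.fst_mul, add_assoc,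
        ← Pi.single_add, Nat.cast_succ]
  have h1 : ∀ (a : ℕ) z, mul (ofPowerSeries (v ^ a)) (κ z) = κ (z + Pi.single 1 (a : ℤ)) := by
    intro a z
    induction a with
    | zero => rw [pow_zero, ofPowerSeries_one, one_mul']; simp
    | succ a ih =>
      rw [pow_succ', ofPowerSeries_mul_mul (h.degreeBounded z), ih, h.snd_mul, add_assoc,
        ← Pi.single_add, Nat.cast_succ]
  rw [ofPowerSeries_mul_mul (h.degreeBounded z), h1, h0, add_assoc]
  congr 2
  funext i
  fin_cases i <;> simp

/-- Multiplying a kernel over `(u, v)` by the power series `c(u, v)`. -/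
theorem subst_mul (h : IsKernel u v κ) (hu : constantCoeff u = 0) (hv : constantCoeff v = 0)
    (c : MvPowerSeries (Fin 2) R) (z : Fin 2 → ℤ) (e : σ → ℤ) :
    mul (ofPowerSeries (c.subst ![u, v])) (κ z) e =
      ∑ᶠ a : Fin 2 → ℤ, ofPowerSeries c a • κ (z + a) e := by
  have huv : HasSubst ![u, v] := hasSubst_of_constantCoeff_zero fun s => by
    fin_cases s
    · exact hu
    · exact hv
  have hprod : ∀ n : Fin 2 →₀ ℕ, (n.prod fun s k => ![u, v] s ^ k) = u ^ n 0 * v ^ n 1 := by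
    intro n
    rw [Finsupp.prod_fintype _ _ (by simp)]
    simp
  have hR : ∑ᶠ a : Fin 2 → ℤ, ofPowerSeries c a • κ (z + a) e =
      ∑ᶠ n : Fin 2 →₀ ℕ, c.coeff n • mul (ofPowerSeries (u ^ n 0 * v ^ n 1)) (κ z) e := by
    simp only [h.pow_mul]
    have := mul_ofPowerSeries_eq c (fun a => κ (z - a) e) 0
    simpa [mul] using this
  rw [hR, mul_ofPowerSeries_eq]
  simp only [coeff_subst huv, hprod, mul_ofPowerSeries_eq]
  rw [finsum_smul_finsum_smul
    (K := fun (n : Fin 2 →₀ ℕ) m => MvPowerSeries.coeff m (u ^ n 0 * v ^ n 1))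
    (g := fun m : σ →₀ ℕ => κ z (e - fun i => (m i : ℤ)))]
  · rfl
  · have hm : {m : σ →₀ ℕ | κ z (e - fun i => (m i : ℤ)) ≠ 0}.Finite := by
      refine Set.Finite.of_finite_image (f := fun m i => (m i : ℤ))
        (((h.degreeBounded z).finite e).subset ?_) natCast_injective.injOn
      rintro _ ⟨m, hm, rfl⟩
      exact ⟨fun i => Int.natCast_nonneg _, hm⟩
    have hn : ∀ m : σ →₀ ℕ, {n : Fin 2 →₀ ℕ |
        MvPowerSeries.coeff m (u ^ n 0 * v ^ n 1) ≠ 0}.Finite := by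
      intro m
      -- the coefficients of the series `∑ x ^ a y ^ b`, all equal to `1`, detect every monomial
      refine (MvPowerSeries.coeff_subst_finite huv (fun _ => (1 : R)) m).subset fun n hn => ?_
      rw [Function.mem_support, hprod]
      change (1 : R) • _ ≠ 0
      rwa [one_smul]
    refine (hm.biUnion fun m _ => (hn m).prod (Set.finite_singleton m)).subset fun p hp => ?_
    exact Set.mem_biUnion (x := p.2) hp.2.2 ⟨hp.2.1, rfl⟩

end IsKernel

/-- The substitution `∑ f z x ^ (z 0) * y ^ (z 1) ↦ ∑ f z κ z` along a kernel. -/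
def pair (κ : (Fin 2 → ℤ) → Bilateral σ R) (f : Bilateral (Fin 2) M) : Bilateral σ M :=
  fun e => ∑ᶠ z, κ z e • f z

/-- The finiteness needed to multiply by power series under the substitution of `κ` into `f`. -/
def PairConverges (κ : (Fin 2 → ℤ) → Bilateral σ R) (f : Bilateral (Fin 2) M) : Prop :=
  ∀ e, {p : (Fin 2 → ℤ) × (Fin 2 → ℤ) |
    κ p.1 e ≠ 0 ∧ (∀ i, 0 ≤ (p.1 - p.2) i) ∧ f p.2 ≠ 0}.Finite

/-- Substitution along a kernel over `(u, v)` turns multiplication by `c(x, y)` into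
multiplication by `c(u, v)`. -/
theorem pair_mul {u v : MvPowerSeries σ R} {κ : (Fin 2 → ℤ) → Bilateral σ R}
    (h : IsKernel u v κ) (hu : constantCoeff u = 0) (hv : constantCoeff v = 0)
    (c : MvPowerSeries (Fin 2) R) {f : Bilateral (Fin 2) M} (hf : PairConverges κ f)
    (e : σ → ℤ) :
    pair κ (mul (ofPowerSeries c) f) e =
      ∑ᶠ z, mul (ofPowerSeries (c.subst ![u, v])) (κ z) e • f z := by
  rw [pair]
  simp only [mul_eq_finsum (ofPowerSeries c)]
  rw [finsum_smul_finsum_smul (K := fun z y => ofPowerSeries c (z - y))]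
  · refine finsum_congr fun y => ?_
    rw [h.subst_mul hu hv, ← finsum_comp_equiv (Equiv.addLeft y)]
    congr 1
    refine finsum_congr fun a => ?_
    simp [mul_comm]
  · exact (hf e).subset fun p hp =>
      ⟨hp.1, fun i => nonneg_of_ofPowerSeries_ne_zero hp.2.1 i, hp.2.2⟩

/-- If the exponent of the variable `j` is bounded above in a part of the support of `f`, then this
part is bounded below; and so is the exponent of `j` on the whole support. For `f` in two variables
`x` and `y`, with `y` the variable `j`, this says that `f` lies in `M((x))((y))`. -/
def LexBounded {τ : Type*} (j : τ) (f : Bilateral τ M) : Prop :=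
  (∃ c, ∀ z, f z ≠ 0 → c ≤ z j) ∧ ∀ c, ∃ b, ∀ z, f z ≠ 0 → z j ≤ c → ∀ i, b ≤ z i

/-- For each exponent `e`, the entry `z j` and the sum `z 0 + z 1` are bounded above on the `z` with
`κ z e ≠ 0`. Such a kernel can be substituted into the series that are `LexBounded j`. -/
def UpperBounded (j : Fin 2) (κ : (Fin 2 → ℤ) → Bilateral σ R) : Prop :=
  ∀ e, ∃ c, ∀ z, κ z e ≠ 0 → z j ≤ c ∧ z 0 + z 1 ≤ c

theorem finite_box {τ : Type*} [Finite τ] (b c : ℤ) :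
    {z : τ → ℤ | ∀ i, b ≤ z i ∧ z i ≤ c}.Finite :=
  Set.Finite.pi' fun _ : τ => Set.finite_Icc b c

/-- Below a point `z` that satisfies the bounds in `UpperBounded`, a lexicographically bounded
series has only finitely many exponents `y`, and only finitely many such `z` have any `y`
below them. -/
theorem LexBounded.exists_box {j : Fin 2} {f : Bilateral (Fin 2) M} (hf : LexBounded j f) (c : ℤ) :
    ∃ b b', ∀ z y : Fin 2 → ℤ, z j ≤ c → z 0 + z 1 ≤ c → (∀ i, y i ≤ z i) → f y ≠ 0 →
      ∀ i, (b ≤ y i ∧ y i ≤ b') ∧ b ≤ z i ∧ z i ≤ b' := by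
  obtain ⟨b, hb⟩ := hf.2 c
  refine ⟨b, c - b, fun z y h1 h2 h3 h4 => ?_⟩
  have h5 := hb y h4 ((h3 j).trans h1)
  have h50 := h5 0
  have h51 := h5 1
  have h30 := h3 0
  have h31 := h3 1
  intro i
  fin_cases i <;> simp <;> omega

theorem LexBounded.pairConverges {τ N : Type*} [AddCommGroup N] {j : Fin 2}
    {f : Bilateral (Fin 2) N} (hf : LexBounded j f) {κ : (Fin 2 → ℤ) → Bilateral τ R}
    (hκ : UpperBounded j κ) : PairConverges κ f := by
  intro e
  obtain ⟨c, hc⟩ := hκ e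
  obtain ⟨b, b', h⟩ := hf.exists_box c
  refine ((finite_box b b').prod (finite_box b b')).subset fun p hp => ?_
  have := h p.1 p.2 (hc _ hp.1).1 (hc _ hp.1).2 (fun i => sub_nonneg.1 (hp.2.1 i)) hp.2.2
  exact ⟨fun i => (this i).2, fun i => (this i).1⟩

/-- If `F(u, v)` acts on a kernel as the monomial with exponents `δ`, then the factor `F(x, y) ^ N`
becomes a shift by `N • δ` under the substitution of the kernel. -/
theorem pair_pow_mul {u v : MvPowerSeries σ R} {κ : (Fin 2 → ℤ) → Bilateral σ R}
    (h : IsKernel u v κ) (hu : constantCoeff u = 0) (hv : constantCoeff v = 0)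
    {F : MvPowerSeries (Fin 2) R} {δ : σ → ℤ}
    (hF : ∀ z e, mul (ofPowerSeries (F.subst ![u, v])) (κ z) e = κ z (e - δ))
    {f : Bilateral (Fin 2) M} (hf : PairConverges κ f) (N : ℕ) (e : σ → ℤ) :
    pair κ (mul (ofPowerSeries (F ^ N)) f) e = pair κ f (e - N • δ) := by
  have huv : HasSubst ![u, v] := hasSubst_of_constantCoeff_zero fun s => by
    fin_cases s
    · exact hu
    · exact hv
  rw [pair_mul h hu hv _ hf, pair]
  refine finsum_congr fun z => ?_
  congr 1
  induction N generalizing e with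
  | zero =>
    rw [pow_zero, ← coe_substAlgHom huv, map_one, ofPowerSeries_one, one_mul', zero_smul, sub_zero]
  | succ N ih =>
    rw [subst_pow huv, pow_succ, ← subst_pow huv, ofPowerSeries_mul_mul (h.degreeBounded z)]
    have : mul (ofPowerSeries (F.subst ![u, v])) (κ z) = fun e => κ z (e - δ) :=
      funext fun e => hF z e
    rw [this, mul_shift, ih, succ_nsmul', sub_sub]

/-- The series `S m`, `m ∈ ℤ`, behave like the powers of `F`, expanded in `R((x))((y))`. -/
structure IsPowers (F : MvPowerSeries (Fin 2) R) (S : ℤ → Bilateral (Fin 2) R) : Prop where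
  zero : S 0 = monomial R 0
  succ : ∀ m, S (m + 1) = mul (ofPowerSeries F) (S m)
  supp : ∀ m z, S m z ≠ 0 → 0 ≤ z 1 ∧ m ≤ z 0 + z 1

theorem IsPowers.lexBounded {F : MvPowerSeries (Fin 2) R} {S : ℤ → Bilateral (Fin 2) R}
    (hS : IsPowers F S) (m : ℤ) : LexBounded 1 (S m) := by
  refine ⟨⟨0, fun z hz => (hS.supp m z hz).1⟩, fun c => ⟨min 0 (m - c), fun z hz hc => ?_⟩⟩
  have := hS.supp m z hz
  intro i
  fin_cases i <;> simp <;> omega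

/-- The substitution of a kernel on which `F(u, v)` acts as the monomial with exponents `δ` into
`F(x, y) ^ m`, for a possibly negative `m`. Negative `m` are reached by descending induction, since
`F(u, v)` acts invertibly on the kernel. -/
theorem pair_powers {u v : MvPowerSeries σ R} {κ : (Fin 2 → ℤ) → Bilateral σ R}
    (h : IsKernel u v κ) (hu : constantCoeff u = 0) (hv : constantCoeff v = 0)
    {F : MvPowerSeries (Fin 2) R} {δ : σ → ℤ}
    (hF : ∀ z e, mul (ofPowerSeries (F.subst ![u, v])) (κ z) e = κ z (e - δ))
    (hκ : UpperBounded 1 κ) {S : ℤ → Bilateral (Fin 2) R} (hS : IsPowers F S) (m : ℤ)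
    (e : σ → ℤ) : pair κ (S m) e = κ 0 (e - m • δ) := by
  have h1 : ∀ m e, pair κ (S (m + 1)) e = pair κ (S m) (e - δ) := by
    intro m e
    have := pair_pow_mul h hu hv hF ((hS.lexBounded m).pairConverges hκ) 1 e
    rwa [pow_one, ← hS.succ, one_smul] at this
  induction m using Int.induction_on generalizing e with
  | zero =>
    rw [hS.zero, pair, finsum_eq_single _ 0 fun z hz => by simp [monomial, hz]]
    simp [monomial]
  | succ m ih => rw [h1, ih, add_smul, one_smul, sub_sub, add_comm]
  | pred m ih =>
    have := h1 (-m - 1) (e + δ)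
    rw [sub_add_cancel, ih, add_sub_cancel_right] at this
    rw [← this]
    congr 1
    module

/-- The substitution `x ↦ F(x, y)` in a series `X(x, y)`, where the `S m` are the powers of `F`. -/
def substFst (S : ℤ → Bilateral (Fin 2) R) (X : Bilateral (Fin 2) M) : Bilateral (Fin 2) M :=
  fun z => ∑ᶠ y : Fin 2 → ℤ, S (y 0) (z - Pi.single 1 (y 1)) • X y

theorem substFst_fst_ge {F : MvPowerSeries (Fin 2) R} {S : ℤ → Bilateral (Fin 2) R}
    (hS : IsPowers F S) {X : Bilateral (Fin 2) M} {c : ℤ} (hX : ∀ z, X z ≠ 0 → c ≤ z 1)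
    {z : Fin 2 → ℤ} (hz : substFst S X z ≠ 0) : c ≤ z 1 := by
  by_contra hc
  refine hz (finsum_eq_zero_of_forall_eq_zero fun y => ?_)
  by_contra h
  have h1 : X y ≠ 0 := fun h0 => h (by simp [h0])
  have h2 : S (y 0) (z - Pi.single 1 (y 1)) ≠ 0 := fun h0 => h (by simp [h0])
  have h3 := (hS.supp _ _ h2).1
  have h4 := hX y h1
  simp at h3
  omega

theorem substFst_lexBounded {F : MvPowerSeries (Fin 2) R} {S : ℤ → Bilateral (Fin 2) R}
    (hS : IsPowers F S) {X : Bilateral (Fin 2) M} (hX : LexBounded 1 X) :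
    LexBounded 1 (substFst S X) := by
  obtain ⟨c, hc⟩ := hX.1
  refine ⟨⟨c, fun z hz => substFst_fst_ge hS hc hz⟩, fun d => ?_⟩
  obtain ⟨b, hb⟩ := hX.2 d
  refine ⟨min c (b + c - d), fun z hz hd => ?_⟩
  obtain ⟨y, hy⟩ : ∃ y, S (y 0) (z - Pi.single 1 (y 1)) • X y ≠ 0 := by
    by_contra! h0
    exact hz (finsum_eq_zero_of_forall_eq_zero h0)
  have h1 : X y ≠ 0 := fun h0 => hy (by simp [h0])
  have h2 := hS.supp (y 0) (z - Pi.single 1 (y 1)) fun h0 => hy (by simp [h0])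
  simp at h2
  have h3 := hc y h1
  have h4 := hb y h1 (by omega) 0
  intro i
  fin_cases i <;> simp <;> omega

/-- Substituting along a kernel on which `F(u, v)` acts as the monomial with exponents `δ`
intertwines `x ↦ F(x, y)` with the substitution of this monomial for `x`. -/
theorem pair_substFst {u v : MvPowerSeries σ R} {κ : (Fin 2 → ℤ) → Bilateral σ R}
    (h : IsKernel u v κ) (hu : constantCoeff u = 0) (hv : constantCoeff v = 0)
    {F : MvPowerSeries (Fin 2) R} {δ : σ → ℤ}
    (hF : ∀ z e, mul (ofPowerSeries (F.subst ![u, v])) (κ z) e = κ z (e - δ))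
    (hκ : UpperBounded 1 κ) {S : ℤ → Bilateral (Fin 2) R} (hS : IsPowers F S)
    {X : Bilateral (Fin 2) M} (hX : LexBounded 1 X) (e : σ → ℤ) :
    pair κ (substFst S X) e =
      ∑ᶠ y : Fin 2 → ℤ, κ (Pi.single 1 (y 1)) (e - y 0 • δ) • X y := by
  rw [pair]
  simp only [substFst]
  have hcomm := finsum_smul_finsum_smul (a := fun z => κ z e)
    (K := fun z (y : Fin 2 → ℤ) => S (y 0) (z - Pi.single 1 (y 1))) (g := X) ?_
  · refine hcomm.trans (finsum_congr fun y => ?_)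
    congr 1
    have hκ' : UpperBounded 1 fun z => κ (z + Pi.single 1 (y 1)) := by
      intro e
      obtain ⟨c, hc⟩ := hκ e
      refine ⟨c - y 1, fun z hz => ?_⟩
      have := hc _ hz
      simp at this
      omega
    have := pair_powers (h.translate (Pi.single 1 (y 1))) hu hv (fun z e => hF _ e) hκ' hS (y 0) e
    rw [zero_add] at this
    rw [← this, pair, ← finsum_comp_equiv (Equiv.addRight (Pi.single 1 (y 1)))]
    simp
  · obtain ⟨c, hc⟩ := hκ e
    obtain ⟨n, hn⟩ := hX.1
    obtain ⟨b, hb⟩ := hX.2 c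
    refine ((finite_box (min n (b + n - c)) (c - n + |c|)).prod
      (finite_box (min n b) (c - n + |c|))).subset fun p hp => ?_
    have h1 := hc _ hp.1
    have h2 := hS.supp _ _ hp.2.1
    have h3 := hn _ hp.2.2
    simp at h2
    have h4 := hb _ hp.2.2 (by omega) 0
    have h5 := le_abs_self c
    have h6 := neg_abs_le c
    constructor <;> intro i <;> fin_cases i <;> simp <;> omega

end Bilateral

/-! ### Series in one or two of the variables -/

namespace Bilateral

section OfVars

variable {σ R M : Type*} [DecidableEq σ] [CommRing R] [AddCommGroup M] [Module R M]

/-- The exponents of `z_i ^ (z 0) * z_j ^ (z 1)`. -/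
def plane (i j : σ) (z : Fin 2 → ℤ) : σ → ℤ := Pi.single i (z 0) + Pi.single j (z 1)

theorem plane_apply_fst {i j : σ} (h : i ≠ j) (z : Fin 2 → ℤ) : plane i j z i = z 0 := by
  simp [plane, h]

theorem plane_apply_snd {i j : σ} (h : i ≠ j) (z : Fin 2 → ℤ) : plane i j z j = z 1 := by
  simp [plane, h.symm]

theorem plane_apply_of_ne {i j k : σ} (hi : k ≠ i) (hj : k ≠ j) (z : Fin 2 → ℤ) :
    plane i j z k = 0 := by
  simp [plane, hi, hj]

theorem plane_injective {i j : σ} (h : i ≠ j) : Function.Injective (plane i j) := by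
  intro y z hyz
  funext s
  fin_cases s
  · simpa [plane_apply_fst h] using congrFun hyz i
  · simpa [plane_apply_snd h] using congrFun hyz j

theorem eq_plane {i j : σ} (h : i ≠ j) {e : σ → ℤ} (he : ∀ k, k ≠ i → k ≠ j → e k = 0) :
    e = plane i j ![e i, e j] := by
  funext k
  by_cases hi : k = i
  · subst hi; simp [plane_apply_fst h]
  by_cases hj : k = j
  · subst hj; simp [plane_apply_snd h]
  rw [he k hi hj, plane_apply_of_ne hi hj]

theorem ofVars_plane {i j : σ} (h : i ≠ j) (g : ℤ → ℤ → M) (z : Fin 2 → ℤ) :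
    ofVars i j g (plane i j z) = g (z 0) (z 1) := by
  rw [ofVars, if_pos fun k hi hj => plane_apply_of_ne hi hj z, plane_apply_fst h,
    plane_apply_snd h]

theorem mem_range_plane {i j : σ} (h : i ≠ j) {g : ℤ → ℤ → M} {e : σ → ℤ}
    (he : ofVars i j g e ≠ 0) : e ∈ Set.range (plane i j) := by
  refine ⟨![e i, e j], (eq_plane h fun k hi hj => ?_).symm⟩
  by_contra hk
  exact he (if_neg fun h' => hk (h' k hi hj))

theorem mul_ofVars {i j : σ} (h : i ≠ j) (f : Bilateral σ R) (g : ℤ → ℤ → M) (e : σ → ℤ) :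
    mul f (ofVars i j g) e = ∑ᶠ z : Fin 2 → ℤ, f (e - plane i j z) • g (z 0) (z 1) := by
  rw [mul_eq_finsum, finsum_comp_of_support_subset_range (plane_injective h)]
  · simp only [ofVars_plane h]
  · exact fun d hd => mem_range_plane h (right_ne_zero_of_smul hd)

theorem ofVars_mul {i j : σ} (h : i ≠ j) (g : ℤ → ℤ → R) (f : Bilateral σ M) (e : σ → ℤ) :
    mul (ofVars i j g) f e = ∑ᶠ z : Fin 2 → ℤ, g (z 0) (z 1) • f (e - plane i j z) := by
  rw [mul, finsum_comp_of_support_subset_range (plane_injective h)]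
  · simp only [ofVars_plane h]
  · exact fun d hd => mem_range_plane h (left_ne_zero_of_smul hd)

theorem ofVar_single (i : σ) (g : ℤ → M) (n : ℤ) : ofVar i g (Pi.single i n) = g n := by
  rw [ofVar, if_pos fun k hk => by simp [hk], Pi.single_eq_same]

theorem mem_range_single {i : σ} {g : ℤ → M} {e : σ → ℤ} (he : ofVar i g e ≠ 0) :
    e ∈ Set.range fun n : ℤ => (Pi.single i n : σ → ℤ) := by
  refine ⟨e i, funext fun k => ?_⟩
  by_cases hk : k = i
  · subst hk; simp
  · by_contra h
    refine he (if_neg fun h' => h ?_)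
    simp [hk, h' k hk]

theorem mul_ofVar (i : σ) (f : Bilateral σ R) (g : ℤ → M) (e : σ → ℤ) :
    mul f (ofVar i g) e = ∑ᶠ n : ℤ, f (e - Pi.single i n) • g n := by
  rw [mul_eq_finsum, finsum_comp_of_support_subset_range (Pi.single_injective i)]
  · simp only [ofVar_single]
  · exact fun d hd => mem_range_single (right_ne_zero_of_smul hd)

theorem ofVar_mul (i : σ) (g : ℤ → R) (f : Bilateral σ M) (e : σ → ℤ) :
    mul (ofVar i g) f e = ∑ᶠ n : ℤ, g n • f (e - Pi.single i n) := by
  rw [mul, finsum_comp_of_support_subset_range (Pi.single_injective i)]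
  · simp only [ofVar_single]
  · exact fun d hd => mem_range_single (left_ne_zero_of_smul hd)

end OfVars

/-! ### Products in `R((x))` and `R((x))((y))` -/

section Laurent

theorem _root_.HahnSeries.finite_mul_support {R : Type*} [CommRing R] (x y : HahnSeries ℤ R)
    (n : ℤ) : {m : ℤ | x.coeff m ≠ 0 ∧ y.coeff (n - m) ≠ 0}.Finite := by
  refine ((Finset.antidiagonal x.isPWO_support y.isPWO_support n).finite_toSet.image
    Prod.fst).subset fun m hm => ⟨(m, n - m), ?_, rfl⟩
  simpa using hm

theorem _root_.HahnSeries.coeff_mul_eq_finsum {R : Type*} [CommRing R] (x y : HahnSeries ℤ R)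
    (n : ℤ) : (x * y).coeff n = ∑ᶠ m : ℤ, x.coeff m * y.coeff (n - m) := by
  rw [HahnSeries.coeff_mul, finsum_eq_sum_of_support_subset
    (s := (Finset.antidiagonal x.isPWO_support y.isPWO_support n).image Prod.fst)]
  · rw [Finset.sum_image]
    · refine Finset.sum_congr rfl fun p hp => ?_
      simp only [Finset.mem_antidiagonal] at hp
      rw [← hp.2.2, add_sub_cancel_left]
    · intro p hp q hq h
      simp only [Finset.mem_coe, Finset.mem_antidiagonal] at hp hq
      refine Prod.ext h ?_
      have h1 := hp.2.2
      have h2 := hq.2.2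
      omega
  · intro m hm
    have h1 : x.coeff m ≠ 0 := fun h0 => hm (by simp [h0])
    have h2 : y.coeff (n - m) ≠ 0 := fun h0 => hm (by simp [h0])
    simp only [Finset.coe_image, Set.mem_image, Finset.mem_coe, Finset.mem_antidiagonal]
    exact ⟨(m, n - m), ⟨h1, h2, by simp⟩, rfl⟩

variable {σ R : Type*} [CommRing R]

theorem finite_iterated_support (w w' : LaurentSeries (LaurentSeries R)) (m n : ℤ) :
    {z : Fin 2 → ℤ | (w.coeff (z 1)).coeff (z 0) ≠ 0 ∧
      (w'.coeff (n - z 1)).coeff (m - z 0) ≠ 0}.Finite := by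
  have h := (HahnSeries.finite_mul_support w w' n).biUnion fun k _ =>
    (HahnSeries.finite_mul_support (w.coeff k) (w'.coeff (n - k)) m).prod (Set.finite_singleton k)
  refine (h.preimage (finTwoArrowEquiv ℤ).injective.injOn).subset fun z hz => ?_
  refine Set.mem_biUnion (x := z 1) ⟨fun h0 => hz.1 ?_, fun h0 => hz.2 ?_⟩ ⟨hz, rfl⟩
  · rw [h0]; rfl
  · rw [h0]; rfl

theorem coeff_coeff_mul (w w' : LaurentSeries (LaurentSeries R)) (m n : ℤ) :
    ((w * w').coeff n).coeff m = ∑ᶠ z : Fin 2 → ℤ,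
      (w.coeff (z 1)).coeff (z 0) * (w'.coeff (n - z 1)).coeff (m - z 0) := by
  have h := HahnSeries.finite_mul_support w w' n
  have h1 : (∑ᶠ k, w.coeff k * w'.coeff (n - k)).coeff m =
      ∑ᶠ k, (w.coeff k * w'.coeff (n - k)).coeff m :=
    (HahnSeries.coeff.addMonoidHom (R := R) m).map_finsum (h.subset fun k hk =>
      ⟨fun h0 => hk (by simp [h0]), fun h0 => hk (by simp [h0])⟩)
  rw [HahnSeries.coeff_mul_eq_finsum, h1]
  simp only [HahnSeries.coeff_mul_eq_finsum]
  rw [← finsum_comp_equiv (finTwoArrowEquiv ℤ).symm,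
    ← finsum_comp_equiv (Equiv.prodComm ℤ ℤ)]
  refine (finsum_curry (fun p : ℤ × ℤ => (w.coeff p.1).coeff p.2 *
    (w'.coeff (n - p.1)).coeff (m - p.2)) ?_).symm
  refine ((finite_iterated_support w w' m n).image fun z => (z 1, z 0)).subset fun p hp => ?_
  exact ⟨![p.2, p.1], ⟨left_ne_zero_of_mul hp, right_ne_zero_of_mul hp⟩, rfl⟩

theorem ofIterated_plane [DecidableEq σ] {i j : σ} (h : i ≠ j)
    (w : LaurentSeries (LaurentSeries R)) (z : Fin 2 → ℤ) :
    ofIterated i j w (plane i j z) = (w.coeff (z 1)).coeff (z 0) :=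
  ofVars_plane h _ z

theorem ofIterated_mul {i j : σ} (h : i ≠ j) (w w' : LaurentSeries (LaurentSeries R)) :
    ofIterated i j (w * w') = mul (ofIterated i j w) (ofIterated i j w') := by
  classical
  funext e
  rw [ofIterated, ofIterated, ofVars_mul h]
  by_cases he : ∀ k, k ≠ i → k ≠ j → e k = 0
  · rw [ofVars, if_pos he, coeff_coeff_mul]
    refine finsum_congr fun z => ?_
    rw [ofIterated, ofVars, if_pos fun k hi hj => by simp [he k hi hj, plane_apply_of_ne hi hj]]
    simp [plane_apply_fst h, plane_apply_snd h]
  · rw [ofVars, if_neg he]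
    refine (finsum_eq_zero_of_forall_eq_zero fun z => ?_).symm
    rw [ofIterated, ofVars, if_neg, smul_zero]
    intro h'
    refine he fun k hi hj => ?_
    simpa [plane_apply_of_ne hi hj] using h' k hi hj

theorem ofIterated_one {i j : σ} (h : i ≠ j) :
    ofIterated i j (1 : LaurentSeries (LaurentSeries R)) = monomial R 0 := by
  classical
  funext e
  by_cases he : ∀ k, k ≠ i → k ≠ j → e k = 0
  · rw [eq_plane h he, ofIterated_plane h, monomial, HahnSeries.coeff_one]
    have : plane i j ![e i, e j] = 0 ↔ e j = 0 ∧ e i = 0 := by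
      refine ⟨fun h0 => ⟨?_, ?_⟩, fun h0 => ?_⟩
      · simpa [plane_apply_snd h] using congrFun h0 j
      · simpa [plane_apply_fst h] using congrFun h0 i
      · simp [plane, h0]
    simp only [this]
    by_cases hj : e j = 0
    · simp [hj, HahnSeries.coeff_one]
    · simp [hj]
  · rw [ofIterated, ofVars, if_neg he, monomial, if_neg]
    rintro rfl
    exact he fun k _ _ => rfl

end Laurent

end Bilateral

/-! ### Supports of the powers of invertible series -/

/-- A multiplicative filtration that contains a unit in degree `1` and its inverse in degree `-1`
contains its `m`-th power in degree `m`. -/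
theorem Units.zpow_mem_filtration {A : Type*} [CommRing A] {P : ℤ → A → Prop} (one : P 0 1)
    (mul : ∀ {m n a b}, P m a → P n b → P (m + n) (a * b)) {w : Aˣ} (hw : P 1 w.val)
    (hw' : P (-1) (w⁻¹).val) (m : ℤ) : P m (w ^ m).val := by
  induction m using Int.induction_on with
  | zero => simpa using one
  | succ m ih => rw [zpow_add_one, Units.val_mul]; exact mul ih hw
  | pred m ih => rw [zpow_sub_one, Units.val_mul]; exact mul ih hw'

namespace LaurentSeries

variable {R : Type*} [CommRing R]

/-- The Laurent series in `x ^ m R⟦x⟧`. -/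
def OrderGE (m : ℤ) (f : LaurentSeries R) : Prop := ∀ k, f.coeff k ≠ 0 → m ≤ k

theorem OrderGE.mul {m n : ℤ} {f g : LaurentSeries R} (hf : OrderGE m f) (hg : OrderGE n g) :
    OrderGE (m + n) (f * g) := by
  intro k hk
  rw [HahnSeries.coeff_mul_eq_finsum] at hk
  obtain ⟨l, hl⟩ : ∃ l, f.coeff l * g.coeff (k - l) ≠ 0 := by
    by_contra! h0
    exact hk (finsum_eq_zero_of_forall_eq_zero h0)
  have h1 := hf l (left_ne_zero_of_mul hl)
  have h2 := hg _ (right_ne_zero_of_mul hl)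
  omega

theorem orderGE_ofPowerSeries (f : PowerSeries R) :
    OrderGE 0 (HahnSeries.ofPowerSeries ℤ R f) := by
  intro k hk
  by_contra h
  rw [PowerSeries.coeff_coe, if_pos (not_le.1 h)] at hk
  exact hk rfl

theorem orderGE_one : OrderGE 0 (1 : LaurentSeries R) := by
  rw [← map_one (HahnSeries.ofPowerSeries ℤ R)]
  exact orderGE_ofPowerSeries 1

theorem orderGE_single (m : ℤ) (r : R) : OrderGE m (HahnSeries.single m r) := by
  intro k hk
  by_contra h
  exact hk (HahnSeries.coeff_single_of_ne fun h' => h h'.ge)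

theorem orderGE_one_of_constantCoeff {f : PowerSeries R} (hf : PowerSeries.constantCoeff f = 0) :
    OrderGE 1 (HahnSeries.ofPowerSeries ℤ R f) := by
  obtain ⟨u, rfl⟩ := PowerSeries.X_dvd_iff.2 hf
  rw [map_mul, HahnSeries.ofPowerSeries_X]
  exact (orderGE_single 1 1).mul (orderGE_ofPowerSeries u)

/-- A power series of order `1` with invertible leading coefficient has an inverse of order `-1`. -/
theorem exists_inverse {f : PowerSeries R} (hf : PowerSeries.constantCoeff f = 0)
    (hf1 : IsUnit (PowerSeries.coeff 1 f)) :
    ∃ g : LaurentSeries R, HahnSeries.ofPowerSeries ℤ R f * g = 1 ∧ OrderGE (-1) g := by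
  obtain ⟨u, rfl⟩ := PowerSeries.X_dvd_iff.2 hf
  have hu : IsUnit u := by
    rw [PowerSeries.isUnit_iff_constantCoeff]
    rw [PowerSeries.coeff_one_mul] at hf1
    simpa using hf1
  obtain ⟨v, hv⟩ := hu.exists_right_inv
  refine ⟨HahnSeries.single (-1) 1 * HahnSeries.ofPowerSeries ℤ R v, ?_,
    by simpa using (orderGE_single (-1) 1).mul (orderGE_ofPowerSeries v)⟩
  rw [map_mul, mul_mul_mul_comm, ← map_mul, hv, HahnSeries.ofPowerSeries_X,
    HahnSeries.single_mul_single]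
  simp

/-- The integral powers of a unit of `R((x))` given by a power series of order `1`. -/
theorem orderGE_inv {f : PowerSeries R} (hf : PowerSeries.constantCoeff f = 0)
    (hf1 : IsUnit (PowerSeries.coeff 1 f)) {w : (LaurentSeries R)ˣ}
    (hw : w.val = HahnSeries.ofPowerSeries ℤ R f) (m : ℤ) : OrderGE m (w ^ m).val := by
  obtain ⟨g, hg, hg'⟩ := exists_inverse hf hf1
  refine Units.zpow_mem_filtration (P := OrderGE) orderGE_one OrderGE.mul ?_ ?_ m
  · rw [hw]; exact orderGE_one_of_constantCoeff hf
  · rwa [show (w⁻¹).val = g from Units.inv_eq_of_mul_eq_one_right (hw ▸ hg)]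

/-- The series in `R((x))⟦y⟧` whose monomials `x ^ k * y ^ n` have degree `k + n ≥ m`. -/
def DegreeGE (m : ℤ) (φ : PowerSeries (LaurentSeries R)) : Prop :=
  ∀ n : ℕ, OrderGE (m - n) (PowerSeries.coeff n φ)

theorem OrderGE.sum {ι : Type*} {s : Finset ι} {m : ℤ} {f : ι → LaurentSeries R}
    (h : ∀ i ∈ s, OrderGE m (f i)) : OrderGE m (∑ i ∈ s, f i) := by
  intro k hk
  rw [HahnSeries.coeff_sum] at hk
  obtain ⟨i, hi, hi'⟩ := Finset.exists_ne_zero_of_sum_ne_zero hk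
  exact h i hi k hi'

theorem DegreeGE.mul {m n : ℤ} {φ ψ : PowerSeries (LaurentSeries R)} (hφ : DegreeGE m φ)
    (hψ : DegreeGE n ψ) : DegreeGE (m + n) (φ * ψ) := by
  intro l
  rw [PowerSeries.coeff_mul]
  refine OrderGE.sum fun p hp => ?_
  rw [Finset.HasAntidiagonal.mem_antidiagonal] at hp
  have := (hφ p.1).mul (hψ p.2)
  rwa [show m + n - (l : ℤ) = m - p.1 + (n - p.2) by rw [← hp]; push_cast; ring]

theorem degreeGE_C {m : ℤ} {f : LaurentSeries R} (hf : OrderGE m f) :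
    DegreeGE m (PowerSeries.C f) := by
  intro n
  rw [PowerSeries.coeff_C]
  split_ifs with h
  · subst h; simpa using hf
  · intro k hk; exact absurd rfl hk

theorem degreeGE_one : DegreeGE 0 (1 : PowerSeries (LaurentSeries R)) := by
  rw [← map_one PowerSeries.C]
  exact degreeGE_C orderGE_one

theorem DegreeGE.pow {φ : PowerSeries (LaurentSeries R)} (hφ : DegreeGE 0 φ) (J : ℕ) :
    DegreeGE 0 (φ ^ J) := by
  induction J with
  | zero => rw [pow_zero]; exact degreeGE_one
  | succ J ih => rw [pow_succ]; exact ih.mul hφ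

/-- If `φ` has degree `≥ 1` and its value at `y = 0` has an inverse of order `-1`, then the inverse
of `φ` has degree `≥ -1`. -/
theorem DegreeGE.inv {φ ψ : PowerSeries (LaurentSeries R)} (hφ : DegreeGE 1 φ) (h : φ * ψ = 1)
    {g : LaurentSeries R} (hg : PowerSeries.constantCoeff φ * g = 1) (hg' : OrderGE (-1) g) :
    DegreeGE (-1) ψ := by
  -- `ε = 1 - g φ` is divisible by `y`; compare `g⁻¹ ψ = (1 - ε)⁻¹` with the geometric series
  set ε := 1 - PowerSeries.C g * φ with hε
  have hε0 : DegreeGE 0 ε := by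
    intro n
    have h1 := degreeGE_one (R := R) n
    have h2 := (degreeGE_C hg').mul hφ n
    rw [neg_add_cancel] at h2
    intro k hk
    rw [hε, map_sub, HahnSeries.coeff_sub] at hk
    by_cases hk1 : (PowerSeries.coeff n (1 : PowerSeries (LaurentSeries R))).coeff k = 0
    · exact h2 k fun h0 => hk (by rw [hk1, h0, sub_zero])
    · exact h1 k hk1
  have hεX : PowerSeries.X ∣ ε := by
    rw [PowerSeries.X_dvd_iff, hε, map_sub, map_mul, PowerSeries.constantCoeff_C, mul_comm, hg]
    simp
  set I := ψ * PowerSeries.C (PowerSeries.constantCoeff φ) with hI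
  have hIψ : ψ = PowerSeries.C g * I := by
    rw [hI, mul_left_comm, ← map_mul, mul_comm g, hg, map_one, mul_one]
  have hI1 : (1 - ε) * I = 1 := by
    rw [hε, sub_sub_cancel, mul_right_comm, ← hIψ, mul_comm, h]
  have hI0 : DegreeGE 0 I := by
    intro n k hk
    have h1 : I = ∑ j ∈ Finset.range (n + 1), ε ^ j + ε ^ (n + 1) * I := by
      linear_combination (∑ j ∈ Finset.range (n + 1), ε ^ j) * hI1 -
        I * mul_neg_geom_sum ε (n + 1)
    have h3 : PowerSeries.coeff n (ε ^ (n + 1) * I) = 0 :=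
      PowerSeries.X_pow_dvd_iff.1 (Dvd.dvd.mul_right (pow_dvd_pow_of_dvd hεX _) _) n (by omega)
    rw [h1, map_add, h3, add_zero, map_sum] at hk
    exact OrderGE.sum (fun j _ => hε0.pow j n) k hk
  rw [hIψ]
  have := (degreeGE_C hg').mul hI0
  rwa [add_zero] at this

end LaurentSeries

namespace Bilateral

open LaurentSeries

variable {σ R : Type*} [CommRing R]

theorem coeff_coeff_iterated (f : MvPowerSeries (Fin 2) R) (p q : ℤ) :
    ((FormalGroup.iterated f).coeff q).coeff p =
      if 0 ≤ p ∧ 0 ≤ q then f.coeff (single 0 p.toNat + single 1 q.toNat) else 0 := by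
  rw [FormalGroup.iterated, PowerSeries.coeff_coe]
  by_cases hq : 0 ≤ q
  · rw [if_neg (not_lt.2 hq), PowerSeries.coeff_mk, PowerSeries.coeff_coe]
    by_cases hp : 0 ≤ p
    · rw [if_neg (not_lt.2 hp), if_pos ⟨hp, hq⟩, PowerSeries.coeff_mk]
      congr 3 <;> congr 1 <;> omega
    · rw [if_pos (not_le.1 hp), if_neg fun h => hp h.1]
  · rw [if_pos (not_le.1 hq), if_neg fun h => hq h.2]
    rfl

theorem hasSubst_X_X (i j : σ) : HasSubst ![(X i : MvPowerSeries σ R), X j] :=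
  hasSubst_of_constantCoeff_zero fun s => by fin_cases s <;> simp

/-- The inclusion of `R⟦x, y⟧ ⊆ R((x))((y))` into the bilateral series substitutes `z_i` and `z_j`
for `x` and `y`. -/
theorem ofIterated_iterated [Fintype σ] {i j : σ} (h : i ≠ j) (f : MvPowerSeries (Fin 2) R) :
    ofIterated i j (FormalGroup.iterated f) = ofPowerSeries (f.subst ![X i, X j]) := by
  classical
  funext e
  by_cases he : ∀ k, 0 ≤ e k
  · obtain ⟨n, rfl⟩ := exists_natCast he
    have hprod : ∀ d : Fin 2 →₀ ℕ, (d.prod fun s k => ![(X i : MvPowerSeries σ R), X j] s ^ k) =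
        MvPowerSeries.monomial (single i (d 0) + single j (d 1)) 1 := by
      intro d
      rw [Finsupp.prod_fintype _ _ (by simp), Fin.prod_univ_two]
      simp [X_pow_eq, monomial_mul_monomial]
    rw [ofPowerSeries_natCast, MvPowerSeries.coeff_subst (hasSubst_X_X i j)]
    simp only [hprod, MvPowerSeries.coeff_monomial]
    rw [finsum_eq_single _ (single 0 (n i) + single 1 (n j))]
    · rw [ofIterated, ofVars, coeff_coeff_iterated,
        if_pos (⟨Int.natCast_nonneg _, Int.natCast_nonneg _⟩ : _ ∧ _)]
      have : (∀ k, k ≠ i → k ≠ j → (n k : ℤ) = 0) ↔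
          n = single i ((single 0 (n i) + single 1 (n j) : Fin 2 →₀ ℕ) 0) +
            single j ((single 0 (n i) + single 1 (n j) : Fin 2 →₀ ℕ) 1) := by
        constructor
        · intro hk
          ext k
          by_cases hi : k = i
          · subst hi; simp [h]
          by_cases hj : k = j
          · subst hj; simp [h.symm]
          have := hk k hi hj
          simp [Ne.symm hi, Ne.symm hj]
          omega
        · intro hn k hi hj
          rw [hn]
          simp [Ne.symm hi, Ne.symm hj]
      by_cases hn : ∀ k, k ≠ i → k ≠ j → (n k : ℤ) = 0
      · rw [if_pos hn, if_pos (this.1 hn)]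
        simp
      · rw [if_neg hn, if_neg (mt this.2 hn), smul_zero]
    · intro d hd
      rw [if_neg, smul_zero]
      rintro rfl
      refine hd ?_
      ext s
      fin_cases s <;> simp [h, h.symm]
  · rw [ofPowerSeries, if_neg he, ofIterated, ofVars]
    split_ifs with h1
    · rw [coeff_coeff_iterated, if_neg]
      rintro ⟨hi, hj⟩
      refine he fun k => ?_
      by_cases hki : k = i
      · rwa [hki]
      by_cases hkj : k = j
      · rwa [hkj]
      exact (h1 k hki hkj).ge
    · rfl

/-- Let a unit of `R((x))((y))` be given by a power series without constant term and with
invertible coefficient of `x`. Then its `m`-th power, for any integer `m`, contains only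
nonnegative powers of `y` and only monomials of total degree at least `m`. -/
theorem zpow_supp {f : MvPowerSeries (Fin 2) R} {w : (LaurentSeries (LaurentSeries R))ˣ}
    (hw : w.val = FormalGroup.iterated f) (h0 : constantCoeff f = 0)
    (h1 : IsUnit (f.coeff (single 0 1))) (m p q : ℤ)
    (h : ((w ^ m).val.coeff q).coeff p ≠ 0) : 0 ≤ q ∧ m ≤ p + q := by
  let φ : PowerSeries (LaurentSeries R) := PowerSeries.mk fun n =>
    HahnSeries.ofPowerSeries ℤ R <| PowerSeries.mk fun m => f.coeff (single 0 m + single 1 n)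
  have hφ : w.val = HahnSeries.ofPowerSeries ℤ (LaurentSeries R) φ := hw
  have hφ1 : DegreeGE 1 φ := by
    intro n k hk
    rw [PowerSeries.coeff_mk, PowerSeries.coeff_coe] at hk
    split_ifs at hk with hk0
    · exact absurd rfl hk
    · rw [PowerSeries.coeff_mk] at hk
      by_contra h2
      refine hk ?_
      have h3 : k.natAbs = 0 := by omega
      have h4 : n = 0 := by omega
      subst h4
      rw [h3]
      simpa using h0
  obtain ⟨g, hg, hg'⟩ := exists_inverse
    (f := PowerSeries.mk fun m => f.coeff (single 0 m)) (by
      rw [← PowerSeries.coeff_zero_eq_constantCoeff_apply, PowerSeries.coeff_mk]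
      simpa using h0) (by rwa [PowerSeries.coeff_mk])
  have hg1 : PowerSeries.constantCoeff φ * g = 1 := by
    rw [← hg, ← PowerSeries.coeff_zero_eq_constantCoeff_apply, PowerSeries.coeff_mk]
    simp
  obtain ⟨ψ, hψ⟩ := (PowerSeries.isUnit_iff_constantCoeff.2
    (IsUnit.of_mul_eq_one g hg1)).exists_right_inv
  have hP := Units.zpow_mem_filtration (w := w)
    (P := fun m a => ∃ χ, DegreeGE m χ ∧ a = HahnSeries.ofPowerSeries ℤ (LaurentSeries R) χ)
    ⟨1, degreeGE_one, (map_one _).symm⟩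
    (by
      rintro m n _ _ ⟨χ, hχ, rfl⟩ ⟨χ', hχ', rfl⟩
      exact ⟨χ * χ', hχ.mul hχ', (map_mul _ _ _).symm⟩)
    ⟨φ, hφ1, hφ⟩
    ⟨ψ, hφ1.inv hψ hg1 hg', Units.inv_eq_of_mul_eq_one_right (by
      rw [hφ, ← map_mul, hψ, map_one])⟩ m
  obtain ⟨χ, hχ, hwχ⟩ := hP
  rw [hwχ, PowerSeries.coeff_coe] at h
  split_ifs at h with hq
  · exact absurd rfl h
  · have := hχ _ _ h
    omega

end Bilateral

/-! ### The group of points of a formal group law -/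

namespace FormalGroup

variable {R σ : Type*} [CommRing R] (F : FormalGroup R)

theorem isNilpotent_iota_subst (x : F.Point σ) : PowerSeries.HasSubst (F.iota.subst x.val) :=
  IsNilpotent_subst x.prop.const (by
    change IsNilpotent (PowerSeries.constantCoeff F.iota)
    rw [F.constantCoeff_iota]
    exact IsNilpotent.zero)

/-- The inverse of a point is given by the series `ι`. -/
instance : Neg (F.Point σ) where
  neg x := ⟨F.iota.subst x.val, F.isNilpotent_iota_subst x⟩

theorem neg_val (x : F.Point σ) : (-x).val = F.iota.subst x.val := rfl

theorem point_add_neg (x : F.Point σ) : x + -x = 0 := by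
  refine Subtype.ext ?_
  have hX : HasSubst ![(PowerSeries.X : PowerSeries R), F.iota] :=
    hasSubst_of_constantCoeff_zero fun s => by
      fin_cases s
      · exact PowerSeries.constantCoeff_X
      · exact F.constantCoeff_iota
  have h := congrArg (PowerSeries.subst x.val) F.subst_iota
  rw [PowerSeries.subst, MvPowerSeries.subst_comp_subst_apply hX x.prop.const] at h
  have h0 : PowerSeries.subst x.val (0 : PowerSeries R) = 0 := by
    rw [← PowerSeries.coe_substAlgHom x.prop, map_zero]
  rw [add_apply, neg_val, zero_apply, ← h0]
  refine Eq.trans ?_ h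
  congr 1
  funext s
  fin_cases s
  · exact (PowerSeries.subst_X x.prop).symm
  · rfl

instance [F.IsComm] : AddCommGroup (F.Point σ) where
  neg_add_cancel x := (add_comm (-x) x).trans (F.point_add_neg x)
  zsmul := zsmulRec

/-- The coordinate functions as points. -/
def pointX (i : σ) : F.Point σ := ⟨X i, PowerSeries.HasSubst.X i⟩

theorem hasSubst_points (x y : F.Point σ) : HasSubst ![x.val, y.val] :=
  hasSubst_of_constantCoeff_nilpotent fun s => by
    fin_cases s
    · exact x.prop
    · exact y.prop

theorem X_dvd_sub : (X 0 : MvPowerSeries (Fin 2) R) ∣ F.toPowerSeries - X 1 := by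
  rw [X_dvd_iff]
  intro m hm
  have hm' : m = single 1 (m 1) := by
    ext s
    fin_cases s <;> simp [hm]
  rw [map_sub, hm', F.coeff_single_one, coeff_X, sub_eq_zero]
  congr 1
  rw [eq_iff_iff]
  constructor
  · intro h; rw [h]
  · intro h; simpa using congrArg (· 1) h

/-- In the group of points, the value of `x` divides the difference of the values of `x + y`
and `y`. -/
theorem dvd_add_val_sub (x y : F.Point σ) : x.val ∣ (x + y).val - y.val := by
  obtain ⟨c, hc⟩ := F.X_dvd_sub
  have h := F.hasSubst_points x y
  refine ⟨c.subst ![x.val, y.val], ?_⟩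
  have := congrArg (MvPowerSeries.subst ![x.val, y.val]) hc
  rw [← coe_substAlgHom h, map_sub, map_mul, coe_substAlgHom h, subst_X h, subst_X h] at this
  exact this

theorem sumUnit_zpow_supp (m p q : ℤ) (h : ((F.sumUnit ^ m).val.coeff q).coeff p ≠ 0) :
    0 ≤ q ∧ m ≤ p + q := by
  refine Bilateral.zpow_supp (f := F.toPowerSeries) rfl F.zero_constantCoeff ?_ m p q h
  rw [F.lin_coeff_X]
  exact isUnit_one

theorem iotaUnit_zpow_supp (m p : ℤ) (h : (F.iotaUnit ^ m).val.coeff p ≠ 0) : m ≤ p :=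
  LaurentSeries.orderGE_inv (w := F.iotaUnit) F.constantCoeff_iota
    (by rw [F.coeff_one_iota]; exact isUnit_one.neg) rfl m p h

variable [F.IsComm]

theorem sub_val (x y : F.Point σ) :
    (x - y).val = F.toPowerSeries.subst ![x.val, F.iota.subst y.val] := by
  rw [sub_eq_add_neg]; rfl

theorem diff_subst (x y : F.Point σ) : F.diff.subst ![x.val, y.val] = (x - y).val := by
  have h := F.hasSubst_points x y
  have h1 : F.diff = F.toPowerSeries.subst
    ![(F.pointX (0 : Fin 2)).val, (-F.pointX (1 : Fin 2)).val] := rfl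
  rw [h1, subst_comp_subst_apply (F.hasSubst_points _ _) h, sub_val]
  congr 1
  funext s
  fin_cases s
  · exact subst_X h 0
  · change MvPowerSeries.subst _ (PowerSeries.subst _ _) = PowerSeries.subst _ _
    rw [PowerSeries.subst, subst_comp_subst_apply (F.pointX (1 : Fin 2)).prop.const h]
    congr 1
    funext _
    exact subst_X h 1

theorem diffSwap_subst (x y : F.Point σ) : F.diffSwap.subst ![x.val, y.val] = (y - x).val := by
  have h := F.hasSubst_points x y
  have h1 : F.diffSwap = F.toPowerSeries.subst
    ![(F.pointX (1 : Fin 2)).val, (-F.pointX (0 : Fin 2)).val] := rfl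
  rw [h1, subst_comp_subst_apply (F.hasSubst_points _ _) h, sub_val]
  congr 1
  funext s
  fin_cases s
  · exact subst_X h 1
  · change MvPowerSeries.subst _ (PowerSeries.subst _ _) = PowerSeries.subst _ _
    rw [PowerSeries.subst, subst_comp_subst_apply (F.pointX (0 : Fin 2)).prop.const h]
    congr 1
    funext _
    exact subst_X h 0

theorem constantCoeff_sub_val {x y : F.Point σ} (hx : constantCoeff x.val = 0)
    (hy : constantCoeff y.val = 0) : constantCoeff (x - y).val = 0 := by
  rw [sub_val]
  refine constantCoeff_subst_eq_zero ?_ ?_ F.zero_constantCoeff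
  · exact F.hasSubst_points x (-y)
  · intro s
    fin_cases s
    · exact hx
    · exact PowerSeries.constantCoeff_subst_eq_zero hy _ F.constantCoeff_iota

/-! ### The units and the delta distribution -/

theorem diff_subst_X_zero : F.diff.subst ![PowerSeries.X, (0 : PowerSeries R)] = PowerSeries.X := by
  have := F.diff_subst (F.pointX ()) 0
  rw [sub_zero] at this
  exact this

theorem diffSwap_subst_X_zero :
    F.diffSwap.subst ![PowerSeries.X, (0 : PowerSeries R)] = F.iota := by
  have := F.diffSwap_subst (F.pointX ()) 0
  rw [zero_sub] at this
  exact this.trans (PowerSeries.X_subst F.iota)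

theorem diffUnit_zpow_supp (m p q : ℤ) (h : ((F.diffUnit ^ m).val.coeff q).coeff p ≠ 0) :
    0 ≤ q ∧ m ≤ p + q := by
  refine Bilateral.zpow_supp (f := F.diff) rfl ?_ ?_ m p q h
  · have := coeff_subst_X_zero F.diff 0
    rw [diff_subst_X_zero] at this
    simpa using this.symm
  · rw [← coeff_subst_X_zero F.diff 1, diff_subst_X_zero, PowerSeries.coeff_one_X]
    exact isUnit_one

theorem diffSwapUnit_zpow_supp (m p q : ℤ)
    (h : ((F.diffSwapUnit ^ m).val.coeff q).coeff p ≠ 0) : 0 ≤ q ∧ m ≤ p + q := by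
  refine Bilateral.zpow_supp (f := F.diffSwap) rfl ?_ ?_ m p q h
  · have := coeff_subst_X_zero F.diffSwap 0
    rw [diffSwap_subst_X_zero] at this
    have h0 := F.constantCoeff_iota
    rw [← PowerSeries.coeff_zero_eq_constantCoeff_apply] at h0
    simpa [h0] using this.symm
  · rw [← coeff_subst_X_zero F.diffSwap 1, diffSwap_subst_X_zero, F.coeff_one_iota]
    exact isUnit_one.neg

end FormalGroup

namespace FormalGroup

open Bilateral

variable {R : Type*} [CommRing R] (F : FormalGroup R)

/-! ### Substitution into the delta distribution -/

/-- `i_{z,w} F(z, ι w)⁻¹`, with `z = z_0` and `w = z_1`. -/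
def deltaPos : Bilateral (Fin 2) R := ofIterated 0 1 (F.diffUnit⁻¹).val

/-- `i_{w,z} F(z, ι w)⁻¹`, with `z = z_0` and `w = z_1`. -/
def deltaNeg : Bilateral (Fin 2) R := ofIterated 1 0 (F.diffSwapUnit⁻¹).val

theorem forall_fin_two_eq_zero {e : Fin 2 → ℤ} : ∀ k, k ≠ 0 → k ≠ 1 → e k = 0 := by
  intro k h0 h1
  fin_cases k
  · exact absurd rfl h0
  · exact absurd rfl h1

theorem _root_.Bilateral.ofIterated_zero_one (w : LaurentSeries (LaurentSeries R))
    (z : Fin 2 → ℤ) : ofIterated 0 1 w z = (w.coeff (z 1)).coeff (z 0) :=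
  if_pos forall_fin_two_eq_zero

theorem _root_.Bilateral.ofIterated_one_zero (w : LaurentSeries (LaurentSeries R))
    (z : Fin 2 → ℤ) : ofIterated 1 0 w z = (w.coeff (z 0)).coeff (z 1) :=
  if_pos fun k h1 h0 => forall_fin_two_eq_zero k h0 h1

theorem delta_eq (p q : ℤ) : F.delta p q = F.deltaPos ![q, p] - F.deltaNeg ![q, p] := by
  rw [deltaPos, deltaNeg, ofIterated_zero_one, ofIterated_one_zero]
  rfl

theorem subst_X_zero_X_one (f : MvPowerSeries (Fin 2) R) :
    f.subst ![(X 0 : MvPowerSeries (Fin 2) R), X 1] = f := by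
  have : ![(X 0 : MvPowerSeries (Fin 2) R), X 1] = X := by
    funext s
    fin_cases s <;> rfl
  rw [this, MvPowerSeries.subst_self]
  rfl

theorem ofPowerSeries_eq_ofIterated (f : MvPowerSeries (Fin 2) R) :
    ofPowerSeries f = ofIterated 0 1 (iterated f) := by
  rw [ofIterated_iterated (by decide), subst_X_zero_X_one]

theorem isPowers_sumUnit :
    IsPowers F.toPowerSeries fun m => ofIterated 0 1 (F.sumUnit ^ m).val where
  zero := by
    rw [zpow_zero]
    exact ofIterated_one (by decide)
  succ m := by
    rw [add_comm, zpow_one_add, Units.val_mul, ofIterated_mul (by decide),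
      ofPowerSeries_eq_ofIterated]
    rfl
  supp m z hz := by
    rw [ofIterated_zero_one] at hz
    exact F.sumUnit_zpow_supp m _ _ hz

theorem ofIterated_pow {σ : Type*} [Fintype σ] {i j : σ} (hij : i ≠ j)
    {w : (LaurentSeries (LaurentSeries R))ˣ} {f : MvPowerSeries (Fin 2) R}
    (hf : w.val = iterated f) (m : ℕ) : ofIterated i j (w ^ m).val =
      ofPowerSeries ((f.subst ![(X i : MvPowerSeries σ R), X j]) ^ m) := by
  induction m with
  | zero => rw [pow_zero, pow_zero, ofPowerSeries_one]; exact ofIterated_one hij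
  | succ m ih => rw [pow_succ, Units.val_mul, ofIterated_mul hij, ih, hf, ofIterated_iterated hij,
      pow_succ, ofPowerSeries_mul]

section Expand

variable {i j k : Fin 3}

theorem sum_fin_three (hij : i ≠ j) (hki : k ≠ i) (hkj : k ≠ j) (e : Fin 3 → ℤ) :
    ∑ l, e l = e i + e j + e k := by
  rw [Fin.sum_univ_three]
  fin_cases i <;> fin_cases j <;> fin_cases k <;> simp_all <;> ring

/-- The family `z_k ^ a * w ^ b`, where `w` is a unit of `R((z_i))((z_j))`. -/
def expandKernel (i j k : Fin 3) (w : (LaurentSeries (LaurentSeries R))ˣ) (z : Fin 2 → ℤ) :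
    Bilateral (Fin 3) R :=
  fun e => ofIterated i j (w ^ z 1).val (e - Pi.single k (z 0))

/-- The result of substituting `z_k` for `z` and `w` for `w` in a series in `z` and `w`. -/
def expand (i j k : Fin 3) (w : (LaurentSeries (LaurentSeries R))ˣ) (B : Bilateral (Fin 2) R) :
    Bilateral (Fin 3) R :=
  pair (expandKernel i j k w) B

variable {w : (LaurentSeries (LaurentSeries R))ˣ}

theorem expandKernel_supp (hki : k ≠ i) (hkj : k ≠ j)
    (hw : ∀ m p q, ((w ^ m).val.coeff q).coeff p ≠ 0 → 0 ≤ q ∧ m ≤ p + q) {z : Fin 2 → ℤ}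
    {e : Fin 3 → ℤ} (h : expandKernel i j k w z e ≠ 0) :
    z 0 = e k ∧ 0 ≤ e j ∧ z 1 ≤ e i + e j := by
  rw [expandKernel, ofIterated, ofVars] at h
  split_ifs at h with h1
  · have h2 := hw _ _ _ h
    have h3 := h1 k hki hkj
    simp [hki.symm, hkj.symm] at h2 h3
    omega
  · exact absurd rfl h

/-- A nonnegative power of `w` is a power series, so it has no negative powers of `z_i` either. -/
theorem expandKernel_nonneg (hij : i ≠ j) (hki : k ≠ i) {f : MvPowerSeries (Fin 2) R}
    (hf : w.val = iterated f) {z : Fin 2 → ℤ} {e : Fin 3 → ℤ} (hz : 0 ≤ z 1)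
    (h : expandKernel i j k w z e ≠ 0) : 0 ≤ e i := by
  obtain ⟨m, hm⟩ := Int.eq_ofNat_of_zero_le hz
  rw [expandKernel, hm, zpow_natCast, ofIterated_pow hij hf] at h
  have := nonneg_of_ofPowerSeries_ne_zero h i
  simpa [hki.symm] using this

theorem isKernel_expandKernel (hij : i ≠ j) (hki : k ≠ i) (hkj : k ≠ j)
    (hw : ∀ m p q, ((w ^ m).val.coeff q).coeff p ≠ 0 → 0 ≤ q ∧ m ≤ p + q)
    {f : MvPowerSeries (Fin 2) R} (hf : w.val = iterated f) :
    IsKernel (X k) (f.subst ![(X i : MvPowerSeries (Fin 3) R), X j]) (expandKernel i j k w) where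
  degreeBounded z := ⟨z 0 + z 1, fun e he => by
    have := expandKernel_supp hki hkj hw he
    rw [sum_fin_three hij hki hkj]
    omega⟩
  fst_mul z := by
    funext e
    rw [Bilateral.X_mul, expandKernel, expandKernel, sub_sub, ← Pi.single_add]
    simp [add_comm]
  snd_mul z := by
    funext e
    have h : expandKernel i j k w z =
      fun e => ofIterated i j (w ^ z 1).val (e - Pi.single k (z 0)) := rfl
    rw [h, mul_shift, ← ofIterated_iterated hij, ← hf, ← ofIterated_mul hij, ← Units.val_mul,
      ← zpow_one_add, expandKernel]
    simp [add_comm]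

theorem expand_apply (i j k : Fin 3) (hki : k ≠ i) (hkj : k ≠ j)
    (hw : ∀ m p q, ((w ^ m).val.coeff q).coeff p ≠ 0 → 0 ≤ q ∧ m ≤ p + q)
    (B : Bilateral (Fin 2) R) (e : Fin 3 → ℤ) :
    expand i j k w B e =
      ∑ᶠ m : ℤ, ofIterated i j (w ^ m).val (e - Pi.single k (e k)) * B ![e k, m] := by
  rw [expand, pair, finsum_comp_of_support_subset_range (φ := fun m : ℤ => ![e k, m])]
  · rfl
  · intro m n h
    simpa using congrFun h 1
  · intro z hz
    have := expandKernel_supp hki hkj hw (left_ne_zero_of_smul hz)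
    refine ⟨z 1, ?_⟩
    rw [← this.1]
    funext s
    fin_cases s <;> rfl

/-- If `B` is an expansion of the inverse of `f(z, w)`, then the result of the substitution is an
inverse of `f(z_k, w)`. -/
theorem expand_inverse (hij : i ≠ j) (hki : k ≠ i) (hkj : k ≠ j)
    (hw : ∀ m p q, ((w ^ m).val.coeff q).coeff p ≠ 0 → 0 ≤ q ∧ m ≤ p + q)
    {g : MvPowerSeries (Fin 2) R} (hg : w.val = iterated g)
    (hg0 : constantCoeff (g.subst ![(X i : MvPowerSeries (Fin 3) R), X j]) = 0)
    {B : Bilateral (Fin 2) R} (hB : ∀ z, B z ≠ 0 → -1 ≤ z 0 + z 1)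
    {f : MvPowerSeries (Fin 2) R} (hf : mul (ofPowerSeries f) B = monomial R 0) :
    mul (ofPowerSeries
      (f.subst ![X k, g.subst ![(X i : MvPowerSeries (Fin 3) R), X j]])) (expand i j k w B) =
      monomial R 0 := by
  have hκ := isKernel_expandKernel hij hki hkj hw hg
  funext e
  have hPC : PairConverges (expandKernel i j k w) B := by
    intro e
    refine ((finite_box (-1 - |e k| - |e i + e j|) (|e k| + |e i + e j|)).prod
      (finite_box (-1 - |e k| - |e i + e j|) (|e k| + |e i + e j|))).subset fun p hp => ?_
    have h1 := expandKernel_supp hki hkj hw hp.1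
    have h20 := hp.2.1 0
    have h21 := hp.2.1 1
    have h3 := hB _ hp.2.2
    have h4 := le_abs_self (e k)
    have h5 := neg_abs_le (e k)
    have h6 := le_abs_self (e i + e j)
    have h7 := neg_abs_le (e i + e j)
    simp at h20 h21
    constructor <;> intro s <;> fin_cases s <;> simp <;> omega
  have h1 := pair_mul hκ (constantCoeff_X k) hg0 f hPC e
  rw [hf, pair, finsum_eq_single _ 0 fun z hz => by simp [Bilateral.monomial, hz]] at h1
  have h2 : expandKernel i j k w 0 e • (monomial R 0 : Bilateral (Fin 2) R) 0 =
      (monomial R 0 : Bilateral (Fin 3) R) e := by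
    simp only [expandKernel, Bilateral.monomial, Pi.zero_apply, Pi.single_zero, sub_zero, zpow_zero]
    rw [show ((1 : (LaurentSeries (LaurentSeries R))ˣ)).val = 1 from rfl, ofIterated_one hij]
    simp [Bilateral.monomial]
  rw [← h2, h1, mul]
  simp only [expand, pair]
  rw [finsum_smul_finsum_smul (K := fun d z => expandKernel i j k w z (e - d))]
  · rfl
  · -- the total degree of `expand` is at least `-1`
    have hfin := finite_nonneg_sum_le (σ := Fin 3) (∑ l, e l + 1)
    have hS : ∀ d : Fin 3 → ℤ, {z : Fin 2 → ℤ |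
        expandKernel i j k w z (e - d) ≠ 0 ∧ B z ≠ 0}.Finite := by
      intro d
      refine (hPC (e - d)).image Prod.fst |>.subset fun z hz => ⟨(z, z), ⟨hz.1, ?_, hz.2⟩, rfl⟩
      intro s
      simp
    refine (hfin.biUnion fun d _ => (Set.finite_singleton d).prod (hS d)).subset fun p hp => ?_
    refine Set.mem_biUnion (x := p.1) ⟨fun l => nonneg_of_ofPowerSeries_ne_zero hp.1 l, ?_⟩
      ⟨rfl, hp.2⟩
    have h3 := expandKernel_supp hki hkj hw hp.2.1
    have h4 := hB _ hp.2.2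
    rw [sum_fin_three hij hki hkj, sum_fin_three hij hki hkj]
    simp at h3
    omega

theorem exists_of_expand_ne_zero {B : Bilateral (Fin 2) R} {e : Fin 3 → ℤ}
    (h : expand i j k w B e ≠ 0) : ∃ z, expandKernel i j k w z e ≠ 0 ∧ B z ≠ 0 := by
  by_contra! hc
  refine h (finsum_eq_zero_of_forall_eq_zero fun z => ?_)
  by_cases hz : expandKernel i j k w z e = 0
  · simp [hz]
  · simp [hc z hz]

theorem mul_deltaPos : mul (ofPowerSeries F.diff) F.deltaPos = monomial R 0 := by
  rw [ofPowerSeries_eq_ofIterated, deltaPos, ← ofIterated_mul (by decide),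
    show iterated F.diff = F.diffUnit.val from rfl, Units.mul_inv]
  exact ofIterated_one (by decide)

theorem mul_deltaIn (hki : k ≠ i) (hkj : k ≠ j) (m : ℤ) (e : Fin 3 → ℤ) :
    mul (ofIterated i j (w ^ m).val) (F.deltaIn k m) e =
      ofIterated i j (w ^ m).val (e - Pi.single k (e k)) * F.delta m (e k) := by
  rw [deltaIn, mul_ofVar, finsum_eq_single _ (e k)]
  · rfl
  · intro n hn
    rw [ofIterated, ofVars, if_neg, zero_smul]
    intro h
    have := h k hki hkj
    simp at this
    omega

variable [F.IsComm]

theorem deltaPos_supp {z : Fin 2 → ℤ} (h : F.deltaPos z ≠ 0) : 0 ≤ z 1 ∧ -1 ≤ z 0 + z 1 := by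
  rw [deltaPos, ofIterated_zero_one, ← zpow_neg_one] at h
  exact F.diffUnit_zpow_supp _ _ _ h

theorem deltaNeg_supp {z : Fin 2 → ℤ} (h : F.deltaNeg z ≠ 0) : 0 ≤ z 0 ∧ -1 ≤ z 0 + z 1 := by
  rw [deltaNeg, ofIterated_one_zero, ← zpow_neg_one] at h
  have := F.diffSwapUnit_zpow_supp _ _ _ h
  omega

theorem delta_supp {p q : ℤ} (h : F.delta p q ≠ 0) : -1 ≤ p + q := by
  rw [delta_eq] at h
  by_cases h1 : F.deltaPos ![q, p] = 0
  · have h2 : F.deltaNeg ![q, p] ≠ 0 := fun h2 => h (by rw [h1, h2, sub_zero])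
    have := (F.deltaNeg_supp h2).2
    simp at this
    omega
  · have := (F.deltaPos_supp h1).2
    simp at this
    omega

theorem mul_deltaNeg : mul (ofPowerSeries F.diff) F.deltaNeg = monomial R 0 := by
  have h : F.diff = F.diffSwap.subst ![(X 1 : MvPowerSeries (Fin 2) R), X 0] :=
    (F.sub_val (F.pointX 0) (F.pointX 1)).symm.trans
      (F.diffSwap_subst (F.pointX 1) (F.pointX 0)).symm
  rw [h, ← ofIterated_iterated (by decide), deltaNeg, ← ofIterated_mul (by decide),
    show iterated F.diffSwap = F.diffSwapUnit.val from rfl, Units.mul_inv]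
  exact ofIterated_one (by decide)

theorem substConverges (hij : i ≠ j) (hki : k ≠ i) (hkj : k ≠ j)
    (hw : ∀ m p q, ((w ^ m).val.coeff q).coeff p ≠ 0 → 0 ≤ q ∧ m ≤ p + q) :
    SubstConverges i j w (F.deltaIn k) := by
  refine ⟨fun m => .of_finite fun e => ?_, fun e => ?_⟩
  · refine (Set.finite_singleton (e - Pi.single k (e k))).subset fun d hd => ?_
    obtain ⟨n, hn⟩ := mem_range_single hd.2
    obtain ⟨z, hz⟩ := mem_range_plane hij hd.1
    have h1 : d k = 0 := by rw [← hz, plane_apply_of_ne hki hkj]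
    have h2 : n = e k := by
      have := congrFun hn k
      simp [h1] at this
      exact this
    rw [Set.mem_singleton_iff, ← h2]
    exact eq_sub_of_add_eq (by rw [add_comm]; exact eq_sub_iff_add_eq.1 hn)
  · refine (Set.finite_Icc (-1 - e k) (e i + e j)).subset fun m hm => ?_
    rw [Set.mem_ofPred_eq, F.mul_deltaIn hki hkj] at hm
    have h1 := F.delta_supp (right_ne_zero_of_mul hm)
    have h2 := expandKernel_supp (z := ![e k, m]) (w := w) hki hkj hw (left_ne_zero_of_mul hm)
    simp at h2
    exact ⟨by omega, h2.2⟩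

theorem deltaSubst_eq (hki : k ≠ i) (hkj : k ≠ j)
    (hw : ∀ m p q, ((w ^ m).val.coeff q).coeff p ≠ 0 → 0 ≤ q ∧ m ≤ p + q) :
    F.deltaSubst i j k w = expand i j k w F.deltaPos - expand i j k w F.deltaNeg := by
  funext e
  rw [deltaSubst, Bilateral.subst, Pi.sub_apply, expand_apply i j k hki hkj hw,
    expand_apply i j k hki hkj hw]
  simp only [F.mul_deltaIn hki hkj, delta_eq, mul_sub]
  have hfin : ∀ B : Bilateral (Fin 2) R, (∀ z, B z ≠ 0 → -1 ≤ z 0 + z 1) →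
      Function.HasFiniteSupport fun m : ℤ =>
        ofIterated i j (w ^ m).val (e - Pi.single k (e k)) * B ![e k, m] := by
    intro B hB
    refine (Set.finite_Icc (-1 - e k) (e i + e j)).subset fun m hm => ?_
    have h1 := hB _ (right_ne_zero_of_mul hm)
    have h2 := expandKernel_supp (z := ![e k, m]) (w := w) hki hkj hw (left_ne_zero_of_mul hm)
    simp at h1 h2
    exact ⟨by omega, h2.2⟩
  exact finsum_sub_distrib (hfin _ fun z hz => (F.deltaPos_supp hz).2)
    (hfin _ fun z hz => (F.deltaNeg_supp hz).2)

end Expand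

end FormalGroup

/-! ### Series supported in a cone -/

namespace Bilateral

variable {R M : Type*} [CommRing R] [AddCommGroup M] [Module R M]

/-- The exponents of `z_i` and `z_j` and the total degree are bounded below on the support of `f`.
For fixed `i ≠ j` such series can be multiplied. -/
def ConeBounded (i j : Fin 3) (f : Bilateral (Fin 3) M) : Prop :=
  ∃ c : ℤ, ∀ e, f e ≠ 0 → c ≤ e i ∧ c ≤ e j ∧ c ≤ ∑ l, e l

variable {i j : Fin 3}

theorem finite_cone (hij : i ≠ j) (b c : ℤ) :
    {d : Fin 3 → ℤ | (b ≤ d i ∧ b ≤ d j ∧ b ≤ ∑ l, d l) ∧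
      d i ≤ c ∧ d j ≤ c ∧ ∑ l, d l ≤ c}.Finite := by
  refine (finite_box (τ := Fin 3) (b - 2 * |b| - 2 * |c|) (c + 2 * |b| + 2 * |c|)).subset ?_
  rintro d ⟨⟨h1, h2, h3⟩, h4, h5, h6⟩ l
  have hb := neg_abs_le b
  have hb' := le_abs_self b
  have hc := neg_abs_le c
  have hc' := le_abs_self c
  rw [Fin.sum_univ_three] at h3 h6
  fin_cases i <;> fin_cases j <;> fin_cases l <;> simp at * <;> omega

theorem ConeBounded.mulConverges (hij : i ≠ j) {f : Bilateral (Fin 3) R}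
    {g : Bilateral (Fin 3) M} (hf : ConeBounded i j f) (hg : ConeBounded i j g) :
    MulConverges f g := .of_finite fun e => by
  obtain ⟨c, hc⟩ := hf
  obtain ⟨b, hb⟩ := hg
  refine (finite_cone hij c (max (max (e i - b) (e j - b)) (∑ l, e l - b))).subset fun d hd => ?_
  have h1 := hb _ hd.2
  simp only [Pi.sub_apply, Finset.sum_sub_distrib] at h1
  exact ⟨hc d hd.1, by omega, by omega, by omega⟩

theorem ConeBounded.mul {f : Bilateral (Fin 3) R} {g : Bilateral (Fin 3) M}
    (hf : ConeBounded i j f) (hg : ConeBounded i j g) : ConeBounded i j (Bilateral.mul f g) := by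
  obtain ⟨c, hc⟩ := hf
  obtain ⟨b, hb⟩ := hg
  refine ⟨c + b, fun e he => ?_⟩
  obtain ⟨d, h1, h2⟩ := exists_of_mul_ne_zero he
  have h1 := hc _ h1
  have h2 := hb _ h2
  simp only [Pi.sub_apply, Finset.sum_sub_distrib] at h2
  omega

theorem ConeBounded.mul_assoc (hij : i ≠ j) {f g : Bilateral (Fin 3) R} {h : Bilateral (Fin 3) M}
    (hf : ConeBounded i j f) (hg : ConeBounded i j g) (hh : ConeBounded i j h) :
    Bilateral.mul (Bilateral.mul f g) h = Bilateral.mul f (Bilateral.mul g h) := by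
  refine mul_assoc' fun e => ?_
  obtain ⟨a, ha⟩ := hf
  obtain ⟨b, hb⟩ := hg
  obtain ⟨c, hc⟩ := hh
  have hfin := finite_cone hij (min a b) (max (max (e i) (e j)) (∑ l, e l) - c - min a b)
  refine (hfin.prod hfin).subset fun p hp => ?_
  have h1 := ha _ hp.1
  have h2 := hb _ hp.2.1
  have h3 := hc _ hp.2.2
  simp only [Pi.sub_apply, Finset.sum_sub_distrib] at h3
  exact ⟨⟨by omega, by omega, by omega, by omega⟩, by omega, by omega, by omega, by omega⟩

theorem coneBounded_ofPowerSeries (f : MvPowerSeries (Fin 3) R) :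
    ConeBounded i j (ofPowerSeries f) :=
  ⟨0, fun _ he => ⟨nonneg_of_ofPowerSeries_ne_zero he i, nonneg_of_ofPowerSeries_ne_zero he j,
    Finset.sum_nonneg fun l _ => nonneg_of_ofPowerSeries_ne_zero he l⟩⟩

/-- Inverses are unique among the series that are bounded in the same cone. -/
theorem ConeBounded.inverse_unique (hij : i ≠ j) {T f g : Bilateral (Fin 3) R}
    (hT : ConeBounded i j T) (hf : ConeBounded i j f) (hg : ConeBounded i j g)
    (h1 : Bilateral.mul T f = monomial R 0) (h2 : Bilateral.mul T g = monomial R 0) : f = g := by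
  have h := hf.mul_assoc hij hT hg
  rw [mul_comm' f T, h1, h2, one_mul', mul_comm', one_mul'] at h
  exact h.symm

end Bilateral

/-! ### The three inverses of `F(F(z_0, z_2), ι z_1)` -/

namespace FormalGroup

open Bilateral

variable {R : Type*} [CommRing R] (F : FormalGroup R) [F.IsComm] {i j k : Fin 3}

/-- `F(F(z_0, z_2), ι z_1)`, that is, `z_0 + z_2 - z_1` in the group of points of `F`. -/
def triple : MvPowerSeries (Fin 3) R := (F.pointX (0 : Fin 3) + F.pointX 2 - F.pointX 1).val

theorem diff_subst_diff :
    F.diff.subst ![X 0, F.diff.subst ![(X 1 : MvPowerSeries (Fin 3) R), X 2]] = F.triple := by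
  have h1 := F.diff_subst (F.pointX (1 : Fin 3)) (F.pointX 2)
  have h2 := F.diff_subst (F.pointX (0 : Fin 3)) (F.pointX 1 - F.pointX 2)
  rw [← h1] at h2
  refine h2.trans (congrArg Subtype.val ?_)
  abel

theorem diff_subst_diffSwap :
    F.diff.subst ![X 0, F.diffSwap.subst ![(X 2 : MvPowerSeries (Fin 3) R), X 1]] = F.triple := by
  have h1 := F.diffSwap_subst (F.pointX (2 : Fin 3)) (F.pointX 1)
  have h2 := F.diff_subst (F.pointX (0 : Fin 3)) (F.pointX 1 - F.pointX 2)
  rw [← h1] at h2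
  refine h2.trans (congrArg Subtype.val ?_)
  abel

theorem diff_subst_diff' :
    F.diff.subst ![X 2, F.diff.subst ![(X 1 : MvPowerSeries (Fin 3) R), X 0]] = F.triple := by
  have h1 := F.diff_subst (F.pointX (1 : Fin 3)) (F.pointX 0)
  have h2 := F.diff_subst (F.pointX (2 : Fin 3)) (F.pointX 1 - F.pointX 0)
  rw [← h1] at h2
  refine h2.trans (congrArg Subtype.val ?_)
  abel

theorem constantCoeff_diff_subst (i j : Fin 3) :
    constantCoeff (F.diff.subst ![(X i : MvPowerSeries (Fin 3) R), X j]) = 0 := by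
  have := F.diff_subst (F.pointX i) (F.pointX j)
  exact (congrArg _ this).trans (F.constantCoeff_sub_val (constantCoeff_X i) (constantCoeff_X j))

theorem constantCoeff_diffSwap_subst (i j : Fin 3) :
    constantCoeff (F.diffSwap.subst ![(X i : MvPowerSeries (Fin 3) R), X j]) = 0 := by
  have := F.diffSwap_subst (F.pointX i) (F.pointX j)
  exact (congrArg _ this).trans (F.constantCoeff_sub_val (constantCoeff_X j) (constantCoeff_X i))

variable {w : (LaurentSeries (LaurentSeries R))ˣ}

theorem expand_deltaPos_supp (hij : i ≠ j) (hki : k ≠ i) (hkj : k ≠ j)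
    (hw : ∀ m p q, ((w ^ m).val.coeff q).coeff p ≠ 0 → 0 ≤ q ∧ m ≤ p + q)
    {g : MvPowerSeries (Fin 2) R} (hg : w.val = iterated g) {e : Fin 3 → ℤ}
    (h : expand i j k w F.deltaPos e ≠ 0) : -1 ≤ e i ∧ -1 ≤ e j ∧ -1 ≤ ∑ l, e l := by
  obtain ⟨z, h1, h2⟩ := exists_of_expand_ne_zero h
  have h3 := expandKernel_supp hki hkj hw h1
  have h4 := F.deltaPos_supp h2
  have h5 := expandKernel_nonneg hij hki hg h4.1 h1
  rw [sum_fin_three hij hki hkj]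
  omega

theorem expand_deltaNeg_supp (hij : i ≠ j) (hki : k ≠ i) (hkj : k ≠ j)
    (hw : ∀ m p q, ((w ^ m).val.coeff q).coeff p ≠ 0 → 0 ≤ q ∧ m ≤ p + q) {e : Fin 3 → ℤ}
    (h : expand i j k w F.deltaNeg e ≠ 0) : -1 ≤ e k ∧ -1 ≤ e j ∧ -1 ≤ ∑ l, e l := by
  obtain ⟨z, h1, h2⟩ := exists_of_expand_ne_zero h
  have h3 := expandKernel_supp hki hkj hw h1
  have h4 := F.deltaNeg_supp h2
  rw [sum_fin_three hij hki hkj]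
  omega

theorem mul_expand_deltaPos (hij : i ≠ j) (hki : k ≠ i) (hkj : k ≠ j)
    (hw : ∀ m p q, ((w ^ m).val.coeff q).coeff p ≠ 0 → 0 ≤ q ∧ m ≤ p + q)
    {g : MvPowerSeries (Fin 2) R} (hg : w.val = iterated g)
    (hg0 : constantCoeff (g.subst ![(X i : MvPowerSeries (Fin 3) R), X j]) = 0)
    (h : F.diff.subst ![X k, g.subst ![(X i : MvPowerSeries (Fin 3) R), X j]] = F.triple) :
    mul (ofPowerSeries F.triple) (expand i j k w F.deltaPos) = monomial R 0 := by
  rw [← h]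
  exact expand_inverse hij hki hkj hw hg hg0 (fun z hz => (F.deltaPos_supp hz).2) F.mul_deltaPos

theorem mul_expand_deltaNeg (hij : i ≠ j) (hki : k ≠ i) (hkj : k ≠ j)
    (hw : ∀ m p q, ((w ^ m).val.coeff q).coeff p ≠ 0 → 0 ≤ q ∧ m ≤ p + q)
    {g : MvPowerSeries (Fin 2) R} (hg : w.val = iterated g)
    (hg0 : constantCoeff (g.subst ![(X i : MvPowerSeries (Fin 3) R), X j]) = 0)
    (h : F.diff.subst ![X k, g.subst ![(X i : MvPowerSeries (Fin 3) R), X j]] = F.triple) :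
    mul (ofPowerSeries F.triple) (expand i j k w F.deltaNeg) = monomial R 0 := by
  rw [← h]
  exact expand_inverse hij hki hkj hw hg hg0 (fun z hz => (F.deltaNeg_supp hz).2) F.mul_deltaNeg

/-- The expansion of the inverse of `F(F(z_0, z_2), ι z_1)` in nonnegative powers of `z_1` and
`z_2`. -/
def inv₀ : Bilateral (Fin 3) R := expand 1 2 0 F.diffUnit F.deltaPos

/-- The expansion of the inverse of `F(F(z_0, z_2), ι z_1)` in nonnegative powers of `z_0` and
`z_2`. -/
def inv₁ : Bilateral (Fin 3) R := expand 1 2 0 F.diffUnit F.deltaNeg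

/-- The expansion of the inverse of `F(F(z_0, z_2), ι z_1)` in nonnegative powers of `z_0` and
`z_1`. -/
def inv₂ : Bilateral (Fin 3) R := expand 2 1 0 F.diffSwapUnit F.deltaNeg

theorem inv₀_supp {e : Fin 3 → ℤ} (h : F.inv₀ e ≠ 0) : -1 ≤ e 1 ∧ -1 ≤ e 2 ∧ -1 ≤ ∑ l, e l :=
  F.expand_deltaPos_supp (by decide) (by decide) (by decide) F.diffUnit_zpow_supp rfl h

theorem inv₁_supp {e : Fin 3 → ℤ} (h : F.inv₁ e ≠ 0) : -1 ≤ e 0 ∧ -1 ≤ e 2 ∧ -1 ≤ ∑ l, e l :=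
  F.expand_deltaNeg_supp (by decide) (by decide) (by decide) F.diffUnit_zpow_supp h

theorem inv₂_supp {e : Fin 3 → ℤ} (h : F.inv₂ e ≠ 0) : -1 ≤ e 0 ∧ -1 ≤ e 1 ∧ -1 ≤ ∑ l, e l :=
  F.expand_deltaNeg_supp (by decide) (by decide) (by decide) F.diffSwapUnit_zpow_supp h

theorem triple_mul_inv₀ : mul (ofPowerSeries F.triple) F.inv₀ = monomial R 0 :=
  F.mul_expand_deltaPos (by decide) (by decide) (by decide) F.diffUnit_zpow_supp rfl
    (F.constantCoeff_diff_subst 1 2) F.diff_subst_diff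

theorem triple_mul_inv₁ : mul (ofPowerSeries F.triple) F.inv₁ = monomial R 0 :=
  F.mul_expand_deltaNeg (by decide) (by decide) (by decide) F.diffUnit_zpow_supp rfl
    (F.constantCoeff_diff_subst 1 2) F.diff_subst_diff

theorem triple_mul_inv₂ : mul (ofPowerSeries F.triple) F.inv₂ = monomial R 0 :=
  F.mul_expand_deltaNeg (by decide) (by decide) (by decide) F.diffSwapUnit_zpow_supp rfl
    (F.constantCoeff_diffSwap_subst 2 1) F.diff_subst_diffSwap

theorem deltaExp_one_two_zero : F.deltaExp (1 : Fin 3) 2 0 = F.inv₀ - F.inv₁ :=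
  F.deltaSubst_eq (by decide) (by decide) F.diffUnit_zpow_supp

/-- The substitutions of `i_{z_1,z_2} F(z_1, ι z_2)` and `i_{z_2,z_1} F(z_1, ι z_2)` in
`i_{z,w} F(z, ι w)⁻¹` agree, since both are inverses of `F(F(z_0, z_2), ι z_1)` in the same cone. -/
theorem deltaExpSwap_one_two_zero : F.deltaExpSwap (1 : Fin 3) 2 0 = F.inv₀ - F.inv₂ := by
  refine (F.deltaSubst_eq (by decide) (by decide) F.diffSwapUnit_zpow_supp).trans ?_
  congr 1
  refine ConeBounded.inverse_unique (i := 1) (j := 2) (by decide)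
    (coneBounded_ofPowerSeries F.triple) ⟨-1, fun e he => ?_⟩ ⟨-1, fun e => F.inv₀_supp⟩
    (F.mul_expand_deltaPos (by decide) (by decide) (by decide) F.diffSwapUnit_zpow_supp rfl
      (F.constantCoeff_diffSwap_subst 2 1) F.diff_subst_diffSwap) F.triple_mul_inv₀
  have := F.expand_deltaPos_supp (by decide) (by decide) (by decide) F.diffSwapUnit_zpow_supp rfl he
  exact ⟨this.2.1, this.1, this.2.2⟩

theorem deltaExp_one_zero_two : F.deltaExp (1 : Fin 3) 0 2 = F.inv₂ - F.inv₁ := by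
  refine (F.deltaSubst_eq (by decide) (by decide) F.diffUnit_zpow_supp).trans ?_
  congr 1
  · refine ConeBounded.inverse_unique (i := 0) (j := 1) (by decide)
      (coneBounded_ofPowerSeries F.triple) ⟨-1, fun e he => ?_⟩ ⟨-1, fun e => F.inv₂_supp⟩
      (F.mul_expand_deltaPos (by decide) (by decide) (by decide) F.diffUnit_zpow_supp rfl
        (F.constantCoeff_diff_subst 1 0) F.diff_subst_diff') F.triple_mul_inv₂
    have := F.expand_deltaPos_supp (by decide) (by decide) (by decide) F.diffUnit_zpow_supp rfl he
    exact ⟨this.2.1, this.1, this.2.2⟩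
  · refine ConeBounded.inverse_unique (i := 0) (j := 2) (by decide)
      (coneBounded_ofPowerSeries F.triple) ⟨-1, fun e he => ?_⟩ ⟨-1, fun e => F.inv₁_supp⟩
      (F.mul_expand_deltaNeg (by decide) (by decide) (by decide) F.diffUnit_zpow_supp rfl
        (F.constantCoeff_diff_subst 1 0) F.diff_subst_diff') F.triple_mul_inv₁
    have := F.expand_deltaNeg_supp (by decide) (by decide) (by decide) F.diffUnit_zpow_supp he
    exact ⟨this.2.1, this.1, this.2.2⟩

/-- The properties of a difference `E` of two of the inverses of `F(F(z_0, z_2), ι z_1)`: it is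
annihilated by `F(F(z_0, z_2), ι z_1)`, and the exponent of the variable `z_j` in which both
inverses are expanded in nonnegative powers is bounded below on its support, as is the total
degree. -/
structure IsDelta (j : Fin 3) (E : Bilateral (Fin 3) R) : Prop where
  mul_eq_zero : mul (ofPowerSeries F.triple) E = 0
  supp : ∃ c : ℤ, ∀ e, E e ≠ 0 → c ≤ e j ∧ c ≤ ∑ l, e l

variable {F} in
theorem IsDelta.sub {A B : Bilateral (Fin 3) R}
    (hA : ∀ e, A e ≠ 0 → -1 ≤ e j ∧ -1 ≤ ∑ l, e l) (hB : ∀ e, B e ≠ 0 → -1 ≤ e j ∧ -1 ≤ ∑ l, e l)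
    (h : mul (ofPowerSeries F.triple) A = mul (ofPowerSeries F.triple) B) :
    F.IsDelta j (A - B) where
  mul_eq_zero := by
    rw [mul_sub', h, sub_self]
    · exact DegreeBounded.mulConverges ⟨-1, fun e he => (hA e he).2⟩ _
    · exact DegreeBounded.mulConverges ⟨-1, fun e he => (hB e he).2⟩ _
  supp := by
    refine ⟨-1, fun e he => ?_⟩
    by_cases h0 : A e = 0
    · exact hB e fun h1 => he (by rw [Pi.sub_apply, h0, h1, sub_zero])
    · exact hA e h0

theorem isDelta_deltaExp_one_two_zero : F.IsDelta 2 (F.deltaExp (1 : Fin 3) 2 0) := by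
  rw [deltaExp_one_two_zero]
  exact .sub (fun _ h => (F.inv₀_supp h).2) (fun _ h => (F.inv₁_supp h).2)
    (F.triple_mul_inv₀.trans F.triple_mul_inv₁.symm)

theorem isDelta_deltaExpSwap_one_two_zero : F.IsDelta 1 (F.deltaExpSwap (1 : Fin 3) 2 0) := by
  rw [deltaExpSwap_one_two_zero]
  exact .sub (fun _ h => ⟨(F.inv₀_supp h).1, (F.inv₀_supp h).2.2⟩) (fun _ h => (F.inv₂_supp h).2)
    (F.triple_mul_inv₀.trans F.triple_mul_inv₂.symm)

theorem isDelta_deltaExp_one_zero_two : F.IsDelta 0 (F.deltaExp (1 : Fin 3) 0 2) := by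
  rw [deltaExp_one_zero_two]
  exact .sub (fun _ h => ⟨(F.inv₂_supp h).1, (F.inv₂_supp h).2.2⟩)
    (fun _ h => ⟨(F.inv₁_supp h).1, (F.inv₁_supp h).2.2⟩)
    (F.triple_mul_inv₂.trans F.triple_mul_inv₁.symm)

end FormalGroup

/-! ### Laurent series in one of the variables -/

namespace Bilateral

section Line

variable {σ R M : Type*} [Fintype σ] [CommRing R] [AddCommGroup M] [Module R M]

/-- The total degree is bounded below on the support of `f`, and each total degree occurs only
finitely often. -/
def DegreeProper (f : Bilateral σ R) : Prop :=
  DegreeBounded f ∧ ∀ c, {d | f d ≠ 0 ∧ ∑ l, d l ≤ c}.Finite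

theorem degreeProper_ofPowerSeries (f : MvPowerSeries σ R) : DegreeProper (ofPowerSeries f) :=
  ⟨⟨0, fun _ he => Finset.sum_nonneg fun l _ => nonneg_of_ofPowerSeries_ne_zero he l⟩,
    fun c => (finite_nonneg_sum_le c).subset fun _ hd =>
      ⟨fun l => nonneg_of_ofPowerSeries_ne_zero hd.1 l, hd.2⟩⟩

theorem DegreeProper.mul_assoc {f g : Bilateral σ R} {h : Bilateral σ M} (hf : DegreeProper f)
    (hg : DegreeProper g) (hh : DegreeBounded h) :
    Bilateral.mul (Bilateral.mul f g) h = Bilateral.mul f (Bilateral.mul g h) := by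
  refine mul_assoc' fun e => ?_
  obtain ⟨⟨a, ha⟩, hf⟩ := hf
  obtain ⟨⟨b, hb⟩, hg⟩ := hg
  obtain ⟨c, hc⟩ := hh
  refine ((hf (∑ l, e l - b - c)).prod (hg (∑ l, e l - a - c))).subset fun p hp => ?_
  have h1 := ha _ hp.1
  have h2 := hb _ hp.2.1
  have h3 := hc _ hp.2.2
  simp only [Pi.sub_apply, Finset.sum_sub_distrib] at h3
  exact ⟨⟨hp.1, by omega⟩, hp.2.1, by omega⟩

theorem DegreeProper.mul_left_comm {f g : Bilateral σ R} {h : Bilateral σ M} (hf : DegreeProper f)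
    (hg : DegreeProper g) (hh : DegreeBounded h) :
    Bilateral.mul f (Bilateral.mul g h) = Bilateral.mul g (Bilateral.mul f h) := by
  rw [← hf.mul_assoc hg hh, mul_comm' f g, hg.mul_assoc hf hh]

variable [DecidableEq σ]

theorem degreeProper_ofVar (x : σ) {g : ℤ → R} {c : ℤ} (hg : ∀ n, g n ≠ 0 → c ≤ n) :
    DegreeProper (ofVar x g) := by
  refine ⟨⟨c, fun e he => ?_⟩, fun b => ?_⟩
  · obtain ⟨n, rfl⟩ := mem_range_single he
    rw [ofVar_single] at he
    simpa using hg n he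
  · refine ((Set.finite_Icc c b).image fun n => (Pi.single x n : σ → ℤ)).subset fun d hd => ?_
    obtain ⟨n, rfl⟩ := mem_range_single hd.1
    have h1 := hd.1
    have h2 := hd.2
    rw [ofVar_single] at h1
    simp only [Finset.sum_pi_single', Finset.mem_univ, if_true] at h2
    exact ⟨n, ⟨hg n h1, h2⟩, rfl⟩

theorem ofVar_coeff_mul (x : σ) (w w' : LaurentSeries R) :
    ofVar x (w * w').coeff = mul (ofVar x w.coeff) (ofVar x w'.coeff) := by
  funext e
  rw [ofVar_mul, ofVar]
  split_ifs with h
  · rw [HahnSeries.coeff_mul_eq_finsum]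
    refine finsum_congr fun n => ?_
    rw [ofVar, if_pos fun k hk => by simp [hk, h k hk]]
    simp
  · rw [finsum_eq_zero_of_forall_eq_zero]
    intro n
    rw [ofVar, if_neg, smul_zero]
    intro h'
    refine h fun k hk => ?_
    simpa [hk] using h' k hk

theorem ofVar_coeff_one (x : σ) : ofVar x (1 : LaurentSeries R).coeff = monomial R 0 := by
  funext e
  rw [ofVar, Bilateral.monomial, HahnSeries.coeff_one]
  by_cases h : ∀ k, k ≠ x → e k = 0
  · rw [if_pos h]
    congr 1
    rw [eq_iff_iff]
    refine ⟨fun h' => funext fun k => ?_, fun h' => by simp [h']⟩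
    by_cases hk : k = x
    · rw [hk, h']; rfl
    · exact h k hk
  · rw [if_neg h, if_neg]
    rintro rfl
    exact h fun _ _ => rfl

theorem ofVar_coeff_ofPowerSeries (x : σ) (f : PowerSeries R) :
    ofVar x (HahnSeries.ofPowerSeries ℤ R f).coeff =
      ofPowerSeries (f.subst (X x : MvPowerSeries σ R)) := by
  funext e
  by_cases he : ∀ i, 0 ≤ e i
  · obtain ⟨n, rfl⟩ := exists_natCast he
    rw [ofPowerSeries_natCast, PowerSeries.coeff_subst (PowerSeries.HasSubst.X x),
      finsum_eq_single _ (n x)]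
    · rw [ofVar, MvPowerSeries.coeff_X_pow, PowerSeries.coeff_coe]
      by_cases h : n = Finsupp.single x (n x)
      · rw [if_pos h, if_pos, if_neg (by omega)]
        · simp
        · intro k hk
          rw [h]
          simp [hk.symm]
      · rw [if_neg h, if_neg, smul_zero]
        intro h'
        refine h (Finsupp.ext fun k => ?_)
        by_cases hk : k = x
        · simp [hk]
        · simpa [Ne.symm hk] using h' k hk
    · intro d hd
      rw [MvPowerSeries.coeff_X_pow, if_neg, smul_zero]
      intro h
      rw [h] at hd
      simp at hd
  · have h1 : ofPowerSeries (f.subst (X x : MvPowerSeries σ R)) e = 0 := by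
      by_contra h
      exact he fun i => nonneg_of_ofPowerSeries_ne_zero h i
    rw [h1]
    by_contra h
    refine he fun i => ?_
    obtain ⟨n, rfl⟩ := mem_range_single h
    rw [ofVar_single] at h
    have := LaurentSeries.orderGE_ofPowerSeries f n h
    by_cases hi : i = x
    · subst hi; simpa using this
    · simp [hi]

end Line

end Bilateral

/-! ### Delta series as kernels -/

namespace FormalGroup

open Bilateral

variable {R M : Type*} [CommRing R] [AddCommGroup M] [Module R M]

/-- The family `u ^ a * z_j ^ b * E`, where `u = w(z_x)` for a unit `w` of `R((z))`. -/
def lineKernel (x j : Fin 3) (w : (LaurentSeries R)ˣ) (E : Bilateral (Fin 3) R) (z : Fin 2 → ℤ) :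
    Bilateral (Fin 3) R :=
  fun e => mul (ofVar x (w ^ z 0).val.coeff) E (e - Pi.single j (z 1))

variable {x j : Fin 3} {w : (LaurentSeries R)ˣ} {E : Bilateral (Fin 3) R}

theorem exists_of_lineKernel_ne_zero {z : Fin 2 → ℤ} {e : Fin 3 → ℤ}
    (h : lineKernel x j w E z e ≠ 0) :
    ∃ n, (w ^ z 0).val.coeff n ≠ 0 ∧ E (e - Pi.single j (z 1) - Pi.single x n) ≠ 0 := by
  rw [lineKernel, ofVar_mul] at h
  by_contra! hc
  refine h (finsum_eq_zero_of_forall_eq_zero fun n => ?_)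
  by_cases hn : (w ^ z 0).val.coeff n = 0
  · simp [hn]
  · simp [hc n hn]

theorem lineKernel_snd (n : ℤ) (e : Fin 3 → ℤ) :
    lineKernel x j w E (Pi.single 1 n) e = E (e - Pi.single j n) := by
  have : (w ^ (Pi.single 1 n : Fin 2 → ℤ) 0).val = 1 := by simp
  rw [lineKernel, this, ofVar_coeff_one, one_mul']
  simp

theorem degreeBounded_lineKernel (hw : ∀ m p, (w ^ m).val.coeff p ≠ 0 → m ≤ p)
    (hE : DegreeBounded E) (z : Fin 2 → ℤ) :
    DegreeBounded (lineKernel x j w E z) := by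
  obtain ⟨c, hc⟩ := hE
  refine ⟨c + z 0 + z 1, fun e he => ?_⟩
  obtain ⟨n, h1, h2⟩ := exists_of_lineKernel_ne_zero he
  have h1 := hw _ _ h1
  have h2 := hc _ h2
  simp at h2
  omega

theorem isKernel_lineKernel (hw : ∀ m p, (w ^ m).val.coeff p ≠ 0 → m ≤ p)
    (hE : DegreeBounded E) {f : PowerSeries R}
    (hf : w.val = HahnSeries.ofPowerSeries ℤ R f) :
    IsKernel (f.subst (X x : MvPowerSeries (Fin 3) R)) (X j) (lineKernel x j w E) where
  degreeBounded z := degreeBounded_lineKernel hw hE z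
  fst_mul z := by
    funext e
    have h : lineKernel x j w E z =
      fun e => mul (ofVar x (w ^ z 0).val.coeff) E (e - Pi.single j (z 1)) := rfl
    rw [h, mul_shift, ← (degreeProper_ofPowerSeries _).mul_assoc
      (degreeProper_ofVar x (hw (z 0))) hE, ← ofVar_coeff_ofPowerSeries, ← hf,
      ← ofVar_coeff_mul, ← Units.val_mul, ← zpow_one_add, lineKernel]
    simp [add_comm]
  snd_mul z := by
    funext e
    rw [Bilateral.X_mul, lineKernel, lineKernel, sub_sub, ← Pi.single_add]
    simp [add_comm]

theorem exists_lineKernel_bound (hxj : x ≠ j) (hw : ∀ m p, (w ^ m).val.coeff p ≠ 0 → m ≤ p)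
    (s : Fin 2) (hE : ∃ c : ℤ, ∀ e, E e ≠ 0 → c ≤ e (![x, j] s) ∧ c ≤ ∑ l, e l)
    (e : Fin 3 → ℤ) : ∃ c, ∀ (z : Fin 2 → ℤ) (n : ℤ), (w ^ z 0).val.coeff n ≠ 0 →
      E (e - Pi.single j (z 1) - Pi.single x n) ≠ 0 → z s ≤ c ∧ z 0 ≤ n ∧ n + z 1 ≤ c := by
  obtain ⟨c, hc⟩ := hE
  refine ⟨max (max (e x - c) (e j - c)) (∑ l, e l - c), fun z n h1 h2 => ?_⟩
  have h1 := hw _ _ h1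
  have h2 := hc _ h2
  fin_cases s <;> simp [hxj, hxj.symm] at h2 ⊢ <;> omega

theorem upperBounded_lineKernel (hxj : x ≠ j) (hw : ∀ m p, (w ^ m).val.coeff p ≠ 0 → m ≤ p)
    (s : Fin 2) (hE : ∃ c : ℤ, ∀ e, E e ≠ 0 → c ≤ e (![x, j] s) ∧ c ≤ ∑ l, e l) :
    UpperBounded s (lineKernel x j w E) := by
  intro e
  obtain ⟨c, hc⟩ := exists_lineKernel_bound hxj hw s hE e
  refine ⟨c, fun z hz => ?_⟩
  obtain ⟨n, h1, h2⟩ := exists_of_lineKernel_ne_zero hz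
  have := hc z n h1 h2
  omega

/-- The substitution `u ↦ w(x)` in the series `∑ X(m, n) u ^ m y ^ n`, where `w` is a unit of
`R((x))`. -/
def substLaurent (w : (LaurentSeries R)ˣ) (X : Bilateral (Fin 2) M) (p q : ℤ) : M :=
  ∑ᶠ m : ℤ, (w ^ m).val.coeff p • X ![m, q]

open Classical in
/-- The substitution along the kernel of a series `E` is a product with `E`. -/
theorem pair_lineKernel (hxj : x ≠ j) (hw : ∀ m p, (w ^ m).val.coeff p ≠ 0 → m ≤ p)
    (s : Fin 2) (hE : ∃ c : ℤ, ∀ e, E e ≠ 0 → c ≤ e (![x, j] s) ∧ c ≤ ∑ l, e l)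
    {X : Bilateral (Fin 2) M} (hX : LexBounded s X) :
    pair (lineKernel x j w E) X = mul E (ofVars x j (substLaurent w X)) := by
  funext e
  let K : (Fin 2 → ℤ) → (Fin 2 → ℤ) → R := fun y z =>
    if z 1 = y 1 then (w ^ z 0).val.coeff (y 0) else 0
  have hK : ∀ y : Fin 2 → ℤ, substLaurent w X (y 0) (y 1) = ∑ᶠ z, K y z • X z := by
    intro y
    rw [substLaurent, finsum_comp_of_support_subset_range (φ := fun m : ℤ => ![m, y 1])]
    · simp [K]
    · intro m n h
      simpa using congrFun h 0
    · intro z hz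
      have h1 : z 1 = y 1 := by
        by_contra h
        exact left_ne_zero_of_smul hz (if_neg h)
      refine ⟨z 0, ?_⟩
      funext t
      fin_cases t
      · rfl
      · exact h1.symm
  have hplane : ∀ (z : Fin 2 → ℤ) (n : ℤ),
      e - plane x j ![n, z 1] = e - Pi.single j (z 1) - Pi.single x n := by
    intro z n
    simp [plane, sub_sub, add_comm]
  rw [mul_ofVars hxj]
  simp only [hK]
  rw [finsum_smul_finsum_smul, pair]
  · refine finsum_congr fun z => ?_
    congr 1
    rw [lineKernel, ofVar_mul, finsum_comp_of_support_subset_range (φ := fun n : ℤ => ![n, z 1])]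
    · refine finsum_congr fun n => ?_
      rw [hplane]
      simp [K, mul_comm]
    · intro m n h
      simpa using congrFun h 0
    · intro y hy
      have h1 : z 1 = y 1 := by
        by_contra h
        exact right_ne_zero_of_mul hy (if_neg h)
      refine ⟨y 0, ?_⟩
      funext t
      fin_cases t
      · rfl
      · exact h1
  · obtain ⟨c, hc⟩ := exists_lineKernel_bound hxj hw s hE e
    obtain ⟨b, b', hb⟩ := hX.exists_box c
    have hfin := (finite_box (τ := Fin 2) b b').prod (Set.finite_Icc b (c - b))
    refine (hfin.image fun p => (![p.2, p.1 1], p.1)).subset fun p hp => ?_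
    have h1 : p.2 1 = p.1 1 := by
      by_contra h
      exact hp.2.1 (if_neg h)
    have h2 : p.1 = ![p.1 0, p.2 1] := by
      funext t
      fin_cases t
      · rfl
      · exact h1.symm
    have h3 := hp.1
    have h4 := hp.2.1
    rw [h2, hplane] at h3
    simp only [K, if_pos h1] at h4
    have h5 := hc _ _ h4 h3
    have h6 := hb p.2 p.2 h5.1 (by omega) (fun _ => le_rfl) hp.2.2
    have h60 := h6 0
    have h61 := h6 1
    exact ⟨(p.2, p.1 0), ⟨fun i => (h6 i).1, by constructor <;> omega⟩, Prod.ext h2.symm rfl⟩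

/-- The variable `z` as a unit of `R((z))`. -/
def varUnit (R : Type*) [CommRing R] : (LaurentSeries R)ˣ where
  val := HahnSeries.single 1 1
  inv := HahnSeries.single (-1) 1
  val_inv := by simp [HahnSeries.single_mul_single]
  inv_val := by simp [HahnSeries.single_mul_single]

theorem varUnit_zpow (m : ℤ) : (varUnit R ^ m).val = HahnSeries.single m 1 := by
  induction m using Int.induction_on with
  | zero => simp
  | succ n ih =>
    rw [zpow_add_one, Units.val_mul, ih]
    exact (HahnSeries.single_mul_single).trans (by simp)
  | pred n ih =>
    rw [zpow_sub_one, Units.val_mul, ih]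
    exact (HahnSeries.single_mul_single).trans (by simp [sub_eq_add_neg])

theorem varUnit_zpow_supp (m p : ℤ) (h : (varUnit R ^ m).val.coeff p ≠ 0) : m ≤ p := by
  rw [varUnit_zpow] at h
  exact LaurentSeries.orderGE_single m 1 p h

theorem substLaurent_varUnit (X : Bilateral (Fin 2) M) (p q : ℤ) :
    substLaurent (varUnit R) X p q = X ![p, q] := by
  rw [substLaurent, finsum_eq_single _ p]
  · rw [varUnit_zpow, HahnSeries.coeff_single_same, one_smul]
  · intro m hm
    rw [varUnit_zpow, HahnSeries.coeff_single_of_ne hm.symm, zero_smul]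

theorem _root_.Bilateral.LexBounded.mul {s : Fin 2} {f : Bilateral (Fin 2) M}
    (hf : LexBounded s f) (c : MvPowerSeries (Fin 2) R) :
    LexBounded s (Bilateral.mul (ofPowerSeries c) f) := by
  obtain ⟨⟨a, ha⟩, hb⟩ := hf
  refine ⟨⟨a, fun z hz => ?_⟩, fun C => ?_⟩
  · obtain ⟨d, h1, h2⟩ := exists_of_mul_ne_zero hz
    have h1 := nonneg_of_ofPowerSeries_ne_zero h1 s
    have h2 := ha _ h2
    simp only [Pi.sub_apply] at h2
    omega
  · obtain ⟨b, hb⟩ := hb C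
    refine ⟨b, fun z hz hC i => ?_⟩
    obtain ⟨d, h1, h2⟩ := exists_of_mul_ne_zero hz
    have h1s := nonneg_of_ofPowerSeries_ne_zero h1 s
    have h1 := nonneg_of_ofPowerSeries_ne_zero h1 i
    have h2 := hb _ h2 (by simp only [Pi.sub_apply]; omega) i
    simp only [Pi.sub_apply] at h2
    omega

variable {F : FormalGroup R} [F.IsComm] {i k : Fin 3} {f : PowerSeries R}

/-- Since `F(F(z_0, z_2), ι z_1)` annihilates a delta series, `F(u, z_j)` acts on it as `z_i`. -/
theorem sum_mul_lineKernel (hw : ∀ m p, (w ^ m).val.coeff p ≠ 0 → m ≤ p) (hE : F.IsDelta k E)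
    (hdvd : F.triple ∣ F.toPowerSeries.subst ![f.subst (X x : MvPowerSeries (Fin 3) R), X j] - X i)
    (z : Fin 2 → ℤ) (e : Fin 3 → ℤ) :
    mul (ofPowerSeries (F.toPowerSeries.subst
      ![f.subst (X x : MvPowerSeries (Fin 3) R), X j])) (lineKernel x j w E z) e =
      lineKernel x j w E z (e - Pi.single i 1) := by
  obtain ⟨c, hc⟩ := hE.supp
  have hE1 : DegreeBounded E := ⟨c, fun e he => (hc e he).2⟩
  have hD := degreeBounded_lineKernel (x := x) (j := j) hw hE1 z
  obtain ⟨q, hq⟩ := hdvd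
  have h1 : mul (ofPowerSeries F.triple) (lineKernel x j w E z) = 0 := by
    funext e
    have h : lineKernel x j w E z =
      fun e => mul (ofVar x (w ^ z 0).val.coeff) E (e - Pi.single j (z 1)) := rfl
    rw [h, mul_shift, (degreeProper_ofPowerSeries _).mul_left_comm
      (degreeProper_ofVar x (hw (z 0))) hE1, hE.mul_eq_zero]
    simp [mul]
  have h2 : mul (ofPowerSeries (F.triple * q)) (lineKernel x j w E z) = 0 := by
    rw [mul_comm, ofPowerSeries_mul_mul hD, h1]
    funext e
    simp [mul]
  rw [← hq, ofPowerSeries_sub, sub_mul' (hD.mulConverges _) (hD.mulConverges _), sub_eq_zero] at h2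
  rw [h2, Bilateral.X_mul]

/-- Multiplication by `F(z, w) ^ N` becomes a shift by `N` in the variable `z_i` after the product
with a delta series. -/
theorem mul_substLaurent_pow_mul (hxj : x ≠ j) (hw : ∀ m p, (w ^ m).val.coeff p ≠ 0 → m ≤ p)
    (hf : w.val = HahnSeries.ofPowerSeries ℤ R f) (hf0 : PowerSeries.constantCoeff f = 0)
    (s : Fin 2) (hE : F.IsDelta (![x, j] s) E)
    (hdvd : F.triple ∣ F.toPowerSeries.subst ![f.subst (X x : MvPowerSeries (Fin 3) R), X j] - X i)
    {Z : Bilateral (Fin 2) M} (hZ : LexBounded s Z) (N : ℕ) (e : Fin 3 → ℤ) :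
    mul E (ofVars x j (substLaurent w (mul (ofPowerSeries (F.toPowerSeries ^ N)) Z))) e =
      mul E (ofVars x j (substLaurent w Z)) (e - N • Pi.single i 1) := by
  obtain ⟨c, hc⟩ := hE.supp
  rw [← pair_lineKernel hxj hw s hE.supp (hZ.mul _), ← pair_lineKernel hxj hw s hE.supp hZ]
  exact pair_pow_mul (isKernel_lineKernel hw ⟨c, fun e he => (hc e he).2⟩ hf)
    (PowerSeries.constantCoeff_subst_eq_zero (constantCoeff_X x) _ hf0) (constantCoeff_X j)
    (sum_mul_lineKernel hw hE hdvd)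
    (hZ.pairConverges (upperBounded_lineKernel hxj hw s hE.supp)) N e

/-- After the product with a delta series, `F(u, z_j)` can be replaced by `z_i`. -/
theorem mul_substLaurent_substFst (hxj : x ≠ j) (hij : i ≠ j)
    (hw : ∀ m p, (w ^ m).val.coeff p ≠ 0 → m ≤ p)
    (hf : w.val = HahnSeries.ofPowerSeries ℤ R f) (hf0 : PowerSeries.constantCoeff f = 0)
    (hE : F.IsDelta j E)
    (hdvd : F.triple ∣ F.toPowerSeries.subst ![f.subst (X x : MvPowerSeries (Fin 3) R), X j] - X i)
    {Z : Bilateral (Fin 2) M} (hZ : LexBounded 1 Z) (e : Fin 3 → ℤ) :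
    mul E (ofVars x j (substLaurent w
        (substFst (fun m => ofIterated 0 1 (F.sumUnit ^ m).val) Z))) e =
      mul E (ofVars i j fun p q => Z ![p, q]) e := by
  obtain ⟨c, hc⟩ := hE.supp
  rw [← pair_lineKernel hxj hw 1 hE.supp (substFst_lexBounded F.isPowers_sumUnit hZ),
    pair_substFst (isKernel_lineKernel hw ⟨c, fun e he => (hc e he).2⟩ hf)
      (PowerSeries.constantCoeff_subst_eq_zero (constantCoeff_X x) _ hf0) (constantCoeff_X j)
      (sum_mul_lineKernel hw hE hdvd) (upperBounded_lineKernel hxj hw 1 hE.supp)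
      F.isPowers_sumUnit hZ, mul_ofVars hij]
  refine finsum_congr fun y => ?_
  rw [lineKernel_snd, plane, sub_sub]
  congr 2
  · congr 2
    rw [← Pi.single_smul]
    simp
  · funext t
    fin_cases t <;> rfl

end FormalGroup

/-! ### The series attached to a vertex `F`-algebra -/

namespace VertexOperator

open Bilateral FormalGroup

variable {R V : Type*} [CommRing R] [AddCommGroup V] [Module R V]

theorem exists_coeff_eq_zero (A : VertexOperator R V) (v : V) :
    ∃ c : ℤ, ∀ n, HVertexOperator.coeff A n v ≠ 0 → c ≤ n := by
  refine ⟨HahnSeries.order ((HahnModule.of R).symm (A v)), fun n hn => ?_⟩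
  by_contra h
  exact hn (coeff_eq_zero_of_lt_order A n v (not_le.1 h))

theorem exists_forall_coeff_eq_zero (A : ℤ → VertexOperator R V) (v : ℤ → V) (c C : ℤ) :
    ∃ b : ℤ, ∀ m, c ≤ m → m ≤ C → ∀ n, HVertexOperator.coeff (A m) n (v m) ≠ 0 → b ≤ n := by
  choose b hb using fun m => exists_coeff_eq_zero (A m) (v m)
  obtain ⟨b', hb'⟩ := ((Set.finite_Icc c C).image b).bddBelow
  exact ⟨b', fun m h1 h2 n hn => (hb' ⟨m, ⟨h1, h2⟩, rfl⟩).trans (hb m n hn)⟩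

theorem lexBounded_comp (A B : VertexOperator R V) (c : V) :
    LexBounded 1 (ofVars (0 : Fin 2) 1 (comp A B c)) := by
  have hz : ∀ z, ofVars (0 : Fin 2) 1 (comp A B c) z = comp A B c (z 0) (z 1) := fun z =>
    if_pos forall_fin_two_eq_zero
  obtain ⟨a, ha⟩ := exists_coeff_eq_zero B c
  have h1 : ∀ z : Fin 2 → ℤ, comp A B c (z 0) (z 1) ≠ 0 → a ≤ z 1 := fun z h =>
    ha _ fun h0 => h (by rw [comp, h0, map_zero])
  refine ⟨⟨a, fun z h => h1 z (by rwa [hz] at h)⟩, fun C => ?_⟩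
  obtain ⟨b, hb⟩ := exists_forall_coeff_eq_zero (fun _ => A)
    (fun q => HVertexOperator.coeff B q c) a C
  refine ⟨min a b, fun z h hC i => ?_⟩
  rw [hz] at h
  have h2 := h1 z h
  have h3 := hb (z 1) h2 hC (z 0) h
  fin_cases i <;> simp <;> omega

theorem lexBounded_nested (Y : V →ₗ[R] VertexOperator R V) (a b c : V) :
    LexBounded 0 (ofVars (0 : Fin 2) 1 (nested Y a b c)) := by
  have hz : ∀ z, ofVars (0 : Fin 2) 1 (nested Y a b c) z = nested Y a b c (z 0) (z 1) := fun z =>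
    if_pos forall_fin_two_eq_zero
  obtain ⟨d, hd⟩ := exists_coeff_eq_zero (Y a) b
  have h1 : ∀ z : Fin 2 → ℤ, nested Y a b c (z 0) (z 1) ≠ 0 → d ≤ z 0 := fun z h =>
    hd _ fun h0 => h (by rw [nested, h0, map_zero, map_zero]; rfl)
  refine ⟨⟨d, fun z h => h1 z (by rwa [hz] at h)⟩, fun C => ?_⟩
  obtain ⟨b', hb⟩ := exists_forall_coeff_eq_zero
    (fun p => Y (HVertexOperator.coeff (Y a) p b)) (fun _ => c) d C
  refine ⟨min d b', fun z h hC i => ?_⟩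
  rw [hz] at h
  have h2 := h1 z h
  have h3 := hb (z 0) h2 hC (z 1) h
  fin_cases i <;> simp <;> omega

variable (F : FormalGroup R)

/-- `i_{z,w} A(F(z, w)) B(w) c` is obtained from `A(v) B(w) c` by the substitution `v ↦ F(z, w)`. -/
theorem atSumComp_eq (A B : VertexOperator R V) (c : V) :
    atSumComp F A B c = substFst (fun m => ofIterated 0 1 (F.sumUnit ^ m).val)
      (ofVars (0 : Fin 2) 1 (comp A B c)) := by
  funext z
  have hz : ∀ y, ofVars (0 : Fin 2) 1 (comp A B c) y = comp A B c (y 0) (y 1) := fun y =>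
    if_pos forall_fin_two_eq_zero
  have hX := lexBounded_comp A B c
  obtain ⟨a, ha⟩ := hX.1
  obtain ⟨b, hb⟩ := hX.2 (z 1)
  have hfin : {y : Fin 2 → ℤ | ofIterated (0 : Fin 2) 1 (F.sumUnit ^ y 0).val
      (z - Pi.single 1 (y 1)) • ofVars (0 : Fin 2) 1 (comp A B c) y ≠ 0}.Finite := by
    refine (finite_box (min a b) (max (z 1) (z 0 + z 1 - a))).subset fun y hy => ?_
    have h1 := left_ne_zero_of_smul hy
    have h2 := right_ne_zero_of_smul hy
    rw [ofIterated_zero_one] at h1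
    have h3 := F.sumUnit_zpow_supp _ _ _ h1
    simp at h3
    have h4 := ha _ h2
    have h5 := hb _ h2 (by omega) 0
    intro i
    fin_cases i <;> simp <;> omega
  rw [atSumComp, Bilateral.subst, substFst, ← finsum_comp_equiv (finTwoArrowEquiv ℤ).symm,
    finsum_curry]
  · refine finsum_congr fun m => ?_
    rw [mul_ofVar]
    refine finsum_congr fun q => ?_
    rw [hz]
    rfl
  · exact hfin.preimage (finTwoArrowEquiv ℤ).symm.injective.injOn

end VertexOperator

namespace VertexFAlgebra

open Bilateral FormalGroup VertexOperator

variable {R V : Type*} [CommRing R] {F : FormalGroup R} [F.IsComm] [AddCommGroup V] [Module R V]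
  (A : VertexFAlgebra F V)

/-- Weak associativity, in terms of products with power series. -/
theorem exists_pow_mul_nested (a b c : V) : ∃ N : ℕ,
    mul (ofPowerSeries (F.toPowerSeries ^ N)) (ofVars (0 : Fin 2) 1 (nested A.Y a b c)) =
      mul (ofPowerSeries (F.toPowerSeries ^ N))
        (substFst (fun m => ofIterated 0 1 (F.sumUnit ^ m).val)
          (ofVars (0 : Fin 2) 1 (comp (A.Y a) (A.Y b) c))) := by
  obtain ⟨N, hN⟩ := A.associativity a b c
  refine ⟨N, ?_⟩
  rwa [ofIterated_pow (by decide) (show F.sumUnit.val = iterated F.toPowerSeries from rfl),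
    subst_X_zero_X_one, atSumComp_eq] at hN

/-- The coefficient of `w ^ n` in `Y(S(w) v, z) c = i_{z,w} Y(v, F(z, w)) c`. -/
theorem coeff_Y_shift (v c : V) (q : ℤ) (n : ℕ) :
    HVertexOperator.coeff (A.Y (A.shift n v)) q c =
      ∑ᶠ m : ℤ, ((F.sumUnit ^ m).val.coeff n).coeff q • HVertexOperator.coeff (A.Y v) m c := by
  have h := congrFun (A.translation v c) ![q, n]
  rw [ofVars, if_pos forall_fin_two_eq_zero] at h
  simp only [Matrix.cons_val_one, Matrix.cons_val_zero, Int.natCast_nonneg, if_true,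
    Int.toNat_natCast] at h
  rw [h, atSum, Bilateral.subst]
  refine finsum_congr fun m => ?_
  rw [mul_ofVars (by decide), finsum_eq_single _ 0]
  · rw [plane]
    simp [ofIterated_zero_one]
  · intro z hz
    rw [if_neg, smul_zero]
    rintro ⟨h0, h1⟩
    refine hz (funext fun s => ?_)
    fin_cases s
    · exact h0
    · exact h1

/-- `v ↦ Y(v, w) c`, on coefficients. -/
def coeffYHom (q : ℤ) (c : V) : V →ₗ[R] V where
  toFun v := HVertexOperator.coeff (A.Y v) q c
  map_add' u v := by rw [map_add, map_add]; rfl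
  map_smul' r v := by rw [map_smul, map_smul]; rfl

/-- Skew symmetry and translation express the iterate of `a` and `b` through that of `b` and `a`. -/
theorem nested_eq (a b c : V) (p q : ℤ) :
    nested A.Y a b c p q = ∑ᶠ n : ℤ, ∑ᶠ k : ℤ, (F.iotaUnit ^ k).val.coeff (p - n) •
      ∑ᶠ m : ℤ, ((F.sumUnit ^ m).val.coeff n).coeff q • nested A.Y b a c k m := by
  obtain ⟨d, hd⟩ := exists_coeff_eq_zero (A.Y b) a
  have hk : ∀ (n : ℕ) (k : ℤ), (F.iotaUnit ^ k).val.coeff (p - n) •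
      HVertexOperator.coeff (A.Y b) k a ≠ 0 → d ≤ k ∧ k ≤ p - n := fun n k h =>
    ⟨hd _ (right_ne_zero_of_smul h), F.iotaUnit_zpow_supp _ _ (left_ne_zero_of_smul h)⟩
  have hn : {n : ℕ | A.shift n (atIota F (A.Y b) a (p - n)) ≠ 0}.Finite := by
    refine (Set.finite_Iic (p - d).toNat).subset fun n h => ?_
    obtain ⟨k, h1⟩ : ∃ k : ℤ, (F.iotaUnit ^ k).val.coeff (p - n) •
        HVertexOperator.coeff (A.Y b) k a ≠ 0 := by
      by_contra! hc
      exact h (by rw [atIota, finsum_eq_zero_of_forall_eq_zero hc, map_zero])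
    have := hk n k h1
    simp only [Set.mem_Iic]
    omega
  change A.coeffYHom q c (HVertexOperator.coeff (A.Y a) p b) = _
  rw [A.skew, map_finsum _ hn,
    finsum_comp_of_support_subset_range (φ := fun n : ℕ => (n : ℤ)) Nat.cast_injective]
  · refine finsum_congr fun n => ?_
    rw [atIota, map_finsum _ ((Set.finite_Icc d (p - n)).subset fun k h => hk n k h),
      map_finsum _ ((Set.finite_Icc d (p - n)).subset fun k h => hk n k fun h0 => h (by
        simp only [h0, map_zero]))]
    refine finsum_congr fun k => ?_
    rw [map_smul, map_smul]
    congr 1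
    exact A.coeff_Y_shift _ c q n
  · intro n h
    by_contra h0
    refine h (finsum_eq_zero_of_forall_eq_zero fun k => ?_)
    rw [finsum_eq_zero_of_forall_eq_zero, smul_zero]
    intro m
    by_contra h1
    have := F.sumUnit_zpow_supp _ _ _ (left_ne_zero_of_smul h1)
    exact h0 ⟨n.toNat, by simp [this.1]⟩

end VertexFAlgebra

/-! ### Delta series and the axioms of a vertex `F`-algebra -/

namespace FormalGroup

open Bilateral

variable {R : Type*} [CommRing R] (F : FormalGroup R)

/-- The series `ι(z_0) ^ (z 0) * F(z_2, z_0) ^ (z 1)`. -/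
def skewKernel (z : Fin 2 → ℤ) : Bilateral (Fin 3) R :=
  mul (ofVar 0 (F.iotaUnit ^ z 0).val.coeff) (ofIterated 2 0 (F.sumUnit ^ z 1).val)

theorem skewKernel_apply (z : Fin 2 → ℤ) (e : Fin 3 → ℤ) :
    F.skewKernel z e = if e 1 = 0 then
      ∑ᶠ n : ℤ, (F.iotaUnit ^ z 0).val.coeff (e 0 - n) *
        ((F.sumUnit ^ z 1).val.coeff n).coeff (e 2) else 0 := by
  rw [skewKernel, ofVar_mul]
  split_ifs with h
  · rw [← finsum_comp_equiv (Equiv.subLeft (e 0))]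
    refine finsum_congr fun n => ?_
    rw [ofIterated, ofVars, if_pos]
    · simp
    · intro k h2 h0
      have : k = 1 := by omega
      subst this
      simp [h]
  · refine finsum_eq_zero_of_forall_eq_zero fun n => ?_
    rw [ofIterated, ofVars, if_neg, smul_zero]
    intro h'
    have := h' 1 (by decide) (by decide)
    simp at this
    exact h this

theorem skewKernel_supp {z : Fin 2 → ℤ} {e : Fin 3 → ℤ} (h : F.skewKernel z e ≠ 0) :
    e 1 = 0 ∧ z 0 ≤ e 0 ∧ z 0 + z 1 ≤ ∑ l, e l := by
  rw [skewKernel_apply] at h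
  split_ifs at h with h1
  · obtain ⟨n, hn⟩ : ∃ n : ℤ, (F.iotaUnit ^ z 0).val.coeff (e 0 - n) *
        ((F.sumUnit ^ z 1).val.coeff n).coeff (e 2) ≠ 0 := by
      by_contra! hc
      exact h (finsum_eq_zero_of_forall_eq_zero hc)
    have h2 := F.iotaUnit_zpow_supp _ _ (left_ne_zero_of_mul hn)
    have h3 := F.sumUnit_zpow_supp _ _ _ (right_ne_zero_of_mul hn)
    rw [Fin.sum_univ_three]
    omega
  · exact absurd rfl h

variable [F.IsComm]

/-- In the group of points, `z_0 + z_2` differs from `z_1` by `z_0 + z_2 - z_1`. -/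
theorem triple_dvd_sub_one :
    F.triple ∣ F.toPowerSeries.subst
      ![(PowerSeries.X : PowerSeries R).subst (X 0 : MvPowerSeries (Fin 3) R), X 2] - X 1 := by
  rw [PowerSeries.subst_X (PowerSeries.HasSubst.X 0)]
  have h := F.dvd_add_val_sub (F.pointX (0 : Fin 3) + F.pointX 2 - F.pointX 1) (F.pointX 1)
  rwa [sub_add_cancel] at h

theorem triple_dvd_sub_one' :
    F.triple ∣ F.toPowerSeries.subst
      ![(PowerSeries.X : PowerSeries R).subst (X 2 : MvPowerSeries (Fin 3) R), X 0] - X 1 := by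
  rw [PowerSeries.subst_X (PowerSeries.HasSubst.X 2)]
  have h := F.dvd_add_val_sub (F.pointX (0 : Fin 3) + F.pointX 2 - F.pointX 1) (F.pointX 1)
  rw [show F.pointX (0 : Fin 3) + F.pointX 2 - F.pointX 1 + F.pointX 1 =
    F.pointX 2 + F.pointX 0 by abel] at h
  exact h

/-- In the group of points, `-z_0 + z_1` differs from `z_2` by `-(z_0 + z_2 - z_1)`. -/
theorem triple_dvd_sub_two :
    F.triple ∣ F.toPowerSeries.subst
      ![F.iota.subst (X 0 : MvPowerSeries (Fin 3) R), X 1] - X 2 := by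
  have h := F.dvd_add_val_sub (F.pointX (0 : Fin 3) + F.pointX 2 - F.pointX 1)
    (-F.pointX 0 + F.pointX 1)
  rw [dvd_sub_comm, show F.pointX (0 : Fin 3) + F.pointX 2 - F.pointX 1 +
    (-F.pointX 0 + F.pointX 1) = F.pointX 2 by abel] at h
  exact h

variable {F}

theorem IsDelta.degreeBounded {k : Fin 3} {E : Bilateral (Fin 3) R} (hE : F.IsDelta k E) :
    DegreeBounded E := by
  obtain ⟨c, hc⟩ := hE.supp
  exact ⟨c, fun e he => (hc e he).2⟩

theorem IsDelta.ofVar_mul {k : Fin 3} {E : Bilateral (Fin 3) R} (hE : F.IsDelta k E) {g : ℤ → R}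
    {m : ℤ} (hg : ∀ n, g n ≠ 0 → m ≤ n) : F.IsDelta k (mul (ofVar k g) E) where
  mul_eq_zero := by
    rw [(degreeProper_ofPowerSeries _).mul_left_comm (degreeProper_ofVar k hg) hE.degreeBounded,
      hE.mul_eq_zero]
    funext e
    simp [mul]
  supp := by
    obtain ⟨c, hc⟩ := hE.supp
    refine ⟨c + m, fun e he => ?_⟩
    obtain ⟨d, h1, h2⟩ := exists_of_mul_ne_zero he
    obtain ⟨n, rfl⟩ := mem_range_single h1
    rw [ofVar_single] at h1
    have h1 := hg n h1
    have h2 := hc _ h2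
    simp at h2
    omega

/-- In the product with a delta series, `F(z_2, z_0)` can be replaced by `z_1`. -/
theorem IsDelta.mul_sumUnit_zpow {E : Bilateral (Fin 3) R} (hE : F.IsDelta 0 E) (m : ℤ)
    (e : Fin 3 → ℤ) :
    mul E (ofIterated 2 0 (F.sumUnit ^ m).val) e = E (e - Pi.single 1 m) := by
  have hκ := isKernel_lineKernel (x := 2) (j := 0) (w := varUnit R) varUnit_zpow_supp
    hE.degreeBounded (HahnSeries.ofPowerSeries_X).symm
  have h := pair_powers hκ (PowerSeries.constantCoeff_subst_eq_zero (constantCoeff_X _) _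
      PowerSeries.constantCoeff_X) (constantCoeff_X _)
    (sum_mul_lineKernel varUnit_zpow_supp hE F.triple_dvd_sub_one')
    (upperBounded_lineKernel (by decide) varUnit_zpow_supp 1 hE.supp) F.isPowers_sumUnit m e
  rw [pair_lineKernel (by decide) varUnit_zpow_supp 1 hE.supp (F.isPowers_sumUnit.lexBounded m)]
    at h
  have h0 : (0 : Fin 2 → ℤ) = Pi.single 1 0 := by simp
  rw [h0, lineKernel_snd] at h
  have h1 : ofVars (2 : Fin 3) 0 (substLaurent (varUnit R)
      (ofIterated (0 : Fin 2) 1 (F.sumUnit ^ m).val)) = ofIterated 2 0 (F.sumUnit ^ m).val := by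
    refine congrArg (ofVars 2 0) (funext fun p => funext fun q => ?_)
    rw [substLaurent_varUnit]
    exact ofIterated_zero_one _ _
  rw [h1] at h
  rw [h, ← Pi.single_smul]
  simp

end FormalGroup

namespace VertexFAlgebra

open Bilateral FormalGroup VertexOperator

variable {R V : Type*} [CommRing R] {F : FormalGroup R} [F.IsComm] [AddCommGroup V] [Module R V]
  (A : VertexFAlgebra F V)

/-- `Y(Y(a, z_0) b, z_2) c` is obtained from `Y(Y(b, x) a, y) c` by the substitutions
`x ↦ ι(z_0)` and `y ↦ F(z_2, z_0)`. -/
theorem nested_eq_finsum_skewKernel (a b c : V) (e : Fin 3 → ℤ) :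
    ofVars 0 2 (nested A.Y a b c) e =
      ∑ᶠ z : Fin 2 → ℤ, F.skewKernel z e • nested A.Y b a c (z 0) (z 1) := by
  by_cases he : e 1 = 0
  · have he' : ∀ k, k ≠ 0 → k ≠ 2 → e k = 0 := fun k h0 h2 => by
      have : k = 1 := by omega
      rw [this, he]
    obtain ⟨⟨d, hd⟩, hB⟩ := lexBounded_nested A.Y b a c
    have hz : ∀ z, ofVars (0 : Fin 2) 1 (nested A.Y b a c) z = nested A.Y b a c (z 0) (z 1) :=
      fun z => if_pos forall_fin_two_eq_zero
    simp only [hz] at hd hB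
    obtain ⟨B, hB⟩ := hB (e 0)
    let K : ℤ × ℤ → (Fin 2 → ℤ) → R := fun x z =>
      if z 0 = x.2 then ((F.sumUnit ^ z 1).val.coeff x.1).coeff (e 2) else 0
    have hK : ∀ n k : ℤ, (∑ᶠ m : ℤ, ((F.sumUnit ^ m).val.coeff n).coeff (e 2) •
        nested A.Y b a c k m) = ∑ᶠ z, K (n, k) z • nested A.Y b a c (z 0) (z 1) := by
      intro n k
      rw [finsum_comp_of_support_subset_range (φ := fun m : ℤ => ![k, m])]
      · simp [K]
      · intro m n h
        simpa using congrFun h 1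
      · intro z hz
        have h1 : z 0 = k := by
          by_contra h
          exact left_ne_zero_of_smul hz (if_neg h)
        refine ⟨z 1, ?_⟩
        funext t
        fin_cases t
        · exact h1.symm
        · rfl
    have hsupp : ∀ (x : ℤ × ℤ) (z : Fin 2 → ℤ), (F.iotaUnit ^ x.2).val.coeff (e 0 - x.1) ≠ 0 →
        K x z ≠ 0 → nested A.Y b a c (z 0) (z 1) ≠ 0 →
        (0 ≤ x.1 ∧ x.1 ≤ e 0 - d) ∧ (d ≤ x.2 ∧ x.2 ≤ e 0) ∧ z 0 = x.2 ∧ B ≤ z 1 ∧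
          z 1 ≤ e 2 + (e 0 - d) := by
      intro x z h1 h2 h3
      have h4 := F.iotaUnit_zpow_supp _ _ h1
      have h5 : z 0 = x.2 := by
        by_contra h
        exact h2 (if_neg h)
      simp only [K, if_pos h5] at h2
      have h6 := F.sumUnit_zpow_supp _ _ _ h2
      have h7 := hd _ h3
      have h8 := hB _ h3 (by omega) 1
      omega
    rw [ofVars, if_pos he', nested_eq]
    simp only [hK]
    rw [← finsum_curry (fun x : ℤ × ℤ => (F.iotaUnit ^ x.2).val.coeff (e 0 - x.1) •
      ∑ᶠ z, K x z • nested A.Y b a c (z 0) (z 1)), finsum_smul_finsum_smul]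
    · refine finsum_congr fun z => ?_
      rw [skewKernel_apply, if_pos he]
      congr 1
      rw [finsum_comp_of_support_subset_range (φ := fun n : ℤ => (n, z 0))]
      · simp [K]
      · intro m n h
        exact congrArg Prod.fst h
      · intro x hx
        have h1 : z 0 = x.2 := by
          by_contra h
          exact right_ne_zero_of_mul hx (if_neg h)
        exact ⟨x.1, Prod.ext rfl h1⟩
    · refine (((Set.finite_Icc 0 (e 0 - d)).prod (Set.finite_Icc d (e 0))).prod
        (finite_box (min d B) (max (e 0) (e 2 + (e 0 - d))))).subset fun p hp => ?_
      obtain ⟨h1, h2, h3, h4, h5⟩ := hsupp p.1 p.2 hp.1 hp.2.1 hp.2.2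
      refine ⟨⟨h1, h2⟩, fun i => ?_⟩
      fin_cases i <;> simp <;> omega
    · refine ((Set.finite_Icc 0 (e 0 - d)).prod (Set.finite_Icc d (e 0))).subset fun x hx => ?_
      obtain ⟨z, h⟩ : ∃ z, K x z • nested A.Y b a c (z 0) (z 1) ≠ 0 := by
        by_contra! hc
        exact right_ne_zero_of_smul hx (finsum_eq_zero_of_forall_eq_zero hc)
      obtain ⟨h1, h2, -⟩ := hsupp x z (left_ne_zero_of_smul hx) (left_ne_zero_of_smul h)
        (right_ne_zero_of_smul h)
      exact ⟨h1, h2⟩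
  · rw [ofVars, if_neg fun h => he (h 1 (by decide) (by decide)), finsum_eq_zero_of_forall_eq_zero]
    intro z
    rw [skewKernel_apply, if_neg he, zero_smul]

/-- In the product with a delta series, the factor `F(z_2, z_0)` of `skewKernel` can be
replaced by `z_1`. -/
theorem mul_skewKernel {E : Bilateral (Fin 3) R} (hE : F.IsDelta 0 E) (z : Fin 2 → ℤ) :
    mul E (F.skewKernel z) = lineKernel 0 1 F.iotaUnit E z := by
  have hι := F.iotaUnit_zpow_supp (z 0)
  obtain ⟨c, hc⟩ := hE.supp
  funext e
  rw [skewKernel, ← mul_assoc', Bilateral.mul_comm' E, (hE.ofVar_mul hι).mul_sumUnit_zpow,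
    lineKernel]
  intro e
  have hfin := finite_cone (i := 0) (j := 1) (by decide) (min (min c (z 0)) (min 0 (e 1)))
    (|e 0| + |e 1| + |∑ l, e l| + |c| + |z 0| + |z 1|)
  refine (hfin.prod hfin).subset fun p hp => ?_
  have h1 := hc _ hp.1
  have h2 := hp.2.1
  obtain ⟨n, hn⟩ := mem_range_single h2
  rw [← hn, ofVar_single] at h2
  have h2 := hι n h2
  have h3 := hp.2.2
  rw [ofIterated, ofVars] at h3
  split_ifs at h3 with h4
  · have h4 := h4 1 (by decide) (by decide)
    have h5 := F.sumUnit_zpow_supp _ _ _ h3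
    have hn0 := congrFun hn 0
    have hn1 := congrFun hn 1
    have hn2 := congrFun hn 2
    simp at hn0 hn1 hn2 h4 h5
    have := le_abs_self (e 0)
    have := le_abs_self (e 1)
    have := neg_abs_le (e 1)
    have := le_abs_self (∑ l, e l)
    have := neg_abs_le c
    have := neg_abs_le (z 0)
    have := le_abs_self (z 0)
    have := neg_abs_le (z 1)
    have := abs_nonneg (e 0)
    have := abs_nonneg (∑ l, e l)
    have := abs_nonneg (z 1)
    have := abs_nonneg c
    have hs : ∑ l, e l = e 0 + e 1 + e 2 := Fin.sum_univ_three _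
    have hs1 : ∑ l, p.1 l = p.1 0 + p.1 1 + p.1 2 := Fin.sum_univ_three _
    have hs2 : ∑ l, p.2 l = p.2 0 + p.2 1 + p.2 2 := Fin.sum_univ_three _
    exact ⟨⟨by omega, by omega, by omega, by omega⟩, by omega, by omega, by omega, by omega⟩
  · exact absurd rfl h3

/-- In the product with a delta series, `Y(Y(a, z_0) b, z_2) c` can be replaced by
`Y(Y(b, ι z_0) a, z_1) c`. -/
theorem mul_nested_skew {E : Bilateral (Fin 3) R} (hE : F.IsDelta 0 E) (a b c : V) :
    mul E (ofVars 0 2 (nested A.Y a b c)) =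
      mul E (ofVars 0 1 (substLaurent F.iotaUnit
        (ofVars (0 : Fin 2) 1 (nested A.Y b a c)))) := by
  have hL := lexBounded_nested A.Y b a c
  rw [← pair_lineKernel (by decide) F.iotaUnit_zpow_supp 0 hE.supp hL]
  obtain ⟨m, hm⟩ := hE.supp
  obtain ⟨⟨d, hd⟩, hB⟩ := hL
  have hz : ∀ z, ofVars (0 : Fin 2) 1 (nested A.Y b a c) z = nested A.Y b a c (z 0) (z 1) :=
    fun z => if_pos forall_fin_two_eq_zero
  funext e
  obtain ⟨B, hB⟩ := hB (e 0 - m)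
  rw [mul, pair]
  simp only [nested_eq_finsum_skewKernel, ← hz]
  have hcomm := finsum_smul_finsum_smul (a := E) (K := fun x z => F.skewKernel z (e - x))
    (g := ofVars (0 : Fin 2) 1 (nested A.Y b a c)) ?_
  · refine hcomm.trans (finsum_congr fun z => ?_)
    rw [← mul_skewKernel hE]
    rfl
  · have hfin := finite_cone (i := 0) (j := 1) (by decide) (min m (e 1))
      (max (max (e 0 - d) (e 1)) (∑ l, e l - d - B))
    refine (hfin.prod (finite_box (τ := Fin 2) (min d B)
      (max (e 0 - m) (∑ l, e l - m - d)))).subset fun p hp => ?_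
    have h1 := hm _ hp.1
    have h2 := F.skewKernel_supp hp.2.1
    simp only [Pi.sub_apply, Finset.sum_sub_distrib] at h2
    have h3 := hd _ hp.2.2
    have h4 := hB _ hp.2.2 (by omega) 1
    refine ⟨⟨⟨by omega, by omega, by omega⟩, by omega, by omega, by omega⟩, fun i => ?_⟩
    fin_cases i <;> simp <;> omega

end VertexFAlgebra

/-! ### The Jacobi identity -/

namespace FormalGroup

open Bilateral

variable {R M : Type*} [CommRing R] [AddCommGroup M] [Module R M] {F : FormalGroup R} [F.IsComm]

theorem IsDelta.mulConverges {i j : Fin 3} (hij : i ≠ j) (s : Fin 2) {E : Bilateral (Fin 3) R}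
    (hE : F.IsDelta (![i, j] s) E) {g : ℤ → ℤ → M} (hg : LexBounded s (ofVars (0 : Fin 2) 1 g)) :
    MulConverges E (ofVars i j g) := .of_finite fun e => by
  obtain ⟨c, hc⟩ := hE.supp
  obtain ⟨b, b', hb⟩ := hg.exists_box (max (e (![i, j] s) - c) (∑ l, e l - c))
  refine ((finite_box (τ := Fin 2) b b').image fun z => e - plane i j z).subset fun d hd => ?_
  obtain ⟨z, hz⟩ := mem_range_plane hij hd.2
  have hd1 : d = e - plane i j z := by rw [hz, sub_sub_cancel]
  refine ⟨z, ?_, hd1.symm⟩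
  have h1 := hc d hd.1
  have h2 := hd.2
  rw [← hz, ofVars_plane hij] at h2
  have h3 : ofVars (0 : Fin 2) 1 g z ≠ 0 := by
    rwa [ofVars, if_pos forall_fin_two_eq_zero]
  rw [hd1] at h1
  simp only [Pi.sub_apply, Finset.sum_sub_distrib] at h1
  have h4 : ∑ l, plane i j z l = z 0 + z 1 := by
    simp [plane, Finset.sum_add_distrib]
  have h5 : plane i j z (![i, j] s) = z s := by
    fin_cases s
    · exact plane_apply_fst hij z
    · exact plane_apply_snd hij z
  exact fun l => (hb z z (by omega) (by omega) (fun _ => le_rfl) h3 l).1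

/-- A series with exponents bounded below that is annihilated by one of the delta series is a
multiple of `F(F(z_0, z_2), ι z_1)`, hence it is annihilated by the other delta series. -/
theorem deltaExpSwap_mul_eq_zero {P : Bilateral (Fin 3) M}
    (hP : ∃ c : ℤ, ∀ e, P e ≠ 0 → ∀ l, c ≤ e l) (h : mul (F.deltaExp (1 : Fin 3) 0 2) P = 0) :
    mul (F.deltaExpSwap (1 : Fin 3) 2 0) P = 0 := by
  have hcone : ∀ {Q : Bilateral (Fin 3) M}, (∃ c : ℤ, ∀ e, Q e ≠ 0 → ∀ l, c ≤ e l) →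
      ∀ i j, ConeBounded i j Q := by
    rintro Q ⟨c, hc⟩ i j
    refine ⟨min c (3 * c), fun e he => ?_⟩
    have h0 := hc e he 0
    have h1 := hc e he 1
    have h2 := hc e he 2
    have hi := hc e he i
    have hj := hc e he j
    rw [Fin.sum_univ_three]
    omega
  have h₀ : ConeBounded 1 2 F.inv₀ := ⟨-1, fun _ => F.inv₀_supp⟩
  have h₁ : ConeBounded 0 2 F.inv₁ := ⟨-1, fun _ => F.inv₁_supp⟩
  have h₂ : ConeBounded 0 1 F.inv₂ := ⟨-1, fun _ => F.inv₂_supp⟩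
  have hPc := hcone hP
  rw [deltaExp_one_zero_two, sub_mul' (h₂.mulConverges (by decide) (hPc 0 1))
    (h₁.mulConverges (by decide) (hPc 0 2)), sub_eq_zero] at h
  -- the common value of the two products has exponents bounded below in every variable
  have hQ : ∃ c : ℤ, ∀ e, mul F.inv₁ P e ≠ 0 → ∀ l, c ≤ e l := by
    obtain ⟨a, ha⟩ := h₁.mul (hPc 0 2)
    obtain ⟨b, hb⟩ := h₂.mul (hPc 0 1)
    refine ⟨min a b, fun e he l => ?_⟩
    have h3 := ha e he
    have h4 := hb e (by rwa [h])
    fin_cases l <;> simp <;> omega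
  have hT : mul (ofPowerSeries F.triple) (mul F.inv₁ P) = P := by
    rw [← (coneBounded_ofPowerSeries F.triple).mul_assoc (by decide) h₁ (hPc 0 2),
      triple_mul_inv₁, one_mul']
  have hA : mul F.inv₀ P = mul F.inv₁ P := by
    conv_lhs => rw [← hT]
    rw [← h₀.mul_assoc (by decide) (coneBounded_ofPowerSeries F.triple) (hcone hQ 1 2),
      Bilateral.mul_comm', triple_mul_inv₀, one_mul']
  rw [deltaExpSwap_one_two_zero, sub_mul' (h₀.mulConverges (by decide) (hPc 1 2))
    (h₂.mulConverges (by decide) (hPc 0 1)), hA, h, sub_self]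

/-- The substitution `u ↦ w(x)` preserves series with exponents bounded below. -/
theorem substLaurent_bounded {x j : Fin 3} {w : (LaurentSeries R)ˣ}
    (hw : ∀ m p, (w ^ m).val.coeff p ≠ 0 → m ≤ p) {K : Bilateral (Fin 2) M}
    (h0 : LexBounded 0 K) (h1 : LexBounded 1 K) :
    ∃ c : ℤ, ∀ e, ofVars x j (substLaurent w K) e ≠ 0 → ∀ l, c ≤ e l := by
  obtain ⟨⟨a, ha⟩, -⟩ := h0
  obtain ⟨⟨b, hb⟩, -⟩ := h1
  refine ⟨min 0 (min a b), fun e he l => ?_⟩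
  rw [ofVars] at he
  split_ifs at he with h
  · obtain ⟨m, hm⟩ : ∃ m, (w ^ m).val.coeff (e x) • K ![m, e j] ≠ 0 := by
      by_contra! hc
      exact he (finsum_eq_zero_of_forall_eq_zero hc)
    have h2 := ha _ (right_ne_zero_of_smul hm)
    have h3 := hb _ (right_ne_zero_of_smul hm)
    have h4 := hw _ _ (left_ne_zero_of_smul hm)
    simp at h2 h3
    by_cases hx : l = x
    · subst hx; omega
    by_cases hj : l = j
    · subst hj; omega
    have := h l hx hj
    omega
  · exact absurd rfl he

theorem ofVars_substLaurent_varUnit (i j : Fin 3) (g : ℤ → ℤ → M) :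
    ofVars i j (substLaurent (varUnit R) (ofVars (0 : Fin 2) 1 g)) = ofVars i j g := by
  refine congrArg (ofVars i j) (funext fun p => funext fun q => ?_)
  rw [substLaurent_varUnit, ofVars, if_pos forall_fin_two_eq_zero]
  rfl

end FormalGroup

namespace VertexFAlgebra

open Bilateral FormalGroup VertexOperator

variable {R V : Type*} [CommRing R] {F : FormalGroup R} [F.IsComm] [AddCommGroup V] [Module R V]
  (A : VertexFAlgebra F V)

theorem ofVars_comp_eq (i j : Fin 3) (B C : VertexOperator R V) (c : V) :
    (ofVars i j fun p q => ofVars (0 : Fin 2) 1 (comp B C c) ![p, q]) =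
      ofVars i j (comp B C c) := by
  refine congrArg (ofVars i j) (funext fun p => funext fun q => ?_)
  rw [ofVars, if_pos forall_fin_two_eq_zero]
  rfl

/-- The Jacobi identity. All three products are rewritten as products of delta series with the
series `K` and `K'`, whose exponents are bounded below; the remaining relation between `K` and
`K'` is `deltaExpSwap_mul_eq_zero`. -/
theorem jacobi (a b c : V) :
    mul (F.deltaExp (1 : Fin 3) 0 2) (ofVars 0 2 (nested A.Y a b c)) =
      mul (F.deltaExp (1 : Fin 3) 2 0) (ofVars 1 2 (comp (A.Y a) (A.Y b) c)) -
      mul (F.deltaExpSwap (1 : Fin 3) 2 0) (ofVars 2 1 (comp (A.Y b) (A.Y a) c)) := by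
  have hX : PowerSeries.constantCoeff (PowerSeries.X : PowerSeries R) = 0 :=
    PowerSeries.constantCoeff_X
  have hwX : (varUnit R).val = HahnSeries.ofPowerSeries ℤ R PowerSeries.X :=
    HahnSeries.ofPowerSeries_X.symm
  have hv := varUnit_zpow_supp (R := R)
  have hι := F.iotaUnit_zpow_supp
  have hD := F.isDelta_deltaExp_one_zero_two
  have h12 := F.isDelta_deltaExp_one_two_zero
  have h21 := F.isDelta_deltaExpSwap_one_two_zero
  obtain ⟨N, hN⟩ := A.exists_pow_mul_nested a b c
  obtain ⟨N', hN'⟩ := A.exists_pow_mul_nested b a c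
  have hZ := lexBounded_nested A.Y a b c
  have hZ' := lexBounded_nested A.Y b a c
  have hC := lexBounded_comp (A.Y a) (A.Y b) c
  have hC' := lexBounded_comp (A.Y b) (A.Y a) c
  have hS := substFst_lexBounded F.isPowers_sumUnit hC
  have hS' := substFst_lexBounded F.isPowers_sumUnit hC'
  set K := mul (ofPowerSeries (F.toPowerSeries ^ N)) (ofVars (0 : Fin 2) 1 (nested A.Y a b c))
    with hK
  set K' := mul (ofPowerSeries (F.toPowerSeries ^ N')) (ofVars (0 : Fin 2) 1 (nested A.Y b a c))
    with hK'
  -- `K` and `K'` have exponents bounded below in both variables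
  have hK0 : LexBounded 0 K := hZ.mul _
  have hK0' : LexBounded 0 K' := hZ'.mul _
  have hK1 : LexBounded 1 K := by rw [hN]; exact hS.mul _
  have hK1' : LexBounded 1 K' := by rw [hN']; exact hS'.mul _
  -- the three terms of the identity, up to shifts, in terms of `K` and `K'`
  have e1 : ∀ e, mul (F.deltaExp (1 : Fin 3) 2 0) (ofVars 0 2 (substLaurent (varUnit R) K)) e =
      mul (F.deltaExp (1 : Fin 3) 2 0) (ofVars 1 2 (comp (A.Y a) (A.Y b) c))
        (e - N • Pi.single 1 1) := by
    intro e
    rw [hN, mul_substLaurent_pow_mul (by decide) hv hwX hX 1 h12 F.triple_dvd_sub_one hS,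
      mul_substLaurent_substFst (by decide) (by decide) hv hwX hX h12 F.triple_dvd_sub_one hC,
      ofVars_comp_eq]
  have e2 : ∀ e, mul (F.deltaExp (1 : Fin 3) 0 2) (ofVars 0 2 (substLaurent (varUnit R) K)) e =
      mul (F.deltaExp (1 : Fin 3) 0 2) (ofVars 0 2 (nested A.Y a b c))
        (e - N • Pi.single 1 1) := by
    intro e
    rw [mul_substLaurent_pow_mul (by decide) hv hwX hX 0 hD F.triple_dvd_sub_one hZ,
      ofVars_substLaurent_varUnit]
  have e3 : ∀ e, mul (F.deltaExpSwap (1 : Fin 3) 2 0) (ofVars 0 1 (substLaurent F.iotaUnit K')) e =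
      mul (F.deltaExpSwap (1 : Fin 3) 2 0) (ofVars 2 1 (comp (A.Y b) (A.Y a) c))
        (e - N' • Pi.single 2 1) := by
    intro e
    rw [hN', mul_substLaurent_pow_mul (by decide) hι rfl F.constantCoeff_iota 1 h21
        F.triple_dvd_sub_two hS',
      mul_substLaurent_substFst (by decide) (by decide) hι rfl F.constantCoeff_iota h21
        F.triple_dvd_sub_two hC', ofVars_comp_eq]
  have e4 : ∀ e, mul (F.deltaExp (1 : Fin 3) 0 2) (ofVars 0 1 (substLaurent F.iotaUnit K')) e =
      mul (F.deltaExp (1 : Fin 3) 0 2) (ofVars 0 2 (nested A.Y a b c))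
        (e - N' • Pi.single 2 1) := by
    intro e
    rw [mul_substLaurent_pow_mul (by decide) hι rfl F.constantCoeff_iota 0 hD
      F.triple_dvd_sub_two hZ', A.mul_nested_skew hD]
  have hB := substLaurent_bounded (x := 0) (j := 2) hv hK0 hK1
  have hB' := substLaurent_bounded (x := 0) (j := 1) hι hK0' hK1'
  set L := ofVars (0 : Fin 3) 2 (substLaurent (varUnit R) K)
  set L' := ofVars (0 : Fin 3) 1 (substLaurent F.iotaUnit K')
  set d : Fin 3 → ℤ := N • Pi.single 1 1 with hd
  set d' : Fin 3 → ℤ := N' • Pi.single 2 1 with hd'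
  have hd0 : ∀ l, 0 ≤ d l := fun l => by
    fin_cases l <;> simp [hd]
  have hd0' : ∀ l, 0 ≤ d' l := fun l => by
    fin_cases l <;> simp [hd']
  have hshift : ∀ {Q : Bilateral (Fin 3) V}, (∃ c : ℤ, ∀ e, Q e ≠ 0 → ∀ l, c ≤ e l) →
      ∀ {d : Fin 3 → ℤ}, (∀ l, 0 ≤ d l) → ∃ c : ℤ, ∀ e, Q (e - d) ≠ 0 → ∀ l, c ≤ e l := by
    rintro Q ⟨c, hc⟩ d hd
    refine ⟨c, fun e he l => ?_⟩
    have := hc _ he l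
    have := hd l
    simp only [Pi.sub_apply] at *
    omega
  have hconv : ∀ {k : Fin 3} {E : Bilateral (Fin 3) R} {Q : Bilateral (Fin 3) V},
      F.IsDelta k E → (∃ c : ℤ, ∀ e, Q e ≠ 0 → ∀ l, c ≤ e l) → MulConverges E Q := by
    rintro k E Q hE ⟨c, hc⟩
    obtain ⟨b, hb⟩ := hE.supp
    refine .of_finite fun e => ?_
    refine (finite_box (τ := Fin 3) (b - |e 0 - c| - |e 1 - c| - |e 2 - c|)
      (|e 0 - c| + |e 1 - c| + |e 2 - c|)).subset fun x hx => ?_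
    have h1 := (hb x hx.1).2
    have h20 := hc _ hx.2 0
    have h21 := hc _ hx.2 1
    have h22 := hc _ hx.2 2
    rw [Fin.sum_univ_three] at h1
    simp only [Pi.sub_apply] at h20 h21 h22
    have := le_abs_self (e 0 - c)
    have := le_abs_self (e 1 - c)
    have := le_abs_self (e 2 - c)
    have := abs_nonneg (e 0 - c)
    have := abs_nonneg (e 1 - c)
    have := abs_nonneg (e 2 - c)
    intro l
    fin_cases l <;> simp <;> omega
  -- by `e2` and `e4`, the shifts turn both terms into the same product with the delta series in
  -- `z_2`, so that it annihilates their difference `P`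
  let P : Bilateral (Fin 3) V := (fun e => L (e - d')) - fun e => L' (e - d)
  have hP : ∃ c : ℤ, ∀ e, P e ≠ 0 → ∀ l, c ≤ e l := by
    obtain ⟨x, hx⟩ := hshift hB hd0'
    obtain ⟨y, hy⟩ := hshift hB' hd0
    refine ⟨min x y, fun e he l => ?_⟩
    by_cases h0 : L (e - d') = 0
    · have := hy e (fun h1 => he (by simp only [P, Pi.sub_apply, h0, h1, sub_zero])) l
      omega
    · have := hx e h0 l
      omega
  have hmulP : ∀ {k : Fin 3} {E : Bilateral (Fin 3) R}, F.IsDelta k E → ∀ e,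
      mul E P e = mul E L (e - d') - mul E L' (e - d) := by
    intro k E hE e
    rw [mul_sub' (hconv hE (hshift hB hd0')) (hconv hE (hshift hB' hd0)), Pi.sub_apply, mul_shift,
      mul_shift]
  have hDP : mul (F.deltaExp (1 : Fin 3) 0 2) P = 0 := by
    funext e
    rw [hmulP hD, e2, e4, sub_right_comm e, sub_self]
    rfl
  have h21P := deltaExpSwap_mul_eq_zero hP hDP
  have hsum : F.deltaExp (1 : Fin 3) 0 2 =
      F.deltaExp (1 : Fin 3) 2 0 - F.deltaExpSwap (1 : Fin 3) 2 0 := by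
    rw [deltaExp_one_zero_two, deltaExp_one_two_zero, deltaExpSwap_one_two_zero]
    abel
  funext e
  have h := congrFun h21P (e + d + d')
  rw [hmulP h21, e3, Pi.zero_apply, sub_eq_zero, add_sub_cancel_right] at h
  have h' := e2 (e + d)
  rw [add_sub_cancel_right] at h'
  have h1 := e1 (e + d)
  rw [add_sub_cancel_right] at h1
  rw [Pi.sub_apply, ← h', ← h1, hsum, sub_mul' (hconv h12 hB) (hconv h21 hB), Pi.sub_apply, h]
  congr 2
  abel

end VertexFAlgebra

end

theorem mainTheorem3 {R : Type*} [CommRing R] (F : FormalGroup R) [F.IsComm]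
    {V : Type*} [AddCommGroup V] [Module R V] (A : VertexFAlgebra F V) (a b c : V) :
    -- all substitutions converge; the variables are `z_0, z_1, z_2`, indexed by `Fin 3`
    Bilateral.SubstConverges (1 : Fin 3) 0 F.diffUnit (F.deltaIn 2) ∧
    Bilateral.SubstConverges (1 : Fin 3) 2 F.diffUnit (F.deltaIn 0) ∧
    Bilateral.SubstConverges (2 : Fin 3) 1 F.diffSwapUnit (F.deltaIn 0) ∧
    -- all products converge
    Bilateral.MulConverges (F.deltaExp (1 : Fin 3) 0 2)
      (Bilateral.ofVars 0 2 (VertexOperator.nested A.Y a b c)) ∧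
    Bilateral.MulConverges (F.deltaExp (1 : Fin 3) 2 0)
      (Bilateral.ofVars 1 2 (VertexOperator.comp (A.Y a) (A.Y b) c)) ∧
    Bilateral.MulConverges (F.deltaExpSwap (1 : Fin 3) 2 0)
      (Bilateral.ofVars 2 1 (VertexOperator.comp (A.Y b) (A.Y a) c)) ∧
    -- the Jacobi identity
    Bilateral.mul (F.deltaExp (1 : Fin 3) 0 2)
        (Bilateral.ofVars 0 2 (VertexOperator.nested A.Y a b c)) =
      Bilateral.mul (F.deltaExp (1 : Fin 3) 2 0)
        (Bilateral.ofVars 1 2 (VertexOperator.comp (A.Y a) (A.Y b) c)) -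
      Bilateral.mul (F.deltaExpSwap (1 : Fin 3) 2 0)
        (Bilateral.ofVars 2 1 (VertexOperator.comp (A.Y b) (A.Y a) c)) :=
  ⟨F.substConverges (by decide) (by decide) (by decide) F.diffUnit_zpow_supp,
    F.substConverges (by decide) (by decide) (by decide) F.diffUnit_zpow_supp,
    F.substConverges (by decide) (by decide) (by decide) F.diffSwapUnit_zpow_supp,
    F.isDelta_deltaExp_one_zero_two.mulConverges (by decide) 0
      (VertexOperator.lexBounded_nested A.Y a b c),
    F.isDelta_deltaExp_one_two_zero.mulConverges (i := 1) (j := 2) (by decide) 1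
      (VertexOperator.lexBounded_comp (A.Y a) (A.Y b) c),
    F.isDelta_deltaExpSwap_one_two_zero.mulConverges (i := 2) (j := 1) (by decide) 1
      (VertexOperator.lexBounded_comp (A.Y b) (A.Y a) c),
    A.jacobi a b c⟩
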